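/- Let $\Gamma$ be the infinite chain of rings of circumference $2\pi$ indexed by $j\in\mathbb{Z}$, in which rings $j-1$ and $j$ touch at the vertex $j$, so that each ring consists of an upper and a lower semicircle of length $\pi$ joining vertex $j$ to vertex $j+1$, both parametrized from left to right. For $A\in\mathbb{R}$ let $\mathcal{D}=\frac{d}{dx}+iA$ on upper and $\mathcal{D}=\frac{d}{dx}-iA$ on lower semicircles. For a bounded real sequence $(\alpha_j)_{j\in\mathbb{Z}}$ consider the operator $-\mathcal{D}^2$ in $L^2(\Gamma)$ whose domain consists of the $\psi\in L^2(\Gamma)$ that are in $H^2$ on every edge, with $\mathcal{D}^2\psi\in L^2(\Gamma)$, that are continuous at every vertex, and for which at each vertex $j$ the sum of the values of $\mathcal{D}\psi$ on the two edges to the right of it minus the sum of those on the two edges to the left of it equals $\alpha_j\psi(j)$. Denote by $H_{\alpha}$ the operator with $\alpha_j=\alpha\in\mathbb{R}$ for all $j$, and by $H_{\alpha,\gamma_1}$ the operator with $\alpha_1=\alpha+\gamma_1$, $\gamma_1\in\mathbb{R}$, and $\alpha_j=\alpha$ for $j\ne 1$. The essential spectrum is the spectrum without the isolated eigenvalues of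 finite multiplicity; a gap is a connected component of the complement of the essential spectrum in $\mathbb{R}$, and the first gap is the one that lies below the whole essential spectrum. Theorem (Non-magnetic case, single impurity). Suppose that $A\in\mathbb{Z}$. The essential spectrum of $H_{\alpha,\gamma_1}$ coincides with the essential spectrum of $H_\alpha$, which is the whole spectrum of $H_\alpha$. Moreover: 1. if $\alpha>0$ and $\gamma_1>0$, then $H_{\alpha,\gamma_1}$ has no eigenvalues in the gaps of its essential spectrum, and no eigenvalues at all apart from numbers $n^2$, $n\in\{1,2,\dots\}$, that lie in the essential spectrum; 2. if $\alpha>0$ and $\gamma_1<0$, then $H_{\alpha,\gamma_1}$ has precisely one eigenvalue in every gap of its essential spectrum, and this eigenvalue is simple; 3. if $\alpha<0$ and $\gamma_1>0$, then $H_{\alpha,\gamma_1}$ has precisely one eigenvalue in every gap of its essential spectrum except the first one, this eigenvalue is simple, and there is no eigenvalue in the first gap; 4. if $\alpha<0$ and $\gamma_1<0$, then $H_{\alpha,\gamma_1}$ has precisely one eigenvalue below its essential spectrum, this eigenvalue is simple, and $H_{\alpha,\gamma_1}$ has no other eigenvalues apart from numbers $n^2$, $n\in\{1,2,\dots\}$,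 that lie in the essential spectrum. -/

import Mathlib

open MeasureTheory Filter Topology

noncomputable section

/-! ### Spectral notions for a partially defined (unbounded) operator on a Hilbert space -/

namespace UnboundedOp

variable {E : Type*} [NormedAddCommGroup E] [InnerProductSpace ℂ E]

/-- The eigenspace `ker (T - z)`. -/
def eigenspace (T : E →ₗ.[ℂ] E) (z : ℂ) : Submodule ℂ E where
  carrier := {u | (u, z • u) ∈ T.graph}
  add_mem' {u v} hu hv := by
    have h := T.graph.add_mem hu hv
    simpa [smul_add] using h
  zero_mem' := by
    change ((0 : E), z • (0 : E)) ∈ T.graph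
    rw [smul_zero]
    exact T.graph.zero_mem
  smul_mem' c u hu := by
    have h := T.graph.smul_mem c hu
    simpa [smul_comm c z u] using h

/-- `z` is an eigenvalue: `T u = z u` for some `u ≠ 0` in the domain of `T`. -/
def IsEigenvalue (T : E →ₗ.[ℂ] E) (z : ℂ) : Prop :=
  ∃ u : T.domain, (u : E) ≠ 0 ∧ T u = z • (u : E)

/-- `z` is an eigenvalue of multiplicity one. -/
def IsSimpleEigenvalue (T : E →ₗ.[ℂ] E) (z : ℂ) : Prop :=
  IsEigenvalue T z ∧ Module.finrank ℂ (eigenspace T z) = 1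

/-- The resolvent set: those `z` for which `T - z`, as a map from the domain of `T` to the whole
space, has a bounded everywhere defined two-sided inverse `R`. -/
def resolventSet (T : E →ₗ.[ℂ] E) : Set ℂ :=
  {z | ∃ R : E →L[ℂ] E,
    (∀ f : E, ∃ h : R f ∈ T.domain, T ⟨R f, h⟩ - z • R f = f) ∧
    ∀ u : T.domain, R (T u - z • (u : E)) = u}

/-- The spectrum. -/
def spectrum (T : E →ₗ.[ℂ] E) : Set ℂ := (resolventSet T)ᶜ

/-- The discrete spectrum: the eigenvalues of finite multiplicity that are isolated points of the
spectrum. -/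
def discreteSpectrum (T : E →ₗ.[ℂ] E) : Set ℂ :=
  {z | IsEigenvalue T z ∧ FiniteDimensional ℂ (eigenspace T z) ∧
    ∀ᶠ w in 𝓝[≠] z, w ∉ spectrum T}

/-- The essential spectrum: the spectrum without the discrete spectrum. -/
def essSpectrum (T : E →ₗ.[ℂ] E) : Set ℂ := spectrum T \ discreteSpectrum T

/-- `G` is a gap of the essential spectrum: a connected component of its complement in `ℝ`. -/
def IsGap (T : E →ₗ.[ℂ] E) (G : Set ℝ) : Prop :=
  ∃ x : ℝ, (x : ℂ) ∉ essSpectrum T ∧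
    G = connectedComponentIn {y : ℝ | (y : ℂ) ∉ essSpectrum T} x

/-- The first gap: the half-line below the (real) essential spectrum. -/
def firstGap (T : E →ₗ.[ℂ] E) : Set ℝ :=
  {x : ℝ | ∀ y : ℝ, (y : ℂ) ∈ essSpectrum T → x < y}

/-- `T` has precisely one eigenvalue in `G`, and this eigenvalue is simple. -/
def HasUniqueSimpleEigenvalueIn (T : E →ₗ.[ℂ] E) (G : Set ℝ) : Prop :=
  ∃ x ∈ G, IsSimpleEigenvalue T (x : ℂ) ∧ ∀ y ∈ G, IsEigenvalue T (y : ℂ) → y = x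

end UnboundedOp

/-! ### The ring chain and its Hamiltonian -/

namespace RingChain

/-- The edges of the chain: the edge `(j, true)` is the upper and `(j, false)` the lower semicircle
of the `j`-th ring. Every edge is parametrized from left to right by `[0, π]`; the vertex with
index `j` is the left end of the two edges of ring `j` and the right end of the two edges of
ring `j - 1`. -/
abbrev Edge : Type := ℤ × Bool

/-- Arc length on one edge. -/
abbrev edgeMeasure : Measure ℝ := volume.restrict (Set.Icc 0 Real.pi)

/-- The state space `L²(Γ)`, the Hilbert sum of the spaces `L²(e)` over all edges. -/
abbrev L2Chain : Type := lp (fun _ : Edge => Lp ℂ 2 edgeMeasure) 2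

/-- `f` is absolutely continuous on `[0, π]` and `g` is (almost everywhere) its derivative. -/
def HasACDeriv (f g : ℝ → ℂ) : Prop :=
  IntervalIntegrable g volume 0 Real.pi ∧
    ∀ x ∈ Set.Icc 0 Real.pi, f x = f 0 + ∫ t in (0 : ℝ)..x, g t

/-- The quasiderivative is `𝓓 = d/dx + quasiCoeff A s`: it is `d/dx + iA` on the upper and
`d/dx - iA` on the lower semicircles. -/
def quasiCoeff (A : ℝ) (s : Bool) : ℂ :=
  if s then Complex.I * (A : ℂ) else -(Complex.I * (A : ℂ))

/-- `ψ` is a function on the chain with quasiderivative `η = 𝓓ψ` on every edge such that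
`-𝓓²ψ = v`, and `ψ` satisfies the `δ`-coupling of strength `α j` at the vertex `j` for all `j`.
As `v` is square integrable, the functions `ψ e` are in the Sobolev space `H²(0, π)`. -/
structure IsSolution (A : ℝ) (α : ℤ → ℝ) (ψ η : Edge → ℝ → ℂ) (v : L2Chain) : Prop where
  deriv_fst : ∀ e : Edge, HasACDeriv (ψ e) (fun x => η e x - quasiCoeff A e.2 * ψ e x)
  deriv_snd : ∀ e : Edge, HasACDeriv (η e) (fun x => -(v e x) - quasiCoeff A e.2 * η e x)
  lower_eq : ∀ j : ℤ, ψ (j, false) 0 = ψ (j, true) 0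
  upper_left_eq : ∀ j : ℤ, ψ (j - 1, true) Real.pi = ψ (j, true) 0
  lower_left_eq : ∀ j : ℤ, ψ (j - 1, false) Real.pi = ψ (j, true) 0
  coupling : ∀ j : ℤ,
    η (j, true) 0 + η (j, false) 0 - η (j - 1, true) Real.pi - η (j - 1, false) Real.pi =
      (α j : ℂ) * ψ (j, true) 0

theorem HasACDeriv.congr_ae {f g g' : ℝ → ℂ} (h : HasACDeriv f g)
    (hg : g =ᵐ[edgeMeasure] g') : HasACDeriv f g' := by
  have hpi : (0 : ℝ) ≤ Real.pi := Real.pi_pos.le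
  have hres : ∀ x ∈ Set.Icc 0 Real.pi, g =ᵐ[volume.restrict (Set.uIoc 0 x)] g' := by
    intro x hx
    refine ae_restrict_of_ae_restrict_of_subset ?_ hg
    rw [Set.uIoc_of_le hx.1]
    exact fun t ht => ⟨ht.1.le, ht.2.trans hx.2⟩
  refine ⟨h.1.congr_ae (hres _ ⟨hpi, le_rfl⟩), fun x hx => ?_⟩
  rw [h.2 x hx, intervalIntegral.integral_congr_ae_restrict (hres x hx)]

theorem HasACDeriv.add {f g f' g' : ℝ → ℂ} (h : HasACDeriv f g) (h' : HasACDeriv f' g') :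
    HasACDeriv (fun x => f x + f' x) (fun x => g x + g' x) := by
  refine ⟨h.1.add h'.1, fun x hx => ?_⟩
  have hsub : Set.uIcc 0 x ⊆ Set.uIcc 0 Real.pi :=
    Set.uIcc_subset_uIcc_left (by rw [Set.uIcc_of_le Real.pi_pos.le]; exact hx)
  change f x + f' x = f 0 + f' 0 + _
  rw [intervalIntegral.integral_add (h.1.mono_set hsub) (h'.1.mono_set hsub), h.2 x hx,
    h'.2 x hx]
  ring

theorem HasACDeriv.const_mul {f g : ℝ → ℂ} (h : HasACDeriv f g) (c : ℂ) :
    HasACDeriv (fun x => c * f x) (fun x => c * g x) := by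
  refine ⟨h.1.const_mul c, fun x hx => ?_⟩
  change c * f x = c * f 0 + _
  rw [intervalIntegral.integral_const_mul, h.2 x hx]
  ring

theorem HasACDeriv.eq_zero {f g : ℝ → ℂ} (h : HasACDeriv f g) (hf : f =ᵐ[edgeMeasure] 0) :
    g =ᵐ[edgeMeasure] 0 := by
  have hpi := Real.pi_pos
  have hcont : ContinuousOn f (Set.Icc 0 Real.pi) := by
    have h1 := intervalIntegral.continuousOn_primitive_interval'
      (μ := volume) (a := 0) (b₁ := 0) (b₂ := Real.pi) (f := g) h.1 (by simp)
    rw [Set.uIcc_of_le hpi.le] at h1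
    exact (h1.const_add (f 0)).congr fun x hx => h.2 x hx
  have hzero : Set.EqOn f 0 (Set.Icc 0 Real.pi) :=
    Measure.eqOn_Icc_of_ae_eq volume hpi.ne hf hcont continuousOn_const
  have hint : ∀ x ∈ Set.Icc 0 Real.pi, ∫ t in (0 : ℝ)..x, g t = 0 := by
    intro x hx
    have h2 := h.2 x hx
    rw [hzero hx, hzero ⟨le_rfl, hpi.le⟩] at h2
    simpa using h2.symm
  have hae := h.1.ae_hasDerivAt_integral
  have key : ∀ᵐ x ∂(volume.restrict (Set.Ioo 0 Real.pi)), g x = 0 := by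
    rw [ae_restrict_iff' measurableSet_Ioo]
    filter_upwards [hae] with x hx hx'
    have hd := hx (by rw [Set.uIcc_of_le hpi.le]; exact Set.Ioo_subset_Icc_self hx') 0 (by simp)
    have he : (fun y => ∫ t in (0 : ℝ)..y, g t) =ᶠ[𝓝 x] fun _ => (0 : ℂ) := by
      filter_upwards [Ioo_mem_nhds hx'.1 hx'.2] with y hy
      exact hint y (Set.Ioo_subset_Icc_self hy)
    exact hd.unique ((hasDerivAt_const x (0 : ℂ)).congr_of_eventuallyEq he)
  have hm : volume.restrict (Set.Ioo 0 Real.pi) = volume.restrict (Set.Icc 0 Real.pi) :=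
    restrict_Ioo_eq_restrict_Icc
  rw [hm] at key
  exact key

/-- The graph of the magnetic Laplacian `-Δ_α` with vector potential `A` and coupling constants
`α j`: the pairs `(u, v)` in `L²(Γ)` such that `u` has a representative in `H²` on every edge that
satisfies the coupling conditions, and `v = -𝓓²u`. -/
def hamiltonianGraph (A : ℝ) (α : ℤ → ℝ) : Submodule ℂ (L2Chain × L2Chain) where
  carrier := {p | ∃ ψ η : Edge → ℝ → ℂ,
    (∀ e, (p.1 e : ℝ → ℂ) =ᵐ[edgeMeasure] ψ e) ∧ IsSolution A α ψ η p.2}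
  add_mem' := by
    rintro p q ⟨ψ, η, hp, h⟩ ⟨ψ', η', hq, h'⟩
    refine ⟨fun e x => ψ e x + ψ' e x, fun e x => η e x + η' e x, fun e => ?_,
      fun e => ?_, fun e => ?_, fun j => ?_, fun j => ?_, fun j => ?_, fun j => ?_⟩
    · filter_upwards [Lp.coeFn_add (p.1 e) (q.1 e), hp e, hq e] with x h1 h2 h3
      change ((p.1 e + q.1 e : Lp ℂ 2 edgeMeasure) : ℝ → ℂ) x = _
      rw [h1, Pi.add_apply, h2, h3]
    · refine ((h.deriv_fst e).add (h'.deriv_fst e)).congr_ae (Eventually.of_forall fun x => ?_)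
      simp only
      ring
    · refine ((h.deriv_snd e).add (h'.deriv_snd e)).congr_ae ?_
      filter_upwards [Lp.coeFn_add (p.2 e) (q.2 e)] with x h1
      change _ = -(((p.2 e + q.2 e : Lp ℂ 2 edgeMeasure) : ℝ → ℂ) x) - _
      rw [h1, Pi.add_apply]
      ring
    · simp only [h.lower_eq, h'.lower_eq]
    · simp only [h.upper_left_eq, h'.upper_left_eq]
    · simp only [h.lower_left_eq, h'.lower_left_eq]
    · linear_combination h.coupling j + h'.coupling j
  zero_mem' := by
    refine ⟨fun _ _ => 0, fun _ _ => 0, fun e => ?_, fun e => ?_, fun e => ?_,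
      fun j => rfl, fun j => rfl, fun j => rfl, fun j => by simp⟩
    · exact Lp.coeFn_zero ℂ 2 edgeMeasure
    · exact ⟨by simp, fun x _ => by simp⟩
    · have h0 : HasACDeriv (fun _ => 0) (fun _ => 0) := ⟨by simp, fun x _ => by simp⟩
      refine h0.congr_ae ?_
      filter_upwards [Lp.coeFn_zero ℂ 2 edgeMeasure] with x h1
      change _ = -(((0 : Lp ℂ 2 edgeMeasure) : ℝ → ℂ) x) - _
      rw [h1]
      simp
  smul_mem' := by
    rintro c p ⟨ψ, η, hp, h⟩
    refine ⟨fun e x => c * ψ e x, fun e x => c * η e x, fun e => ?_,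
      fun e => ?_, fun e => ?_, fun j => ?_, fun j => ?_, fun j => ?_, fun j => ?_⟩
    · filter_upwards [Lp.coeFn_smul c (p.1 e), hp e] with x h1 h2
      change ((c • p.1 e : Lp ℂ 2 edgeMeasure) : ℝ → ℂ) x = _
      rw [h1, Pi.smul_apply, h2, smul_eq_mul]
    · refine ((h.deriv_fst e).const_mul c).congr_ae (Eventually.of_forall fun x => ?_)
      simp only
      ring
    · refine ((h.deriv_snd e).const_mul c).congr_ae ?_
      filter_upwards [Lp.coeFn_smul c (p.2 e)] with x h1
      change _ = -(((c • p.2 e : Lp ℂ 2 edgeMeasure) : ℝ → ℂ) x) - _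
      rw [h1, Pi.smul_apply, smul_eq_mul]
      ring
    · simp only [h.lower_eq]
    · simp only [h.upper_left_eq]
    · simp only [h.lower_left_eq]
    · linear_combination c * h.coupling j

/-- `-𝓓²u` is determined by `u`. -/
theorem hamiltonianGraph_single_valued (A : ℝ) (α : ℤ → ℝ) (p : L2Chain × L2Chain)
    (hp : p ∈ hamiltonianGraph A α) (h0 : p.1 = 0) : p.2 = 0 := by
  obtain ⟨ψ, η, hu, h⟩ := hp
  apply lp.ext
  funext e
  have hψ : ψ e =ᵐ[edgeMeasure] 0 := by
    filter_upwards [hu e, Lp.coeFn_zero ℂ 2 edgeMeasure] with x h1 h2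
    rw [h0] at h1
    rw [← h1]
    exact h2
  have hη : η e =ᵐ[edgeMeasure] 0 := by
    filter_upwards [(h.deriv_fst e).eq_zero hψ, hψ] with x h1 h2
    simpa [h2] using h1
  have hv : ((p.2 e : Lp ℂ 2 edgeMeasure) : ℝ → ℂ) =ᵐ[edgeMeasure] 0 := by
    filter_upwards [(h.deriv_snd e).eq_zero hη, hη] with x h1 h2
    simpa [h2] using h1
  exact (Lp.eq_zero_iff_ae_eq_zero).2 hv

/-- The magnetic Laplacian `-Δ_α` on the ring chain, as an operator in `L²(Γ)`. -/
def hamiltonian (A : ℝ) (α : ℤ → ℝ) : L2Chain →ₗ.[ℂ] L2Chain :=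
  (hamiltonianGraph A α).toLinearPMap

theorem hamiltonian_graph (A : ℝ) (α : ℤ → ℝ) :
    (hamiltonian A α).graph = hamiltonianGraph A α :=
  Submodule.toLinearPMap_graph_eq _ (hamiltonianGraph_single_valued A α)

/-- The unperturbed operator: the same coupling constant `α` at all vertices. -/
def periodicHamiltonian (A α : ℝ) : L2Chain →ₗ.[ℂ] L2Chain :=
  hamiltonian A fun _ => α

/-- The operator with a single impurity of strength `γ`: the coupling constant is `α + γ` at the
vertex with index `1` and `α` at all other vertices. -/
def impurityHamiltonian (A α γ : ℝ) : L2Chain →ₗ.[ℂ] L2Chain :=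
  hamiltonian A fun j => if j = 1 then α + γ else α

end RingChain

end

/-! Fix `z` and write `s = sinRoot z π`. On each edge the equation `-𝓓²u - zu = f` is solved by
variation of constants, the potential entering only through a gauge factor. If `s ≠ 0`, the slopes
can be eliminated in favour of the vertex values `a j`. For integer `A` the gauge contributes the
same sign `ε = (-1)^A` on both semicircles, and the resolvent equation becomes a scalar difference
equation with constant coefficient `2εD`, where `D = discr α z`, plus a rank one term at the
impurity (`mem_impurity_graph_iff`).

If `D ∉ [-1, 1]`, then `2εD = l + l⁻¹` with `|l| < 1`. The unperturbed difference operator factors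
into two Neumann-invertible pieces, so the perturbed one is invertible unless its kernel is
nontrivial. The kernel is spanned by `l ^ |j - 1|`, subject to the matching condition `l - l⁻¹ =
εγs/2`. If `D ∈ [-1, 1]` and `s ≠ 0`, the recursion has no nonzero decaying solutions: there is no
eigenvalue, but a source on a single edge shows that `z` is in the spectrum. If `s = 0`, i.e. `z =
n²` with `n ≥ 1`, the antisymmetric states on single rings form an infinite-dimensional family of
eigenvectors. So `band α`, where `D ∈ [-1, 1]`, always belongs to the essential spectrum.

For real `x` put `P = lowFac α x` and `Q = upFac α x`. Half-angle formulas give `D - 1 = Ps` and `D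
+ 1 = Qs`, so the gaps are where `PQ > 0`. Squaring the matching condition gives `PQ = γ²/16`, and
`|l| < 1` selects the sign `γP < 0` (`isEigenvalue_real_iff`). Between consecutive zeros of `s` both
factors strictly decrease, by Wronskian identities, and `P + Q` runs from `+∞` to `-∞`. Hence each
gap with positive factors contains exactly one solution of `PQ = γ²/16`, and so does each gap with
negative factors; the former are eigenvalues for `γ < 0`, the latter for `γ > 0`. For `α > 0` no gap
has negative factors (`not_both_neg`). For `α < 0` positive factors occur only for `x < 0`, in the
first gap (`neg_of_fac_pos`), and in the first gap the factors are always positive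
(`fac_pos_of_mem_firstGap`).

Nonreal `z` are excluded without self-adjointness: the same Wronskian identities give the imaginary
parts of the tangent and cotangent terms definite, opposite signs. -/

noncomputable section
namespace RingChain

/-! ### The fundamental system of `-y'' = z y` -/

/-- A square root of `z`. -/
def csqrt (z : ℂ) : ℂ := z ^ (1 / 2 : ℂ)

theorem csqrt_sq (z : ℂ) : csqrt z ^ 2 = z := by
  simp [csqrt]

/-- The entire function `sin u / u`. -/
def csinc : ℂ → ℂ := dslope Complex.sin 0

theorem mul_csinc (u : ℂ) : u * csinc u = Complex.sin u := by
  have h := sub_smul_dslope Complex.sin 0 u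
  simpa [csinc] using h

theorem csinc_zero : csinc 0 = 1 := by
  simp [csinc, dslope_same]

theorem continuous_csinc : Continuous csinc := by
  have h := (continuousOn_dslope (f := Complex.sin) (a := 0) (s := Set.univ) univ_mem).2
    ⟨Complex.continuous_sin.continuousOn, Complex.differentiable_sin 0⟩
  exact continuousOn_univ.1 h

theorem csinc_neg (u : ℂ) : csinc (-u) = csinc u := by
  rcases eq_or_ne u 0 with rfl | hu
  · simp
  · have h1 := mul_csinc (-u)
    have h2 := mul_csinc u
    rw [Complex.sin_neg, ← h2] at h1
    apply mul_left_cancel₀ hu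
    linear_combination -h1

theorem csinc_conj (u : ℂ) :
    csinc ((starRingEnd ℂ) u) = (starRingEnd ℂ) (csinc u) := by
  rcases eq_or_ne u 0 with rfl | hu
  · simp [csinc_zero]
  · have h1 := mul_csinc ((starRingEnd ℂ) u)
    rw [Complex.sin_conj, ← mul_csinc u, map_mul] at h1
    exact mul_left_cancel₀ (by simpa using hu) h1

/-- The solution of `-y'' = z y` with `y 0 = 1`, `y' 0 = 0`. -/
def cosRoot (z : ℂ) (x : ℝ) : ℂ := Complex.cos (csqrt z * x)

/-- The solution of `-y'' = z y` with `y 0 = 0`, `y' 0 = 1`. -/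
def sinRoot (z : ℂ) (x : ℝ) : ℂ := x * csinc (csqrt z * x)

/-- Cosine is even, so the branch chosen in `csqrt` is invisible and any convenient root may be
used. -/
theorem cosRoot_sq (k : ℂ) (x : ℝ) : cosRoot (k ^ 2) x = Complex.cos (k * x) := by
  rcases sq_eq_sq_iff_eq_or_eq_neg.1 (csqrt_sq (k ^ 2)) with h | h <;>
    simp [cosRoot, h]

theorem sinRoot_sq (k : ℂ) (x : ℝ) : sinRoot (k ^ 2) x = x * csinc (k * x) := by
  rcases sq_eq_sq_iff_eq_or_eq_neg.1 (csqrt_sq (k ^ 2)) with h | h <;>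
    simp [sinRoot, h, csinc_neg]

theorem mul_sinRoot_sq (k : ℂ) (x : ℝ) : k * sinRoot (k ^ 2) x = Complex.sin (k * x) := by
  rw [sinRoot_sq, ← mul_csinc]
  ring

@[simp] theorem cosRoot_zero_right (z : ℂ) : cosRoot z 0 = 1 := by simp [cosRoot]

@[simp] theorem sinRoot_zero_right (z : ℂ) : sinRoot z 0 = 0 := by simp [sinRoot]

theorem csqrt_mul_sinRoot (z : ℂ) (x : ℝ) :
    csqrt z * sinRoot z x = Complex.sin (csqrt z * x) := by
  rw [sinRoot, ← mul_csinc]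
  ring

theorem cosRoot_sq_add (z : ℂ) (x : ℝ) : cosRoot z x ^ 2 + z * sinRoot z x ^ 2 = 1 := by
  have h := Complex.cos_sq_add_sin_sq (csqrt z * x)
  rw [← csqrt_mul_sinRoot] at h
  rw [cosRoot]
  linear_combination h - sinRoot z x ^ 2 * csqrt_sq z

theorem hasDerivAt_cosRoot (z : ℂ) (x : ℝ) :
    HasDerivAt (cosRoot z) (-(z * sinRoot z x)) x := by
  have h1 : HasDerivAt (fun y : ℝ => csqrt z * (y : ℂ)) (csqrt z * 1) x :=
    (Complex.ofRealCLM.hasDerivAt (x := x)).const_mul (csqrt z)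
  have h2 := (Complex.hasDerivAt_cos (csqrt z * x)).comp x h1
  refine h2.congr_deriv ?_
  rw [← csqrt_mul_sinRoot]
  linear_combination -sinRoot z x * csqrt_sq z

theorem hasDerivAt_sinRoot (z : ℂ) (x : ℝ) :
    HasDerivAt (sinRoot z) (cosRoot z x) x := by
  have h1 : HasDerivAt (fun y : ℝ => csqrt z * (y : ℂ)) (csqrt z * 1) x :=
    (Complex.ofRealCLM.hasDerivAt (x := x)).const_mul (csqrt z)
  rcases eq_or_ne (csqrt z) 0 with h0 | h0
  · have h : sinRoot z = fun y : ℝ => (y : ℂ) := by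
      funext y
      simp [sinRoot, h0, csinc_zero]
    rw [h, cosRoot, h0, zero_mul, Complex.cos_zero]
    exact Complex.ofRealCLM.hasDerivAt (x := x)
  · have h2 := ((Complex.hasDerivAt_sin (csqrt z * x)).comp x h1).const_mul (csqrt z)⁻¹
    have h : sinRoot z =
        fun y : ℝ => (csqrt z)⁻¹ * (Complex.sin ∘ fun y : ℝ => csqrt z * (y : ℂ)) y := by
      funext y
      rw [Function.comp_apply, ← csqrt_mul_sinRoot, inv_mul_cancel_left₀ h0]
    rw [h]
    refine h2.congr_deriv ?_
    rw [cosRoot]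
    field_simp

theorem continuous_cosRoot (z : ℂ) : Continuous (cosRoot z) :=
  continuous_iff_continuousAt.2 fun x => (hasDerivAt_cosRoot z x).continuousAt

theorem continuous_sinRoot (z : ℂ) : Continuous (sinRoot z) :=
  continuous_iff_continuousAt.2 fun x => (hasDerivAt_sinRoot z x).continuousAt

theorem cosRoot_pi (z : ℂ) :
    cosRoot z Real.pi = cosRoot z (Real.pi / 2) ^ 2 - z * sinRoot z (Real.pi / 2) ^ 2 := by
  have h : csqrt z * (Real.pi : ℂ) = 2 * (csqrt z * ((Real.pi / 2 : ℝ) : ℂ)) := by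
    push_cast
    ring
  have h1 := Complex.cos_two_mul' (csqrt z * ((Real.pi / 2 : ℝ) : ℂ))
  rw [cosRoot, h, h1, ← csqrt_mul_sinRoot, cosRoot]
  linear_combination -sinRoot z (Real.pi / 2) ^ 2 * csqrt_sq z

theorem sinRoot_pi (z : ℂ) :
    sinRoot z Real.pi = 2 * sinRoot z (Real.pi / 2) * cosRoot z (Real.pi / 2) := by
  rcases eq_or_ne (csqrt z) 0 with h0 | h0
  · simp [sinRoot, cosRoot, h0, csinc_zero]
    ring
  · have h : csqrt z * (Real.pi : ℂ) = 2 * (csqrt z * ((Real.pi / 2 : ℝ) : ℂ)) := by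
      push_cast
      ring
    have h1 := Complex.sin_two_mul (csqrt z * ((Real.pi / 2 : ℝ) : ℂ))
    rw [← h, ← csqrt_mul_sinRoot, ← csqrt_mul_sinRoot] at h1
    apply mul_left_cancel₀ h0
    rw [h1, cosRoot]
    ring

theorem cosRoot_conj (z : ℂ) (x : ℝ) :
    cosRoot ((starRingEnd ℂ) z) x = (starRingEnd ℂ) (cosRoot z x) := by
  have h : (starRingEnd ℂ) z = ((starRingEnd ℂ) (csqrt z)) ^ 2 := by
    rw [← map_pow, csqrt_sq]
  rw [h, cosRoot_sq, cosRoot, ← Complex.cos_conj, map_mul, Complex.conj_ofReal]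

theorem sinRoot_conj (z : ℂ) (x : ℝ) :
    sinRoot ((starRingEnd ℂ) z) x = (starRingEnd ℂ) (sinRoot z x) := by
  have h : (starRingEnd ℂ) z = ((starRingEnd ℂ) (csqrt z)) ^ 2 := by
    rw [← map_pow, csqrt_sq]
  rw [h, sinRoot_sq, sinRoot, map_mul, ← csinc_conj, map_mul, Complex.conj_ofReal]

/-- A square root of a real number, continuous on the whole line. -/
def realRoot (r : ℝ) : ℂ := (Real.sqrt r : ℂ) + Complex.I * (Real.sqrt (-r) : ℂ)

theorem realRoot_sq (r : ℝ) : realRoot r ^ 2 = (r : ℂ) := by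
  have hmul : (Real.sqrt r : ℂ) * (Real.sqrt (-r) : ℂ) = 0 := by
    rcases le_total r 0 with h | h
    · simp [Real.sqrt_eq_zero_of_nonpos h]
    · simp [Real.sqrt_eq_zero_of_nonpos (neg_nonpos.2 h)]
  have hsq : (Real.sqrt r : ℂ) ^ 2 - (Real.sqrt (-r) : ℂ) ^ 2 = (r : ℂ) := by
    norm_cast
    rcases le_total r 0 with h | h
    · rw [Real.sqrt_eq_zero_of_nonpos h, Real.sq_sqrt (neg_nonneg.2 h)]
      ring
    · rw [Real.sqrt_eq_zero_of_nonpos (neg_nonpos.2 h), Real.sq_sqrt h]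
      ring
  rw [realRoot]
  linear_combination hsq + 2 * Complex.I * hmul + (Real.sqrt (-r) : ℂ) ^ 2 * Complex.I_sq

theorem continuous_realRoot : Continuous realRoot := by
  unfold realRoot
  fun_prop

/-- `cosRoot` for real `z`, as a real function. -/
def cosR (r x : ℝ) : ℝ := (cosRoot r x).re

/-- `sinRoot` for real `z`, as a real function. -/
def sinR (r x : ℝ) : ℝ := (sinRoot r x).re

theorem ofReal_cosR (r x : ℝ) : (cosR r x : ℂ) = cosRoot r x := by
  apply Complex.conj_eq_iff_re.1
  rw [← cosRoot_conj, Complex.conj_ofReal]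

theorem ofReal_sinR (r x : ℝ) : (sinR r x : ℂ) = sinRoot r x := by
  apply Complex.conj_eq_iff_re.1
  rw [← sinRoot_conj, Complex.conj_ofReal]

/-- By evenness `csqrt` may be replaced by `realRoot`, whose continuity through `0` is evident. -/
theorem continuous_cosR : Continuous fun p : ℝ × ℝ => cosR p.1 p.2 := by
  have h : (fun p : ℝ × ℝ => cosR p.1 p.2) =
      fun p => (Complex.cos (realRoot p.1 * (p.2 : ℂ))).re := by
    funext p
    rw [cosR, ← realRoot_sq, cosRoot_sq]
  rw [h]
  have := continuous_realRoot
  fun_prop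

theorem continuous_sinR : Continuous fun p : ℝ × ℝ => sinR p.1 p.2 := by
  have h : (fun p : ℝ × ℝ => sinR p.1 p.2) =
      fun p => ((p.2 : ℂ) * csinc (realRoot p.1 * (p.2 : ℂ))).re := by
    funext p
    rw [sinR, ← realRoot_sq, sinRoot_sq]
  rw [h]
  have := continuous_realRoot
  have := continuous_csinc
  fun_prop

/-! ### Calculus of absolutely continuous functions -/

theorem HasACDeriv.continuousOn {f g : ℝ → ℂ} (h : HasACDeriv f g) :
    ContinuousOn f (Set.Icc 0 Real.pi) := by
  have h1 := intervalIntegral.continuousOn_primitive_interval'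
    (μ := volume) (a := 0) (b₁ := 0) (b₂ := Real.pi) (f := g) h.1 (by simp)
  rw [Set.uIcc_of_le Real.pi_pos.le] at h1
  exact (h1.const_add (f 0)).congr fun x hx => h.2 x hx

/-- Fubini on the triangle `s ≤ t`: the inner integral of `h'` over `[s, x]` is `h x - h s`. This is
integration by parts when one factor is only a primitive of an integrable function. -/
theorem integral_mul_primitive {h h' g : ℝ → ℂ} (hh : ∀ x, HasDerivAt h (h' x) x)
    (hc : Continuous h') {x : ℝ} (hx : 0 ≤ x) (hg : IntervalIntegrable g volume 0 x) :
    ∫ t in (0 : ℝ)..x, h' t * ∫ s in (0 : ℝ)..t, g s =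
      ∫ s in (0 : ℝ)..x, g s * (h x - h s) := by
  set μ := volume.restrict (Set.Ioc 0 x) with hμ
  have hgi : Integrable g μ := (intervalIntegrable_iff_integrableOn_Ioc_of_le hx).1 hg
  have hhi : Integrable h' μ :=
    (intervalIntegrable_iff_integrableOn_Ioc_of_le hx).1 (hc.intervalIntegrable _ _)
  set F : ℝ → ℝ → ℂ := fun t s =>
    {p : ℝ × ℝ | p.2 ≤ p.1}.indicator (fun p => h' p.1 * g p.2) (t, s) with hF
  have hms : MeasurableSet {p : ℝ × ℝ | p.2 ≤ p.1} := measurableSet_le measurable_snd measurable_fst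
  have hFi : Integrable (Function.uncurry F) (μ.prod μ) := (hhi.mul_prod hgi).indicator hms
  have hsw := integral_integral_swap hFi
  have hl : ∀ t ∈ Set.Ioc 0 x, ∫ s, F t s ∂μ = h' t * ∫ s in (0 : ℝ)..t, g s := by
    intro t ht
    have e : (fun s => F t s) = (Set.Iic t).indicator fun s => h' t * g s := by
      funext s
      by_cases hs : s ≤ t <;> simp [hF, Set.indicator, hs]
    rw [e, integral_indicator measurableSet_Iic, hμ, Measure.restrict_restrict measurableSet_Iic,
      Set.inter_comm, Set.Ioc_inter_Iic, min_eq_right ht.2, integral_const_mul,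
      intervalIntegral.integral_of_le ht.1.le]
  have hr : ∀ s ∈ Set.Ioc 0 x, ∫ t, F t s ∂μ = g s * (h x - h s) := by
    intro s hs
    have e : (fun t => F t s) = (Set.Ici s).indicator fun t => h' t * g s := by
      funext t
      by_cases hst : s ≤ t <;> simp [hF, Set.indicator, hst]
    have hset : Set.Ici s ∩ Set.Ioc 0 x = Set.Icc s x := by
      ext t
      simp only [Set.mem_inter_iff, Set.mem_Ici, Set.mem_Ioc, Set.mem_Icc]
      exact ⟨fun H => ⟨H.1, H.2.2⟩, fun H => ⟨H.1, hs.1.trans_le H.1, H.2⟩⟩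
    rw [e, integral_indicator measurableSet_Ici, hμ, Measure.restrict_restrict measurableSet_Ici,
      hset, integral_mul_const, integral_Icc_eq_integral_Ioc,
      ← intervalIntegral.integral_of_le hs.2,
      intervalIntegral.integral_eq_sub_of_hasDerivAt (fun t _ => hh t) (hc.intervalIntegrable _ _)]
    ring
  rw [intervalIntegral.integral_of_le hx, intervalIntegral.integral_of_le hx,
    ← setIntegral_congr_fun measurableSet_Ioc hl, ← setIntegral_congr_fun measurableSet_Ioc hr]
  exact hsw

/-- The product rule, with one factor continuously differentiable. -/
theorem HasACDeriv.mul_left {f g h h' : ℝ → ℂ} (H : HasACDeriv f g)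
    (hh : ∀ x, HasDerivAt h (h' x) x) (hc : Continuous h') :
    HasACDeriv (fun x => h x * f x) (fun x => h' x * f x + h x * g x) := by
  have hh0 : Continuous h := continuous_iff_continuousAt.2 fun x => (hh x).continuousAt
  have hpi := Real.pi_pos.le
  have i1 : IntervalIntegrable (fun x => h' x * f x) volume 0 Real.pi := by
    apply ContinuousOn.intervalIntegrable
    rw [Set.uIcc_of_le hpi]
    exact hc.continuousOn.mul H.continuousOn
  have i2 : IntervalIntegrable (fun x => h x * g x) volume 0 Real.pi :=
    H.1.continuousOn_mul hh0.continuousOn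
  refine ⟨i1.add i2, fun x hx => ?_⟩
  have hsub : Set.uIcc 0 x ⊆ Set.uIcc 0 Real.pi :=
    Set.uIcc_subset_uIcc_left (by rw [Set.uIcc_of_le hpi]; exact hx)
  have hg := H.1.mono_set hsub
  have hp := intervalIntegral.continuousOn_primitive_interval' (μ := volume) hg
    (Set.left_mem_uIcc)
  have e1 : ∫ t in (0 : ℝ)..x, h' t * f t =
      (h x - h 0) * f 0 + ∫ s in (0 : ℝ)..x, g s * (h x - h s) := by
    rw [← integral_mul_primitive hh hc hx.1 hg,
      ← intervalIntegral.integral_eq_sub_of_hasDerivAt (fun t _ => hh t)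
        (hc.intervalIntegrable 0 x), ← intervalIntegral.integral_mul_const,
      ← intervalIntegral.integral_add]
    · apply intervalIntegral.integral_congr
      intro t ht
      rw [Set.uIcc_of_le hx.1] at ht
      simp only
      rw [H.2 t ⟨ht.1, ht.2.trans hx.2⟩]
      ring
    · exact (hc.intervalIntegrable 0 x).mul_const _
    · exact (hc.continuousOn.mul hp).intervalIntegrable
  have e2 : ∫ s in (0 : ℝ)..x, g s * (h x - h s) =
      h x * (∫ s in (0 : ℝ)..x, g s) - ∫ s in (0 : ℝ)..x, h s * g s := by
    rw [← intervalIntegral.integral_const_mul, ← intervalIntegral.integral_sub]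
    · congr 1
      funext s
      ring
    · exact hg.const_mul _
    · exact i2.mono_set hsub
  simp only
  rw [intervalIntegral.integral_add (i1.mono_set hsub) (i2.mono_set hsub), e1, e2, H.2 x hx]
  ring

end RingChain
end

noncomputable section
namespace RingChain

/-! ### Solutions on a single edge -/

/-- The gauge factor of the constant magnetic potential on an edge. -/
def gauge (c : ℂ) (x : ℝ) : ℂ := Complex.exp (c * x)

theorem hasDerivAt_gauge (c : ℂ) (x : ℝ) : HasDerivAt (gauge c) (c * gauge c x) x := by
  have h1 : HasDerivAt (fun y : ℝ => c * (y : ℂ)) (c * 1) x :=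
    (Complex.ofRealCLM.hasDerivAt (x := x)).const_mul c
  refine ((Complex.hasDerivAt_exp (c * x)).comp x h1).congr_deriv ?_
  rw [gauge]
  ring

theorem continuous_gauge (c : ℂ) : Continuous (gauge c) :=
  continuous_iff_continuousAt.2 fun x => (hasDerivAt_gauge c x).continuousAt

@[simp] theorem gauge_zero_right (c : ℂ) : gauge c 0 = 1 := by simp [gauge]

theorem gauge_neg_mul (c : ℂ) (x : ℝ) : gauge (-c) x * gauge c x = 1 := by
  rw [gauge, gauge, ← Complex.exp_add]
  simp

/-- The weight `exp (c x) cos (√z x)`. -/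
def cosWeight (c z : ℂ) (x : ℝ) : ℂ := gauge c x * cosRoot z x

/-- The weight `exp (c x) sin (√z x) / √z`. -/
def sinWeight (c z : ℂ) (x : ℝ) : ℂ := gauge c x * sinRoot z x

theorem continuous_cosWeight (c z : ℂ) : Continuous (cosWeight c z) :=
  (continuous_gauge c).mul (continuous_cosRoot z)

theorem continuous_sinWeight (c z : ℂ) : Continuous (sinWeight c z) :=
  (continuous_gauge c).mul (continuous_sinRoot z)

theorem hasDerivAt_cosWeight (c z : ℂ) (x : ℝ) :
    HasDerivAt (cosWeight c z) (c * cosWeight c z x - z * sinWeight c z x) x := by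
  refine ((hasDerivAt_gauge c x).mul (hasDerivAt_cosRoot z x)).congr_deriv ?_
  rw [cosWeight, sinWeight]
  ring

theorem hasDerivAt_sinWeight (c z : ℂ) (x : ℝ) :
    HasDerivAt (sinWeight c z) (c * sinWeight c z x + cosWeight c z x) x := by
  refine ((hasDerivAt_gauge c x).mul (hasDerivAt_sinRoot z x)).congr_deriv ?_
  rw [cosWeight, sinWeight]
  ring

theorem continuous_deriv_cosWeight (c z : ℂ) :
    Continuous fun x => c * cosWeight c z x - z * sinWeight c z x := by
  have := continuous_cosWeight c z
  have := continuous_sinWeight c z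
  fun_prop

theorem continuous_deriv_sinWeight (c z : ℂ) :
    Continuous fun x => c * sinWeight c z x + cosWeight c z x := by
  have := continuous_cosWeight c z
  have := continuous_sinWeight c z
  fun_prop

/-- Variation of constants: the solution of `-𝓓²ψ - zψ = f` with `ψ 0 = a`, `𝓓ψ 0 = b`. -/
def edgeSol (c z a b : ℂ) (f : ℝ → ℂ) (x : ℝ) : ℂ :=
  sinWeight (-c) z x * (b - ∫ t in (0 : ℝ)..x, cosWeight c z t * f t) +
    cosWeight (-c) z x * (a + ∫ t in (0 : ℝ)..x, sinWeight c z t * f t)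

/-- The quasiderivative of `edgeSol`. -/
def edgeDer (c z a b : ℂ) (f : ℝ → ℂ) (x : ℝ) : ℂ :=
  cosWeight (-c) z x * (b - ∫ t in (0 : ℝ)..x, cosWeight c z t * f t) -
    z * sinWeight (-c) z x * (a + ∫ t in (0 : ℝ)..x, sinWeight c z t * f t)

@[simp] theorem edgeSol_zero_right (c z a b : ℂ) (f : ℝ → ℂ) : edgeSol c z a b f 0 = a := by
  simp [edgeSol, sinWeight, cosWeight]

@[simp] theorem edgeDer_zero_right (c z a b : ℂ) (f : ℝ → ℂ) : edgeDer c z a b f 0 = b := by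
  simp [edgeDer, sinWeight, cosWeight]

theorem hasACDeriv_primitive {g : ℝ → ℂ} (hg : IntervalIntegrable g volume 0 Real.pi) (a : ℂ) :
    HasACDeriv (fun x => a + ∫ t in (0 : ℝ)..x, g t) g :=
  ⟨hg, fun x _ => by simp⟩

section

variable {c z : ℂ} {f : ℝ → ℂ}

theorem cosWeight_mul_cosWeight (c z : ℂ) (x : ℝ) :
    cosWeight (-c) z x * cosWeight c z x = cosRoot z x ^ 2 := by
  rw [cosWeight, cosWeight]
  linear_combination cosRoot z x ^ 2 * gauge_neg_mul c x

theorem sinWeight_mul_sinWeight (c z : ℂ) (x : ℝ) :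
    sinWeight (-c) z x * sinWeight c z x = sinRoot z x ^ 2 := by
  rw [sinWeight, sinWeight]
  linear_combination sinRoot z x ^ 2 * gauge_neg_mul c x

theorem sinWeight_mul_cosWeight (c z : ℂ) (x : ℝ) :
    sinWeight (-c) z x * cosWeight c z x = sinRoot z x * cosRoot z x := by
  rw [sinWeight, cosWeight]
  linear_combination sinRoot z x * cosRoot z x * gauge_neg_mul c x

theorem cosWeight_mul_sinWeight (c z : ℂ) (x : ℝ) :
    cosWeight (-c) z x * sinWeight c z x = sinRoot z x * cosRoot z x := by
  rw [sinWeight, cosWeight]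
  linear_combination sinRoot z x * cosRoot z x * gauge_neg_mul c x

theorem hasACDeriv_parameters (hf : IntervalIntegrable f volume 0 Real.pi) (a b : ℂ) :
    HasACDeriv (fun x => b - ∫ t in (0 : ℝ)..x, cosWeight c z t * f t)
        (fun x => -(cosWeight c z x * f x)) ∧
      HasACDeriv (fun x => a + ∫ t in (0 : ℝ)..x, sinWeight c z t * f t)
        (fun x => sinWeight c z x * f x) := by
  have h1 : HasACDeriv (fun x => b + ∫ t in (0 : ℝ)..x, -(cosWeight c z t * f t))
      (fun x => -(cosWeight c z x * f x)) := hasACDeriv_primitive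
    (hf.continuousOn_mul (continuous_cosWeight c z).continuousOn).neg b
  have h2 := hasACDeriv_primitive
    (hf.continuousOn_mul (continuous_sinWeight c z).continuousOn) a
  refine ⟨?_, h2⟩
  simpa [sub_eq_add_neg] using h1

theorem hasACDeriv_edgeSol (hf : IntervalIntegrable f volume 0 Real.pi) (a b : ℂ) :
    HasACDeriv (edgeSol c z a b f) (fun x => edgeDer c z a b f x - c * edgeSol c z a b f x) := by
  obtain ⟨h1, h2⟩ := hasACDeriv_parameters (c := c) (z := z) hf a b
  have h := (h1.mul_left (hasDerivAt_sinWeight (-c) z) (continuous_deriv_sinWeight (-c) z)).add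
    (h2.mul_left (hasDerivAt_cosWeight (-c) z) (continuous_deriv_cosWeight (-c) z))
  refine h.congr_ae (Eventually.of_forall fun x => ?_)
  simp only [edgeSol, edgeDer]
  linear_combination f x * cosWeight_mul_sinWeight c z x - f x * sinWeight_mul_cosWeight c z x

theorem hasACDeriv_edgeDer (hf : IntervalIntegrable f volume 0 Real.pi) (a b : ℂ) :
    HasACDeriv (edgeDer c z a b f)
      (fun x => -(f x + z * edgeSol c z a b f x) - c * edgeDer c z a b f x) := by
  obtain ⟨h1, h2⟩ := hasACDeriv_parameters (c := c) (z := z) hf a b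
  have h := (h1.mul_left (hasDerivAt_cosWeight (-c) z) (continuous_deriv_cosWeight (-c) z)).add
    ((h2.mul_left (hasDerivAt_sinWeight (-c) z)
      (continuous_deriv_sinWeight (-c) z)).const_mul (-z))
  have e : edgeDer c z a b f = fun x =>
      cosWeight (-c) z x * (b - ∫ t in (0 : ℝ)..x, cosWeight c z t * f t) +
      -z * (sinWeight (-c) z x * (a + ∫ t in (0 : ℝ)..x, sinWeight c z t * f t)) := by
    funext x
    rw [edgeDer]
    ring
  rw [e]
  refine h.congr_ae (Eventually.of_forall fun x => ?_)
  simp only [edgeSol]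
  linear_combination -f x * cosWeight_mul_cosWeight c z x -
    z * f x * sinWeight_mul_sinWeight c z x - f x * cosRoot_sq_add z x

/-- Uniqueness for the edge equation. The combinations `hP` and `hQ` of `ψ` and `η` have derivatives
containing only `f`, so they are fixed by the initial values. The linear system is then inverted by
means of `cos² + z sin² = 1`. -/
theorem eq_edgeSol {ψ η v : ℝ → ℂ} (h1 : HasACDeriv ψ (fun x => η x - c * ψ x))
    (h2 : HasACDeriv η (fun x => -(v x) - c * η x))
    (hv : f =ᵐ[edgeMeasure] fun x => v x - z * ψ x) {x : ℝ} (hx : x ∈ Set.Icc 0 Real.pi) :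
    ψ x = edgeSol c z (ψ 0) (η 0) f x ∧ η x = edgeDer c z (ψ 0) (η 0) f x := by
  have hP : HasACDeriv (fun x => cosWeight c z x * ψ x + -1 * (sinWeight c z x * η x))
      (fun x => sinWeight c z x * f x) := by
    refine ((h1.mul_left (hasDerivAt_cosWeight c z) (continuous_deriv_cosWeight c z)).add
      ((h2.mul_left (hasDerivAt_sinWeight c z)
        (continuous_deriv_sinWeight c z)).const_mul (-1))).congr_ae ?_
    filter_upwards [hv] with x hx
    rw [hx]
    ring
  have hQ : HasACDeriv (fun x => z * (sinWeight c z x * ψ x) + cosWeight c z x * η x)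
      (fun x => -(cosWeight c z x * f x)) := by
    refine (((h1.mul_left (hasDerivAt_sinWeight c z)
      (continuous_deriv_sinWeight c z)).const_mul z).add
      (h2.mul_left (hasDerivAt_cosWeight c z) (continuous_deriv_cosWeight c z))).congr_ae ?_
    filter_upwards [hv] with x hx
    rw [hx]
    ring
  have eP := hP.2 x hx
  have eQ := hQ.2 x hx
  have c0 : cosWeight c z 0 = 1 := by simp [cosWeight]
  have s0 : sinWeight c z 0 = 0 := by simp [sinWeight]
  rw [intervalIntegral.integral_neg] at eQ
  simp only [c0, s0] at eP eQ
  have k1 := cosWeight_mul_cosWeight c z x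
  have k2 := sinWeight_mul_sinWeight c z x
  have k3 := sinWeight_mul_cosWeight c z x
  have k4 := cosWeight_mul_sinWeight c z x
  have k5 := cosRoot_sq_add z x
  constructor
  · rw [edgeSol]
    linear_combination cosWeight (-c) z x * eP + sinWeight (-c) z x * eQ - ψ x * k1
      - z * ψ x * k2 - η x * k3 + η x * k4 - ψ x * k5
  · rw [edgeDer]
    linear_combination cosWeight (-c) z x * eQ - z * sinWeight (-c) z x * eP - η x * k1
      - z * η x * k2 + z * ψ x * k3 - z * ψ x * k4 - η x * k5

end

/-! ### The edge spaces -/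

/-- `L²` of one edge. -/
abbrev EdgeL2 : Type := Lp ℂ 2 edgeMeasure

theorem intervalIntegrable_edgeL2 (f : EdgeL2) : IntervalIntegrable f volume 0 Real.pi := by
  rw [intervalIntegrable_iff_integrableOn_Icc_of_le Real.pi_pos.le]
  exact (Lp.memLp f).integrable (by norm_num)

theorem exists_integral_norm_le :
    ∃ K : ℝ, 0 ≤ K ∧ ∀ f : EdgeL2, ∫ t in (0 : ℝ)..Real.pi, ‖f t‖ ≤ K * ‖f‖ := by
  refine ⟨((edgeMeasure Set.univ) ^ (1 / (1 : ENNReal).toReal - 1 / (2 : ENNReal).toReal)).toReal,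
    ENNReal.toReal_nonneg, fun f => ?_⟩
  have h := eLpNorm_le_eLpNorm_mul_rpow_measure_univ (μ := edgeMeasure) (p := 1) (q := 2)
    (by norm_num) (Lp.aestronglyMeasurable f)
  have hfin : eLpNorm f 2 edgeMeasure * (edgeMeasure Set.univ) ^
      (1 / (1 : ENNReal).toReal - 1 / (2 : ENNReal).toReal) ≠ ⊤ := by
    refine ENNReal.mul_ne_top (Lp.eLpNorm_ne_top f) (ENNReal.rpow_ne_top_of_nonneg ?_ ?_)
    · norm_num
    · simp
  have h2 := ENNReal.toReal_mono hfin h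
  rw [ENNReal.toReal_mul, eLpNorm_one_eq_lintegral_enorm] at h2
  rw [intervalIntegral.integral_of_le Real.pi_pos.le, ← integral_Icc_eq_integral_Ioc,
    integral_norm_eq_lintegral_enorm (Lp.aestronglyMeasurable f), Lp.norm_def, mul_comm]
  exact h2

theorem exists_integral_mul_le {w : ℝ → ℂ} (hw : Continuous w) :
    ∃ K : ℝ, 0 ≤ K ∧ ∀ f : EdgeL2, ∀ x ∈ Set.Icc 0 Real.pi,
      ‖∫ t in (0 : ℝ)..x, w t * f t‖ ≤ K * ‖f‖ := by
  obtain ⟨K, hK, hKf⟩ := exists_integral_norm_le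
  obtain ⟨B, hB⟩ := (isCompact_Icc (a := (0 : ℝ)) (b := Real.pi)).exists_bound_of_continuousOn
    hw.continuousOn
  have hB0 : 0 ≤ B := (norm_nonneg _).trans (hB 0 ⟨le_rfl, Real.pi_pos.le⟩)
  refine ⟨B * K, mul_nonneg hB0 hK, fun f x hx => ?_⟩
  have hf := (intervalIntegrable_edgeL2 f).norm
  have hsub : Set.uIcc 0 x ⊆ Set.uIcc 0 Real.pi :=
    Set.uIcc_subset_uIcc_left (by rw [Set.uIcc_of_le Real.pi_pos.le]; exact hx)
  calc ‖∫ t in (0 : ℝ)..x, w t * f t‖ ≤ ∫ t in (0 : ℝ)..x, B * ‖f t‖ := by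
        apply intervalIntegral.norm_integral_le_of_norm_le hx.1
        · refine Eventually.of_forall fun t ht => ?_
          rw [norm_mul]
          exact mul_le_mul_of_nonneg_right (hB t ⟨ht.1.le, ht.2.trans hx.2⟩) (norm_nonneg _)
        · exact (hf.mono_set hsub).const_mul B
    _ = B * ∫ t in (0 : ℝ)..x, ‖f t‖ := intervalIntegral.integral_const_mul _ _
    _ ≤ B * ∫ t in (0 : ℝ)..Real.pi, ‖f t‖ := by
        apply mul_le_mul_of_nonneg_left _ hB0
        exact intervalIntegral.integral_mono_interval le_rfl hx.1 hx.2
          (Eventually.of_forall fun t => norm_nonneg _) hf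
    _ ≤ B * K * ‖f‖ := by
        rw [mul_assoc]
        exact mul_le_mul_of_nonneg_left (hKf f) hB0

theorem integral_mul_add {w : ℝ → ℂ} (hw : Continuous w) (f g : EdgeL2) {x : ℝ}
    (hx : x ∈ Set.Icc 0 Real.pi) :
    ∫ t in (0 : ℝ)..x, w t * (f + g : EdgeL2) t =
      (∫ t in (0 : ℝ)..x, w t * f t) + ∫ t in (0 : ℝ)..x, w t * g t := by
  have hsub : Set.uIcc 0 x ⊆ Set.uIcc 0 Real.pi :=
    Set.uIcc_subset_uIcc_left (by rw [Set.uIcc_of_le Real.pi_pos.le]; exact hx)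
  rw [← intervalIntegral.integral_add]
  · apply intervalIntegral.integral_congr_ae_restrict
    rw [Set.uIoc_of_le hx.1]
    have h : Set.Ioc 0 x ⊆ Set.Icc 0 Real.pi := fun t ht => ⟨ht.1.le, ht.2.trans hx.2⟩
    filter_upwards [ae_restrict_of_ae_restrict_of_subset h (Lp.coeFn_add f g)] with t ht
    rw [ht, Pi.add_apply, mul_add]
  · exact ((intervalIntegrable_edgeL2 f).mono_set hsub).continuousOn_mul hw.continuousOn
  · exact ((intervalIntegrable_edgeL2 g).mono_set hsub).continuousOn_mul hw.continuousOn

theorem integral_mul_smul (w : ℝ → ℂ) (k : ℂ) (f : EdgeL2) {x : ℝ}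
    (hx : x ∈ Set.Icc 0 Real.pi) :
    ∫ t in (0 : ℝ)..x, w t * (k • f : EdgeL2) t = k * ∫ t in (0 : ℝ)..x, w t * f t := by
  rw [← intervalIntegral.integral_const_mul]
  apply intervalIntegral.integral_congr_ae_restrict
  rw [Set.uIoc_of_le hx.1]
  have h : Set.Ioc 0 x ⊆ Set.Icc 0 Real.pi := fun t ht => ⟨ht.1.le, ht.2.trans hx.2⟩
  filter_upwards [ae_restrict_of_ae_restrict_of_subset h (Lp.coeFn_smul k f)] with t ht
  rw [ht, Pi.smul_apply, smul_eq_mul]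
  ring

theorem pi_mem_Icc : Real.pi ∈ Set.Icc 0 Real.pi := ⟨Real.pi_pos.le, le_rfl⟩

/-- Integration over an edge against a continuous weight. -/
def weightCLM (w : ℝ → ℂ) (hw : Continuous w) : EdgeL2 →L[ℂ] ℂ :=
  LinearMap.mkContinuousOfExistsBound
    { toFun f := ∫ t in (0 : ℝ)..Real.pi, w t * f t
      map_add' f g := integral_mul_add hw f g pi_mem_Icc
      map_smul' k f := integral_mul_smul w k f pi_mem_Icc }
    (by
      obtain ⟨K, -, hK⟩ := exists_integral_mul_le hw
      exact ⟨K, fun f => hK f _ pi_mem_Icc⟩)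

/-- The functional `f ↦ ∫ exp (c t) cos (√z t) f t`. -/
def cosFun (c z : ℂ) : EdgeL2 →L[ℂ] ℂ := weightCLM (cosWeight c z) (continuous_cosWeight c z)

/-- The functional `f ↦ ∫ exp (c t) sin (√z t) / √z f t`. -/
def sinFun (c z : ℂ) : EdgeL2 →L[ℂ] ℂ := weightCLM (sinWeight c z) (continuous_sinWeight c z)

theorem edgeSol_pi (c z a b : ℂ) (f : EdgeL2) :
    edgeSol c z a b f Real.pi =
      gauge (-c) Real.pi * (sinRoot z Real.pi * (b - cosFun c z f) +
        cosRoot z Real.pi * (a + sinFun c z f)) := by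
  change sinWeight (-c) z Real.pi * (b - cosFun c z f) +
    cosWeight (-c) z Real.pi * (a + sinFun c z f) = _
  rw [sinWeight, cosWeight]
  ring

theorem edgeDer_pi (c z a b : ℂ) (f : EdgeL2) :
    edgeDer c z a b f Real.pi =
      gauge (-c) Real.pi * (cosRoot z Real.pi * (b - cosFun c z f) -
        z * sinRoot z Real.pi * (a + sinFun c z f)) := by
  change cosWeight (-c) z Real.pi * (b - cosFun c z f) -
    z * sinWeight (-c) z Real.pi * (a + sinFun c z f) = _
  rw [sinWeight, cosWeight]
  ring

theorem continuousOn_edgeSol (c z a b : ℂ) (f : EdgeL2) :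
    ContinuousOn (edgeSol c z a b f) (Set.Icc 0 Real.pi) :=
  (hasACDeriv_edgeSol (intervalIntegrable_edgeL2 f) a b).continuousOn

theorem exists_edgeSol_le (c z : ℂ) :
    ∃ K : ℝ, 0 ≤ K ∧ ∀ (a b : ℂ) (f : EdgeL2), ∀ x ∈ Set.Icc 0 Real.pi,
      ‖edgeSol c z a b f x‖ ≤ K * ‖(a, b, f)‖ := by
  obtain ⟨K1, hK1, h1⟩ := exists_integral_mul_le (continuous_cosWeight c z)
  obtain ⟨K2, hK2, h2⟩ := exists_integral_mul_le (continuous_sinWeight c z)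
  obtain ⟨B1, hB1⟩ := (isCompact_Icc (a := (0 : ℝ)) (b := Real.pi)).exists_bound_of_continuousOn
    (continuous_sinWeight (-c) z).continuousOn
  obtain ⟨B2, hB2⟩ := (isCompact_Icc (a := (0 : ℝ)) (b := Real.pi)).exists_bound_of_continuousOn
    (continuous_cosWeight (-c) z).continuousOn
  have hB10 : 0 ≤ B1 := (norm_nonneg _).trans (hB1 0 ⟨le_rfl, Real.pi_pos.le⟩)
  have hB20 : 0 ≤ B2 := (norm_nonneg _).trans (hB2 0 ⟨le_rfl, Real.pi_pos.le⟩)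
  refine ⟨B1 * (1 + K1) + B2 * (1 + K2), by positivity, fun a b f x hx => ?_⟩
  have ha : ‖a‖ ≤ ‖(a, b, f)‖ := norm_fst_le (a, b, f)
  have hb : ‖b‖ ≤ ‖(a, b, f)‖ := (norm_fst_le (b, f)).trans (norm_snd_le (a, b, f))
  have hf : ‖f‖ ≤ ‖(a, b, f)‖ := (norm_snd_le (b, f)).trans (norm_snd_le (a, b, f))
  set N := ‖(a, b, f)‖
  have e1 : ‖b - ∫ t in (0 : ℝ)..x, cosWeight c z t * f t‖ ≤ (1 + K1) * N := by
    refine (norm_sub_le _ _).trans ?_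
    nlinarith [h1 f x hx, mul_le_mul_of_nonneg_left hf hK1]
  have e2 : ‖a + ∫ t in (0 : ℝ)..x, sinWeight c z t * f t‖ ≤ (1 + K2) * N := by
    refine (norm_add_le _ _).trans ?_
    nlinarith [h2 f x hx, mul_le_mul_of_nonneg_left hf hK2]
  rw [edgeSol]
  refine (norm_add_le _ _).trans ?_
  rw [norm_mul, norm_mul, add_mul, mul_assoc, mul_assoc]
  exact add_le_add (mul_le_mul (hB1 x hx) e1 (norm_nonneg _) hB10)
    (mul_le_mul (hB2 x hx) e2 (norm_nonneg _) hB20)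

theorem memLp_edgeSol (c z a b : ℂ) (f : EdgeL2) :
    MemLp (edgeSol c z a b f) 2 edgeMeasure := by
  obtain ⟨K, -, hK⟩ := exists_edgeSol_le c z
  refine MemLp.of_bound ((continuousOn_edgeSol c z a b f).aestronglyMeasurable measurableSet_Icc)
    (K * ‖(a, b, f)‖) ?_
  filter_upwards [ae_restrict_mem measurableSet_Icc] with x hx
  exact hK a b f x hx

/-- `edgeSol` as an operator from the initial values and the right-hand side. -/
def edgeCLM (c z : ℂ) : (ℂ × ℂ × EdgeL2) →L[ℂ] EdgeL2 :=
  LinearMap.mkContinuousOfExistsBound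
    { toFun p := (memLp_edgeSol c z p.1 p.2.1 p.2.2).toLp
      map_add' p q := by
        rw [← MemLp.toLp_add]
        apply MemLp.toLp_congr
        filter_upwards [ae_restrict_mem measurableSet_Icc] with x hx
        simp only [edgeSol, Pi.add_apply, Prod.fst_add, Prod.snd_add]
        rw [integral_mul_add (continuous_cosWeight c z) _ _ hx,
          integral_mul_add (continuous_sinWeight c z) _ _ hx]
        ring
      map_smul' k p := by
        rw [RingHom.id_apply, ← MemLp.toLp_const_smul]
        apply MemLp.toLp_congr
        filter_upwards [ae_restrict_mem measurableSet_Icc] with x hx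
        simp only [edgeSol, Pi.smul_apply, Prod.smul_fst, Prod.smul_snd, smul_eq_mul]
        rw [integral_mul_smul _ _ _ hx, integral_mul_smul _ _ _ hx]
        ring }
    (by
      obtain ⟨K, hK0, hK⟩ := exists_edgeSol_le c z
      refine ⟨(measureUnivNNReal edgeMeasure : ℝ) ^ (2 : ENNReal).toReal⁻¹ * K, fun p => ?_⟩
      refine (Lp.norm_le_of_ae_bound (C := K * ‖p‖) (by positivity) ?_).trans
        (le_of_eq (mul_assoc _ K ‖p‖).symm)
      filter_upwards [MemLp.coeFn_toLp (memLp_edgeSol c z p.1 p.2.1 p.2.2),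
        ae_restrict_mem measurableSet_Icc] with x h1 hx
      change ‖((memLp_edgeSol c z p.1 p.2.1 p.2.2).toLp : EdgeL2) x‖ ≤ _
      rw [h1]
      exact hK p.1 p.2.1 p.2.2 x hx)

theorem coeFn_edgeCLM (c z a b : ℂ) (f : EdgeL2) :
    (edgeCLM c z (a, b, f) : ℝ → ℂ) =ᵐ[edgeMeasure] edgeSol c z a b f :=
  MemLp.coeFn_toLp (memLp_edgeSol c z a b f)

/-- A solution vanishing almost everywhere has a quasiderivative vanishing almost everywhere. Both
are continuous, hence zero at the left end too. -/
theorem eq_zero_of_edgeCLM_eq_zero {c z a b : ℂ} (h : edgeCLM c z (a, b, 0) = 0) :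
    a = 0 ∧ b = 0 := by
  have hpi := Real.pi_pos
  have h0 : (0 : ℝ) ∈ Set.Icc 0 Real.pi := ⟨le_rfl, hpi.le⟩
  have hi := intervalIntegrable_edgeL2 (0 : EdgeL2)
  have d1 := hasACDeriv_edgeSol (c := c) (z := z) hi a b
  have d2 := hasACDeriv_edgeDer (c := c) (z := z) hi a b
  have e1 : edgeSol c z a b (0 : EdgeL2) =ᵐ[edgeMeasure] 0 := by
    filter_upwards [coeFn_edgeCLM c z a b 0, Lp.coeFn_zero ℂ 2 edgeMeasure] with x h1 h2
    rw [← h1, h]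
    exact h2
  have e2 : edgeDer c z a b (0 : EdgeL2) =ᵐ[edgeMeasure] 0 := by
    filter_upwards [d1.eq_zero e1, e1] with x h1 h2
    simp only [Pi.zero_apply] at h1 h2 ⊢
    linear_combination h1 + c * h2
  have z1 : Set.EqOn (edgeSol c z a b (0 : EdgeL2)) 0 (Set.Icc 0 Real.pi) :=
    Measure.eqOn_Icc_of_ae_eq volume hpi.ne e1 d1.continuousOn continuousOn_const
  have z2 : Set.EqOn (edgeDer c z a b (0 : EdgeL2)) 0 (Set.Icc 0 Real.pi) :=
    Measure.eqOn_Icc_of_ae_eq volume hpi.ne e2 d2.continuousOn continuousOn_const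
  exact ⟨by simpa using z1 h0, by simpa using z2 h0⟩

/-- The map from initial data to homogeneous solutions is injective on a finite-dimensional space,
hence bounded below. This is what makes the vertex values of an `L²` solution square summable. -/
theorem exists_norm_le_edgeCLM (c z : ℂ) :
    ∃ K : ℝ, 0 ≤ K ∧ ∀ (a b : ℂ) (f : EdgeL2),
      ‖a‖ ≤ K * (‖edgeCLM c z (a, b, f)‖ + ‖f‖) := by
  set L : (ℂ × ℂ) →ₗ[ℂ] EdgeL2 :=
    { toFun p := edgeCLM c z (p.1, p.2, 0)
      map_add' p q := by rw [← map_add]; simp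
      map_smul' k p := by rw [RingHom.id_apply, ← map_smul]; simp } with hL
  have hinj : Function.Injective L := by
    rw [injective_iff_map_eq_zero]
    rintro ⟨a, b⟩ h
    obtain ⟨rfl, rfl⟩ := eq_zero_of_edgeCLM_eq_zero h
    rfl
  obtain ⟨K, -, hK⟩ := L.injective_iff_antilipschitz.1 hinj
  set N : EdgeL2 →L[ℂ] EdgeL2 :=
    edgeCLM c z ∘L (ContinuousLinearMap.inr ℂ ℂ (ℂ × EdgeL2)) ∘L
      (ContinuousLinearMap.inr ℂ ℂ EdgeL2) with hN
  refine ⟨K * (1 + ‖N‖), by positivity, fun a b f => ?_⟩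
  have h1 := hK.le_mul_norm (by simp) (a, b)
  have h2 : L (a, b) = edgeCLM c z (a, b, f) - N f := by
    simp only [hL, hN, LinearMap.coe_mk, AddHom.coe_mk, ContinuousLinearMap.comp_apply,
      ContinuousLinearMap.inr_apply, ← map_sub]
    simp
  have h3 : ‖L (a, b)‖ ≤ (1 + ‖N‖) * (‖edgeCLM c z (a, b, f)‖ + ‖f‖) := by
    rw [h2]
    refine (norm_sub_le _ _).trans ?_
    nlinarith [N.le_opNorm f, norm_nonneg (edgeCLM c z (a, b, f)), norm_nonneg f,
      norm_nonneg N, mul_nonneg (norm_nonneg N) (norm_nonneg (edgeCLM c z (a, b, f)))]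
  calc ‖a‖ ≤ ‖(a, b)‖ := norm_fst_le (a, b)
    _ ≤ K * ‖L (a, b)‖ := h1
    _ ≤ K * ((1 + ‖N‖) * (‖edgeCLM c z (a, b, f)‖ + ‖f‖)) :=
        mul_le_mul_of_nonneg_left h3 K.2
    _ = _ := by ring

end RingChain
end

noncomputable section
namespace RingChain

/-! ### The resolvent equation on the chain -/

/-- An element of the graph is coded by its initial value `a e` and initial slope `b e` on each
edge, so only conditions at the vertices remain. -/
theorem mem_hamiltonianGraph_iff (A : ℝ) (α : ℤ → ℝ) (z : ℂ) (u f : L2Chain) :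
    (u, f + z • u) ∈ hamiltonianGraph A α ↔ ∃ a b : Edge → ℂ,
      (∀ e, u e = edgeCLM (quasiCoeff A e.2) z (a e, b e, f e)) ∧
      (∀ j, a (j, false) = a (j, true)) ∧
      (∀ j s, edgeSol (quasiCoeff A s) z (a (j - 1, s)) (b (j - 1, s)) (f (j - 1, s)) Real.pi =
        a (j, true)) ∧
      ∀ j, b (j, true) + b (j, false) -
        edgeDer (quasiCoeff A true) z (a (j - 1, true)) (b (j - 1, true)) (f (j - 1, true)) Real.pi -
        edgeDer (quasiCoeff A false) z (a (j - 1, false)) (b (j - 1, false)) (f (j - 1, false))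
          Real.pi = (α j : ℂ) * a (j, true) := by
  have hcoe : ∀ e, ((f + z • u : L2Chain) e : ℝ → ℂ) =ᵐ[edgeMeasure]
      fun x => f e x + z * u e x := by
    intro e
    filter_upwards [Lp.coeFn_add (f e) (z • u e), Lp.coeFn_smul z (u e)] with x h1 h2
    change ((f e + z • u e : EdgeL2) : ℝ → ℂ) x = _
    rw [h1, Pi.add_apply, h2, Pi.smul_apply, smul_eq_mul]
  constructor
  · rintro ⟨ψ, η, hu, h⟩
    have key : ∀ e, ∀ x ∈ Set.Icc 0 Real.pi,
        ψ e x = edgeSol (quasiCoeff A e.2) z (ψ e 0) (η e 0) (f e) x ∧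
          η e x = edgeDer (quasiCoeff A e.2) z (ψ e 0) (η e 0) (f e) x := by
      intro e x hx
      refine eq_edgeSol (h.deriv_fst e) (h.deriv_snd e) ?_ hx
      filter_upwards [hcoe e, hu e] with y h1 h2
      change f e y = (f + z • u : L2Chain) e y - z * ψ e y
      rw [h1, ← h2]
      ring
    refine ⟨fun e => ψ e 0, fun e => η e 0, fun e => ?_, h.lower_eq, fun j s => ?_, fun j => ?_⟩
    · apply Lp.ext
      filter_upwards [hu e, coeFn_edgeCLM (quasiCoeff A e.2) z (ψ e 0) (η e 0) (f e),
        ae_restrict_mem measurableSet_Icc] with x h1 h2 hx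
      rw [h2, ← (key e x hx).1]
      exact h1
    · rw [← (key (j - 1, s) Real.pi pi_mem_Icc).1]
      cases s
      · exact h.lower_left_eq j
      · exact h.upper_left_eq j
    · rw [← (key (j - 1, true) Real.pi pi_mem_Icc).2, ← (key (j - 1, false) Real.pi pi_mem_Icc).2]
      exact h.coupling j
  · rintro ⟨a, b, hu, h1, h2, h3⟩
    refine ⟨fun e => edgeSol (quasiCoeff A e.2) z (a e) (b e) (f e),
      fun e => edgeDer (quasiCoeff A e.2) z (a e) (b e) (f e), fun e => ?_,
      fun e => ?_, fun e => ?_, fun j => ?_, fun j => ?_, fun j => ?_, fun j => ?_⟩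
    · change (u e : ℝ → ℂ) =ᵐ[edgeMeasure] _
      rw [hu e]
      exact coeFn_edgeCLM _ _ _ _ _
    · exact hasACDeriv_edgeSol (intervalIntegrable_edgeL2 (f e)) _ _
    · refine (hasACDeriv_edgeDer (intervalIntegrable_edgeL2 (f e)) _ _).congr_ae ?_
      filter_upwards [hcoe e, coeFn_edgeCLM (quasiCoeff A e.2) z (a e) (b e) (f e)] with x k1 k2
      change _ = -((f + z • u : L2Chain) e x) - _
      rw [k1, hu e, k2]
    · simpa using h1 j
    · simpa using h2 j true
    · simpa using h2 j false
    · simpa using h3 j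

/-- The sign `exp (i A π)` for an integer magnetic potential. -/
def magSign (A : ℤ) : ℂ := (-1) ^ A

theorem magSign_mul_self (A : ℤ) : magSign A * magSign A = 1 := by
  rw [magSign, ← mul_zpow]
  simp

theorem magSign_eq_or (A : ℤ) : magSign A = 1 ∨ magSign A = -1 :=
  mul_self_eq_one_iff.1 (magSign_mul_self A)

/-- Integrality of `A` enters here: the phases `exp (∓iAπ)` collected on the two semicircles are the
same sign. -/
theorem gauge_quasiCoeff (A : ℤ) (s : Bool) :
    gauge (-quasiCoeff A s) Real.pi = magSign A := by
  have h1 : Complex.exp (-(Real.pi * Complex.I)) = -1 := by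
    rw [Complex.exp_neg, Complex.exp_pi_mul_I]
    norm_num
  cases s
  · have : -quasiCoeff A false * (Real.pi : ℂ) = (A : ℂ) * (Real.pi * Complex.I) := by
      simp [quasiCoeff]
      ring
    rw [gauge, this, Complex.exp_int_mul, Complex.exp_pi_mul_I, magSign]
  · have : -quasiCoeff A true * (Real.pi : ℂ) = (A : ℂ) * (-(Real.pi * Complex.I)) := by
      simp [quasiCoeff]
      ring
    rw [gauge, this, Complex.exp_int_mul, h1, magSign]

/-- The initial slope on an edge with boundary values `a` and `a'` and right-hand side `f`. -/
def initSlope (A : ℤ) (z : ℂ) (s : Bool) (a a' : ℂ) (f : EdgeL2) : ℂ :=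
  cosFun (quasiCoeff A s) z f + (magSign A * a' -
    cosRoot z Real.pi * (a + sinFun (quasiCoeff A s) z f)) / sinRoot z Real.pi

/-- The right-hand side of the vertex equation. -/
def vertexSource (A : ℤ) (z : ℂ) (f : L2Chain) (j : ℤ) : ℂ :=
  (sinRoot z Real.pi * cosFun (quasiCoeff A true) z (f (j, true)) -
      cosRoot z Real.pi * sinFun (quasiCoeff A true) z (f (j, true)) +
    (sinRoot z Real.pi * cosFun (quasiCoeff A false) z (f (j, false)) -
      cosRoot z Real.pi * sinFun (quasiCoeff A false) z (f (j, false)))) * (-(magSign A / 2)) +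
  (sinFun (quasiCoeff A true) z (f (j - 1, true)) +
    sinFun (quasiCoeff A false) z (f (j - 1, false))) * (-(1 / 2))

/-- Reduction of the resolvent equation to a difference equation for the vertex values. -/
theorem mem_hamiltonianGraph_iff_vertex (A : ℤ) (α : ℤ → ℝ) {z : ℂ} (hz : sinRoot z Real.pi ≠ 0)
    (u f : L2Chain) :
    (u, f + z • u) ∈ hamiltonianGraph A α ↔ ∃ a : ℤ → ℂ,
      (∀ e : Edge, u e = edgeCLM (quasiCoeff A e.2) z
        (a e.1, initSlope A z e.2 (a e.1) (a (e.1 + 1)) (f e), f e)) ∧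
      ∀ j, a (j + 1) + a (j - 1) -
        magSign A * (2 * cosRoot z Real.pi + α j * sinRoot z Real.pi / 2) * a j =
          vertexSource A z f j := by
  have hε := magSign_mul_self A
  have hp := cosRoot_sq_add z Real.pi
  -- Since `sinRoot z π ≠ 0`, the value at the right end is an invertible affine function of the
  -- initial slope.
  have hslope : ∀ (s : Bool) (a a' b : ℂ) (g : EdgeL2),
      edgeSol (quasiCoeff A s) z a b g Real.pi = a' ↔ b = initSlope A z s a a' g := by
    intro s a a' b g
    rw [edgeSol_pi, gauge_quasiCoeff, initSlope]
    constructor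
    · rintro rfl
      field_simp
      linear_combination -(sinRoot z Real.pi * (b - cosFun (quasiCoeff A s) z g) +
        cosRoot z Real.pi * (a + sinFun (quasiCoeff A s) z g)) * hε
    · rintro rfl
      field_simp
      linear_combination a' * hε
  have hder : ∀ (s : Bool) (a a' : ℂ) (g : EdgeL2),
      edgeDer (quasiCoeff A s) z a (initSlope A z s a a' g) g Real.pi =
        (cosRoot z Real.pi * a' - magSign A * (a + sinFun (quasiCoeff A s) z g)) /
          sinRoot z Real.pi := by
    intro s a a' g
    rw [edgeDer_pi, gauge_quasiCoeff, initSlope]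
    field_simp
    linear_combination cosRoot z Real.pi * a' * hε -
      magSign A * (a + sinFun (quasiCoeff A s) z g) * hp
  rw [mem_hamiltonianGraph_iff]
  constructor
  · rintro ⟨a, b, hu, h1, h2, h3⟩
    have hab : ∀ j s, a (j, s) = a (j, true) := by
      intro j s
      cases s
      · exact h1 j
      · rfl
    have hb : ∀ j s, b (j, s) = initSlope A z s (a (j, true)) (a (j + 1, true)) (f (j, s)) := by
      intro j s
      rw [← hab j s, ← hslope]
      simpa using h2 (j + 1) s
    refine ⟨fun j => a (j, true), fun ⟨j, s⟩ => ?_, fun j => ?_⟩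
    · rw [hu (j, s), hab j s, hb j s]
    · have h := h3 j
      rw [hab (j - 1) false, hb j, hb j, hb (j - 1), hb (j - 1), hder, hder, sub_add_cancel] at h
      simp only [initSlope] at h
      field_simp at h
      rw [vertexSource]
      -- After clearing the denominator `sinRoot z π`, the coupling condition times `magSign A / 2`
      -- is the difference equation, up to uses of `magSign A ^ 2 = 1`.
      linear_combination magSign A / 2 * h - (a (j + 1, true) + a (j - 1, true) +
        (sinFun (quasiCoeff A true) z (f (j - 1, true)) +
          sinFun (quasiCoeff A false) z (f (j - 1, false))) / 2) * hε
  · rintro ⟨a, hu, ha⟩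
    refine ⟨fun e => a e.1, fun e => initSlope A z e.2 (a e.1) (a (e.1 + 1)) (f e), hu,
      fun j => rfl, fun j s => ?_, fun j => ?_⟩
    · rw [hslope]
      simp
    · simp only
      rw [hder, hder, sub_add_cancel]
      have h := ha j
      rw [vertexSource] at h
      simp only [initSlope]
      field_simp
      linear_combination 2 * magSign A * h +
        (2 * cosRoot z Real.pi * 2 * a j + sinRoot z Real.pi * α j * a j
        - (sinRoot z Real.pi * cosFun (quasiCoeff A true) z (f (j, true)) -
      cosRoot z Real.pi * sinFun (quasiCoeff A true) z (f (j, true)) +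
    (sinRoot z Real.pi * cosFun (quasiCoeff A false) z (f (j, false)) -
      cosRoot z Real.pi * sinFun (quasiCoeff A false) z (f (j, false))))) * hε

end RingChain
end

noncomputable section
namespace RingChain

/-! ### Operators between `ℓ²` sums -/

section Pull

variable {ι ι' X : Type*} [NormedAddCommGroup X]

open Classical in
theorem sum_pull_le {τ : ι → ι'} {s : Set ι} (h : Set.InjOn τ s) (f : lp (fun _ : ι' => X) 2)
    (t : Finset ι) :
    ∑ i ∈ t, ‖if i ∈ s then f (τ i) else 0‖ ^ (2 : ENNReal).toReal ≤
      ‖f‖ ^ (2 : ENNReal).toReal := by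
  have h1 : ∑ i ∈ t, ‖if i ∈ s then f (τ i) else 0‖ ^ (2 : ENNReal).toReal =
      ∑ i ∈ t with i ∈ s, ‖f (τ i)‖ ^ (2 : ENNReal).toReal := by
    rw [Finset.sum_filter]
    refine Finset.sum_congr rfl fun i _ => ?_
    split_ifs <;> simp
  have h2 : ∑ i ∈ t with i ∈ s, ‖f (τ i)‖ ^ (2 : ENNReal).toReal =
      ∑ k ∈ (t.filter (· ∈ s)).image τ, ‖f k‖ ^ (2 : ENNReal).toReal := by
    rw [Finset.sum_image]
    intro i hi k hk
    exact h (by simpa using (Finset.mem_filter.1 hi).2) (by simpa using (Finset.mem_filter.1 hk).2)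
  rw [h1, h2]
  exact lp.sum_rpow_le_norm_rpow (by norm_num) f _

variable [NormedSpace ℂ X]

open Classical in
/-- Reindexing along a map that is injective on `s`, with zero outside of `s`. -/
def lpPull (τ : ι → ι') (s : Set ι) (h : Set.InjOn τ s) :
    lp (fun _ : ι' => X) 2 →L[ℂ] lp (fun _ : ι => X) 2 :=
  LinearMap.mkContinuous
    { toFun f := ⟨fun i => if i ∈ s then f (τ i) else 0, memℓp_gen' (sum_pull_le h f)⟩
      map_add' f g := by
        ext i
        change (if i ∈ s then (f + g) (τ i) else 0) =
          (if i ∈ s then f (τ i) else 0) + (if i ∈ s then g (τ i) else 0)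
        by_cases hi : i ∈ s <;> simp [hi]
      map_smul' k f := by
        ext i
        by_cases hi : i ∈ s <;> simp [hi] }
    1 (fun f => by
      rw [one_mul]
      exact lp.norm_le_of_forall_sum_le (by norm_num) (norm_nonneg _) (sum_pull_le h f))

open Classical in
theorem lpPull_apply (τ : ι → ι') (s : Set ι) (h : Set.InjOn τ s) (f : lp (fun _ : ι' => X) 2)
    (i : ι) : lpPull τ s h f i = if i ∈ s then f (τ i) else 0 := rfl

theorem norm_lpPull_le (τ : ι → ι') (s : Set ι) (h : Set.InjOn τ s) :
    ‖lpPull (X := X) τ s h‖ ≤ 1 :=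
  LinearMap.mkContinuous_norm_le _ zero_le_one _

end Pull

/-- The space of square summable vertex values. -/
abbrev VertexL2 : Type := lp (fun _ : ℤ => ℂ) 2

/-- Translation of sequences: `(shift m a) j = a (j + m)`. -/
def shift (m : ℤ) : VertexL2 →L[ℂ] VertexL2 :=
  lpPull (· + m) Set.univ (add_left_injective m).injOn

@[simp] theorem shift_apply (m : ℤ) (a : VertexL2) (j : ℤ) : shift m a j = a (j + m) := by
  rw [shift, lpPull_apply, if_pos (Set.mem_univ j)]

theorem norm_shift_le (m : ℤ) : ‖shift m‖ ≤ 1 := norm_lpPull_le _ _ _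

/-- The restriction of a sequence to the vertex `1`. -/
def siteProj : VertexL2 →L[ℂ] VertexL2 := lpPull id {1} Function.injective_id.injOn

theorem siteProj_apply (a : VertexL2) (j : ℤ) : siteProj a j = if j = 1 then a j else 0 := by
  rw [siteProj, lpPull_apply]
  simp

/-- The difference operator `a ↦ a (j + 1) + a (j - 1) - β a j - d δ_{j1} a j`. -/
def vertexOp (β d : ℂ) : VertexL2 →L[ℂ] VertexL2 :=
  shift 1 + shift (-1) - β • 1 - d • siteProj

theorem vertexOp_apply (β d : ℂ) (a : VertexL2) (j : ℤ) :
    vertexOp β d a j = a (j + 1) + a (j - 1) - β * a j - if j = 1 then d * a j else 0 := by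
  have h : vertexOp β d a = shift 1 a + shift (-1) a - β • a - d • siteProj a := rfl
  rw [h]
  simp only [lp.coeFn_sub, lp.coeFn_add, lp.coeFn_smul, Pi.sub_apply, Pi.add_apply,
    Pi.smul_apply, smul_eq_mul, shift_apply, siteProj_apply]
  rw [← sub_eq_add_neg]
  split_ifs <;> simp

/-- With `S = shift 1` the operator is `-l⁻¹ (1 - l S⁻¹)(1 - l S)`. Both brackets are inverted by a
Neumann series, because shifts have norm at most one. -/
theorem isUnit_vertexOp_zero {l : ℂ} (h0 : l ≠ 0) (h1 : ‖l‖ < 1) :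
    IsUnit (vertexOp (l + l⁻¹) 0) := by
  have hu : ∀ m, IsUnit (1 - l • shift m) := by
    intro m
    apply isUnit_one_sub_of_norm_lt_one
    rw [norm_smul]
    calc ‖l‖ * ‖shift m‖ ≤ ‖l‖ * 1 := mul_le_mul_of_nonneg_left (norm_shift_le m) (norm_nonneg _)
      _ < 1 := by rwa [mul_one]
  have hc : IsUnit ((-l⁻¹) • (1 : VertexL2 →L[ℂ] VertexL2)) := by
    rw [← Algebra.algebraMap_eq_smul_one]
    exact (IsUnit.mk0 (-l⁻¹) (by simpa using h0)).map (algebraMap ℂ (VertexL2 →L[ℂ] VertexL2))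
  have e : vertexOp (l + l⁻¹) 0 =
      ((-l⁻¹) • (1 : VertexL2 →L[ℂ] VertexL2)) * ((1 - l • shift (-1)) * (1 - l • shift 1)) := by
    ext a j
    have h : (((-l⁻¹) • (1 : VertexL2 →L[ℂ] VertexL2)) *
        ((1 - l • shift (-1)) * (1 - l • shift 1))) a =
        (-l⁻¹) • ((a - l • shift 1 a) - l • shift (-1) (a - l • shift 1 a)) := rfl
    rw [h, vertexOp_apply]
    simp only [lp.coeFn_sub, lp.coeFn_smul, Pi.sub_apply, Pi.smul_apply, smul_eq_mul, shift_apply,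
      sub_add_cancel, zero_mul, ite_self, sub_zero, ← sub_eq_add_neg]
    field_simp
    ring
  rw [e]
  exact hc.mul ((hu _).mul (hu _))

/-- A rank one perturbation of an invertible difference operator is invertible if it is
injective. -/
theorem isUnit_vertexOp {l : ℂ} (h0 : l ≠ 0) (h1 : ‖l‖ < 1) {d : ℂ}
    (hinj : ∀ a, vertexOp (l + l⁻¹) d a = 0 → a = 0) : IsUnit (vertexOp (l + l⁻¹) d) := by
  have hsplit : ∀ a, vertexOp (l + l⁻¹) d a = vertexOp (l + l⁻¹) 0 a - d • siteProj a := by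
    intro a
    simp [vertexOp]
  have hsite : ∀ a, siteProj a = a 1 • lp.single 2 (1 : ℤ) (1 : ℂ) := by
    intro a
    ext j
    rw [siteProj_apply]
    by_cases hj : j = 1
    · subst hj
      simp
    · simp [hj]
  obtain ⟨hi, hs⟩ := ContinuousLinearMap.isUnit_iff_bijective.1 (isUnit_vertexOp_zero h0 h1)
  obtain ⟨g, hg⟩ := hs (lp.single 2 (1 : ℤ) (1 : ℂ))
  -- The rank one determinant. If it vanished, `g`, the unperturbed preimage of the unit vector at
  -- the impurity, would lie in the kernel.
  have hne : 1 - d * g 1 ≠ 0 := by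
    intro h
    have hg0 : g = 0 := by
      apply hinj
      rw [hsplit, hg, hsite, smul_smul, ← sub_eq_zero.1 h, one_smul, sub_self]
    rw [hg0, map_zero] at hg
    have := congrArg (fun a : VertexL2 => a 1) hg
    simp at this
  rw [ContinuousLinearMap.isUnit_iff_bijective]
  refine ⟨(injective_iff_map_eq_zero _).2 hinj, fun y => ?_⟩
  obtain ⟨x, hx⟩ := hs y
  -- The coefficient `t` of `g` is found by solving `t = d (x 1 + t g 1)`, as in the
  -- Sherman–Morrison formula.
  refine ⟨x + (d * x 1 / (1 - d * g 1)) • g, ?_⟩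
  rw [hsplit, map_add, map_smul, hx, hg, hsite, smul_smul, add_sub_assoc, ← sub_smul]
  have : d * x 1 / (1 - d * g 1) -
      d * (x + (d * x 1 / (1 - d * g 1)) • g : VertexL2) 1 = 0 := by
    simp only [lp.coeFn_add, lp.coeFn_smul, Pi.add_apply, Pi.smul_apply, smul_eq_mul]
    field_simp
    ring
  rw [this, zero_smul, add_zero]

/-! ### Decaying solutions of the difference equation -/

/-- The combination `x (n + 1) - l x n` isolates the component proportional to `l⁻¹ ^ n`, which does
not decay and so must be absent. -/
theorem eq_pow_mul_of_tendsto_zero {l : ℂ} (h0 : l ≠ 0) (h1 : ‖l‖ < 1) {x : ℕ → ℂ}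
    (hx : ∀ n, x (n + 2) = (l + l⁻¹) * x (n + 1) - x n) (ht : Tendsto x atTop (𝓝 0)) (n : ℕ) :
    x n = l ^ n * x 0 := by
  have hy : ∀ n, x (n + 1) - l * x n = (l⁻¹) ^ n * (x 1 - l * x 0) := by
    intro n
    induction n with
    | zero => simp
    | succ n ih =>
      rw [pow_succ', mul_assoc, ← ih, hx n]
      field_simp
      ring
  have hy0 : x 1 - l * x 0 = 0 := by
    have ht1 : Tendsto (fun n => ‖x (n + 1) - l * x n‖) atTop (𝓝 0) := by
      have := ((ht.comp (tendsto_add_atTop_nat 1)).sub (ht.const_mul l)).norm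
      simpa using this
    have hle : ∀ n, ‖x 1 - l * x 0‖ ≤ ‖x (n + 1) - l * x n‖ := by
      intro n
      rw [hy n, norm_mul, norm_pow, norm_inv]
      apply le_mul_of_one_le_left (norm_nonneg _)
      exact one_le_pow₀ ((one_le_inv₀ (norm_pos_iff.2 h0)).2 h1.le)
    exact norm_le_zero_iff.1 (ge_of_tendsto' ht1 hle)
  induction n with
  | zero => simp
  | succ n ih =>
    have h := hy n
    rw [hy0, mul_zero, ih] at h
    rw [pow_succ']
    linear_combination h

/-- The nonnegative form `q` is conserved by the recursion and tends to zero, so it vanishes. For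
`|r| < 1` this gives `x n = 0` at once. For `|r| = 1` it gives `x (n + 1) = r x n`, so `‖x n‖` is
constant and again zero. -/
theorem eq_zero_of_tendsto_zero {r : ℝ} (h1 : -1 ≤ r) (h2 : r ≤ 1) {x : ℕ → ℂ}
    (hx : ∀ n, x (n + 2) = 2 * r * x (n + 1) - x n) (ht : Tendsto x atTop (𝓝 0)) (n : ℕ) :
    x n = 0 := by
  set q : ℕ → ℝ := fun n => Complex.normSq (x (n + 1) - r * x n) + (1 - r ^ 2) * Complex.normSq (x n)
    with hq
  have hstep : ∀ n, q (n + 1) = q n := by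
    intro n
    have h := hx n
    have hre := congrArg Complex.re h
    have him := congrArg Complex.im h
    simp only [Complex.sub_re, Complex.sub_im, Complex.mul_re, Complex.mul_im, Complex.ofReal_re,
      Complex.ofReal_im, Complex.re_ofNat, Complex.im_ofNat] at hre him
    simp only [hq, Complex.normSq_apply, Complex.sub_re, Complex.sub_im, Complex.mul_re,
      Complex.mul_im, Complex.ofReal_re, Complex.ofReal_im]
    rw [hre, him]
    ring
  have hconst : ∀ n, q n = q 0 := by
    intro n
    induction n with
    | zero => rfl
    | succ n ih => rw [hstep, ih]
  have hlim : Tendsto q atTop (𝓝 0) := by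
    have a1 : Tendsto (fun n => x (n + 1) - r * x n) atTop (𝓝 0) := by
      simpa using (ht.comp (tendsto_add_atTop_nat 1)).sub (ht.const_mul (r : ℂ))
    have c1 := (Complex.continuous_normSq.tendsto 0).comp a1
    have c2 := ((Complex.continuous_normSq.tendsto 0).comp ht).const_mul (1 - r ^ 2)
    simpa using c1.add c2
  have hq0 : ∀ n, q n = 0 := by
    intro n
    have : Tendsto q atTop (𝓝 (q 0)) := by
      rw [show q = fun _ => q 0 from funext hconst]
      exact tendsto_const_nhds
    rw [hconst n]
    exact tendsto_nhds_unique this hlim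
  have hr : 0 ≤ 1 - r ^ 2 := by nlinarith
  have hparts : ∀ n, x (n + 1) = r * x n ∧ (1 - r ^ 2) * Complex.normSq (x n) = 0 := by
    intro n
    have h := hq0 n
    have p1 := Complex.normSq_nonneg (x (n + 1) - r * x n)
    have p2 := mul_nonneg hr (Complex.normSq_nonneg (x n))
    simp only [hq] at h
    refine ⟨?_, by linarith⟩
    have : Complex.normSq (x (n + 1) - r * x n) = 0 := by linarith
    exact sub_eq_zero.1 (Complex.normSq_eq_zero.1 this)
  rcases hr.eq_or_lt with h | h
  · have hnorm : ∀ m, ‖x (n + m)‖ = ‖x n‖ := by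
      have hra : |r| = 1 := by
        rw [← sq_eq_sq₀ (abs_nonneg r) zero_le_one, sq_abs]
        linarith
      intro m
      induction m with
      | zero => rfl
      | succ m ih =>
        rw [← add_assoc, (hparts (n + m)).1, norm_mul, Complex.norm_real, Real.norm_eq_abs, hra,
          one_mul, ih]
    have ht' : Tendsto (fun m => ‖x (n + m)‖) atTop (𝓝 0) := by
      have := (ht.comp (tendsto_add_atTop_nat n)).norm
      simpa [Function.comp_def, add_comm] using this
    simp only [hnorm] at ht'
    exact norm_eq_zero.1 (tendsto_nhds_unique tendsto_const_nhds ht')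
  · have := (mul_eq_zero.1 (hparts n).2).resolve_left h.ne'
    exact Complex.normSq_eq_zero.1 this

/-- The roots of `l² - βl + 1` have product one. If neither is inside the unit disc, both are on the
circle, and then `β = l + conj l = 2 Re l`. -/
theorem exists_root_norm_lt_one {β : ℂ} (h : ∀ r : ℝ, -1 ≤ r → r ≤ 1 → β ≠ 2 * r) :
    ∃ l : ℂ, l ≠ 0 ∧ ‖l‖ < 1 ∧ l + l⁻¹ = β := by
  obtain ⟨w, hw⟩ : ∃ w : ℂ, w ^ 2 = β ^ 2 / 4 - 1 := ⟨_, csqrt_sq _⟩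
  have hprod : (β / 2 + w) * (β / 2 - w) = 1 := by linear_combination -hw
  have h1 : β / 2 + w ≠ 0 := left_ne_zero_of_mul_eq_one hprod
  have hinv : (β / 2 + w)⁻¹ = β / 2 - w := inv_eq_of_mul_eq_one_right hprod
  have hsum : (β / 2 + w) + (β / 2 + w)⁻¹ = β := by
    rw [hinv]
    ring
  rcases lt_trichotomy ‖β / 2 + w‖ 1 with hl | hl | hl
  · exact ⟨_, h1, hl, hsum⟩
  · exfalso
    set l := β / 2 + w with hldef
    have hconj : l⁻¹ = (starRingEnd ℂ) l := by
      rw [Complex.inv_def, Complex.normSq_eq_norm_sq, hl]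
      simp
    have hre := Complex.abs_re_le_norm l
    rw [hl, abs_le] at hre
    apply h l.re hre.1 hre.2
    rw [← hsum, hconj, Complex.add_conj]
    push_cast
    ring
  · refine ⟨(β / 2 + w)⁻¹, inv_ne_zero h1, ?_, ?_⟩
    · rw [norm_inv]
      exact inv_lt_one_of_one_lt₀ hl
    · rw [inv_inv, add_comm]
      exact hsum

theorem tendsto_vertexL2 (a : VertexL2) {τ : ℕ → ℤ} (hτ : Function.Injective τ) :
    Tendsto (fun n => a (τ n)) atTop (𝓝 0) := by
  have hs := (lp.memℓp a).summable (by norm_num)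
  have h1 := hs.tendsto_cofinite_zero.comp (hτ.tendsto_cofinite)
  rw [Nat.cofinite_eq_atTop] at h1
  have h2 := h1.sqrt
  rw [Real.sqrt_zero] at h2
  rw [tendsto_zero_iff_norm_tendsto_zero]
  refine h2.congr fun n => ?_
  simp

theorem vertexOp_eq_zero_iff {β d : ℂ} {a : VertexL2} :
    vertexOp β d a = 0 ↔
      ∀ j, a (j + 1) + a (j - 1) - β * a j - (if j = 1 then d * a j else 0) = 0 := by
  constructor
  · intro h j
    rw [← vertexOp_apply, h]
    rfl
  · intro h
    ext j
    rw [vertexOp_apply, h]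
    rfl

/-- Elements of the kernel decay exponentially away from the impurity. -/
theorem eq_pow_of_vertexOp_eq_zero {l d : ℂ} (h0 : l ≠ 0) (h1 : ‖l‖ < 1) {a : VertexL2}
    (ha : vertexOp (l + l⁻¹) d a = 0) (j : ℤ) : a j = l ^ (j - 1).natAbs * a 1 := by
  rw [vertexOp_eq_zero_iff] at ha
  have hr : ∀ n : ℕ, a (1 + n) = l ^ n * a 1 := by
    intro n
    have := eq_pow_mul_of_tendsto_zero h0 h1 (x := fun n : ℕ => a (1 + n)) (fun n => ?_)
      (tendsto_vertexL2 a (τ := fun n : ℕ => 1 + (n : ℤ)) fun n m h => by simpa using h) n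
    · simpa using this
    · have h := ha (1 + (n + 1 : ℕ))
      rw [if_neg (by push_cast; omega),
        show (1 : ℤ) + (n + 1 : ℕ) + 1 = 1 + (n + 2 : ℕ) by push_cast; ring,
        show (1 : ℤ) + (n + 1 : ℕ) - 1 = 1 + n by push_cast; ring] at h
      linear_combination h
  have hl : ∀ n : ℕ, a (1 - n) = l ^ n * a 1 := by
    intro n
    have := eq_pow_mul_of_tendsto_zero h0 h1 (x := fun n : ℕ => a (1 - n)) (fun n => ?_)
      (tendsto_vertexL2 a (τ := fun n : ℕ => 1 - (n : ℤ)) fun n m h => by simpa using h) n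
    · simpa using this
    · have h := ha (1 - (n + 1 : ℕ))
      rw [if_neg (by push_cast; omega),
        show (1 : ℤ) - (n + 1 : ℕ) + 1 = 1 - n by push_cast; ring,
        show (1 : ℤ) - (n + 1 : ℕ) - 1 = 1 - (n + 2 : ℕ) by push_cast; ring] at h
      linear_combination h
  rcases le_total 1 j with h | h
  · have e := hr (j - 1).natAbs
    rwa [show (1 : ℤ) + (j - 1).natAbs = j by omega] at e
  · have e := hl (j - 1).natAbs
    rwa [show (1 : ℤ) - (j - 1).natAbs = j by omega] at e

/-- Both neighbours of the impurity carry `l * a 1`, so the equation at vertex `1` reads `2l - (l +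
l⁻¹) - d = 0`. -/
theorem sub_inv_eq_of_vertexOp_eq_zero {l d : ℂ} (h0 : l ≠ 0) (h1 : ‖l‖ < 1) {a : VertexL2}
    (ha : vertexOp (l + l⁻¹) d a = 0) (hne : a ≠ 0) : l - l⁻¹ = d := by
  have hp := eq_pow_of_vertexOp_eq_zero h0 h1 ha
  have ha1 : a 1 ≠ 0 := by
    intro h
    apply hne
    ext j
    rw [hp j, h, mul_zero]
    rfl
  have h := (vertexOp_eq_zero_iff.1 ha) 1
  rw [if_pos rfl, hp (1 + 1), hp (1 - 1)] at h
  norm_num at h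
  apply mul_right_cancel₀ ha1
  linear_combination h

theorem exists_vertexOp_eq_zero {l d : ℂ} (h0 : l ≠ 0) (h1 : ‖l‖ < 1) (hd : l - l⁻¹ = d) :
    ∃ a : VertexL2, a ≠ 0 ∧ vertexOp (l + l⁻¹) d a = 0 := by
  have hs : Summable fun j : ℤ => ‖l ^ (j - 1).natAbs‖ ^ (2 : ENNReal).toReal := by
    have h2 : Summable fun j : ℤ => (‖l‖ ^ 2) ^ j.natAbs := by
      have hg := summable_geometric_of_lt_one (sq_nonneg ‖l‖)
        (pow_lt_one₀ (norm_nonneg _) h1 two_ne_zero)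
      exact Summable.of_nat_of_neg (by simpa using hg) (by simpa using hg)
    have h3 := h2.comp_injective (sub_left_injective (b := (1 : ℤ)))
    refine h3.congr fun j => ?_
    simp only [Function.comp_apply, norm_pow, ENNReal.toReal_ofNat, Real.rpow_ofNat]
    rw [← pow_mul, ← pow_mul, mul_comm]
  refine ⟨⟨fun j => l ^ (j - 1).natAbs, memℓp_gen hs⟩, fun h => ?_, ?_⟩
  · have := congrArg (fun a : VertexL2 => a 1) h
    simp at this
  · rw [vertexOp_eq_zero_iff]
    intro j
    change l ^ (j + 1 - 1).natAbs + l ^ (j - 1 - 1).natAbs - (l + l⁻¹) * l ^ (j - 1).natAbs -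
      (if j = 1 then d * l ^ (j - 1).natAbs else 0) = 0
    rcases lt_trichotomy j 1 with hj | rfl | hj
    · obtain ⟨n, rfl⟩ : ∃ n : ℕ, j = -n := ⟨j.natAbs, by omega⟩
      rw [if_neg hj.ne, show (-(n : ℤ) + 1 - 1).natAbs = n by omega,
        show (-(n : ℤ) - 1 - 1).natAbs = n + 2 by omega,
        show (-(n : ℤ) - 1).natAbs = n + 1 by omega]
      field_simp
      ring
    · rw [← hd]
      norm_num
    · obtain ⟨n, rfl⟩ : ∃ n : ℕ, j = n + 2 := ⟨(j - 2).natAbs, by omega⟩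
      rw [if_neg hj.ne', show ((n : ℤ) + 2 + 1 - 1).natAbs = n + 2 by omega,
        show ((n : ℤ) + 2 - 1 - 1).natAbs = n by omega,
        show ((n : ℤ) + 2 - 1).natAbs = n + 1 by omega]
      field_simp
      ring

end RingChain
end

/-! ### Eigenvalues and resolvent set in terms of the graph -/

namespace UnboundedOp

variable {E : Type*} [NormedAddCommGroup E] [InnerProductSpace ℂ E]

theorem isEigenvalue_iff {T : E →ₗ.[ℂ] E} {z : ℂ} :
    IsEigenvalue T z ↔ ∃ u : E, u ≠ 0 ∧ (u, z • u) ∈ T.graph := by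
  constructor
  · rintro ⟨u, hu, h⟩
    exact ⟨u, hu, T.mem_graph_iff.2 ⟨u, rfl, h⟩⟩
  · rintro ⟨u, hu, h⟩
    obtain ⟨y, hy, hT⟩ := T.mem_graph_iff.1 h
    refine ⟨y, ?_, ?_⟩
    · rw [hy]
      exact hu
    · rw [hT, hy]

theorem mem_resolventSet_of_graph {T : E →ₗ.[ℂ] E} {z : ℂ} (R : E →L[ℂ] E)
    (h1 : ∀ f, (R f, f + z • R f) ∈ T.graph) (h2 : ∀ u f, (u, f + z • u) ∈ T.graph → R f = u) :
    z ∈ resolventSet T := by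
  refine ⟨R, fun f => ?_, fun u => ?_⟩
  · obtain ⟨y, hy, hT⟩ := T.mem_graph_iff.1 (h1 f)
    simp only at hy hT
    have hmem : R f ∈ T.domain := hy ▸ y.2
    refine ⟨hmem, ?_⟩
    have : (⟨R f, hmem⟩ : T.domain) = y := Subtype.ext hy.symm
    rw [this, hT]
    simp
  · apply h2
    rw [sub_add_cancel]
    exact T.mem_graph u

theorem exists_graph_of_mem_resolventSet {T : E →ₗ.[ℂ] E} {z : ℂ} (hz : z ∈ resolventSet T)
    (f : E) : ∃ u, (u, f + z • u) ∈ T.graph := by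
  obtain ⟨R, h1, -⟩ := hz
  obtain ⟨h, hf⟩ := h1 f
  refine ⟨R f, T.mem_graph_iff.2 ⟨⟨R f, h⟩, rfl, ?_⟩⟩
  exact sub_eq_iff_eq_add.1 hf

theorem IsEigenvalue.mem_spectrum {T : E →ₗ.[ℂ] E} {z : ℂ} (h : IsEigenvalue T z) :
    z ∈ spectrum T := by
  obtain ⟨u, hu, hT⟩ := h
  rintro ⟨R, -, h2⟩
  apply hu
  rw [← h2 u, hT, sub_self, map_zero]

end UnboundedOp

noncomputable section
namespace RingChain

/-! ### The chain operators in terms of vertex values -/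

section BoolMap

variable {X Y : Type*} [NormedAddCommGroup X] [NormedSpace ℂ X] [NormedAddCommGroup Y]
  [NormedSpace ℂ Y]

/-- Edgewise application of an operator that only depends on the type of the edge. -/
def boolMap (T : Bool → X →L[ℂ] Y) :
    lp (fun _ : Edge => X) 2 →L[ℂ] lp (fun _ : Edge => Y) 2 :=
  lp.mapCLM 2 (fun e : Edge => T e.2) (K := ‖T true‖ + ‖T false‖) (by positivity) fun e => by
    cases e.2
    · exact le_add_of_nonneg_left (norm_nonneg _)
    · exact le_add_of_nonneg_right (norm_nonneg _)

theorem boolMap_apply (T : Bool → X →L[ℂ] Y) (f : lp (fun _ : Edge => X) 2) (e : Edge) :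
    boolMap T f e = T e.2 (f e) := rfl

/-- Restriction to the edges of type `s`, translated by `m`. -/
def edgePull (m : ℤ) (s : Bool) : lp (fun _ : Edge => X) 2 →L[ℂ] lp (fun _ : ℤ => X) 2 :=
  lpPull (fun j => (j + m, s)) Set.univ fun i _ j _ h => by simpa using h

theorem edgePull_apply (m : ℤ) (s : Bool) (f : lp (fun _ : Edge => X) 2) (j : ℤ) :
    edgePull m s f j = f (j + m, s) := by
  exact (lpPull_apply _ _ _ f j).trans (if_pos (Set.mem_univ j))

/-- The value at the left end of each edge. -/
def leftValue : lp (fun _ : ℤ => X) 2 →L[ℂ] lp (fun _ : Edge => X) 2 :=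
  -- `Prod.fst` is two-to-one on edges, whereas `lpPull` needs injectivity; hence one summand for
  -- each type of edge.
  lpPull Prod.fst {e : Edge | e.2 = true} (by
      rintro ⟨i, s⟩ hs ⟨j, t⟩ ht h
      exact Prod.ext h (Eq.trans hs (Eq.symm ht))) +
    lpPull Prod.fst {e : Edge | e.2 = false} (by
      rintro ⟨i, s⟩ hs ⟨j, t⟩ ht h
      exact Prod.ext h (Eq.trans hs (Eq.symm ht)))

theorem leftValue_apply (a : lp (fun _ : ℤ => X) 2) (e : Edge) : leftValue a e = a e.1 := by
  refine (congrArg₂ (· + ·) (lpPull_apply _ _ _ a e) (lpPull_apply _ _ _ a e)).trans ?_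
  rcases e with ⟨j, s⟩
  cases s <;> simp

end BoolMap

/-- The solution on the chain with zero right-hand side and given vertex values. -/
def vertexLift (A : ℤ) (z : ℂ) : VertexL2 →L[ℂ] L2Chain :=
  boolMap (fun s => ContinuousLinearMap.toSpanSingleton ℂ
      (edgeCLM (quasiCoeff A s) z (1, -(cosRoot z Real.pi / sinRoot z Real.pi), 0))) ∘L leftValue +
    boolMap (fun s => ContinuousLinearMap.toSpanSingleton ℂ
      (edgeCLM (quasiCoeff A s) z (0, magSign A / sinRoot z Real.pi, 0))) ∘L leftValue ∘L shift 1

/-- The solution on the chain with zero vertex values and given right-hand side. -/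
def dirichletLift (A : ℤ) (z : ℂ) : L2Chain →L[ℂ] L2Chain :=
  boolMap fun s => edgeCLM (quasiCoeff A s) z ∘L
    (ContinuousLinearMap.prod 0 (ContinuousLinearMap.prod
      (cosFun (quasiCoeff A s) z -
        (cosRoot z Real.pi / sinRoot z Real.pi) • sinFun (quasiCoeff A s) z)
      (ContinuousLinearMap.id ℂ EdgeL2)))

theorem vertexLift_add_dirichletLift (A : ℤ) (z : ℂ) (a : VertexL2) (f : L2Chain) (e : Edge) :
    (vertexLift A z a + dirichletLift A z f) e = edgeCLM (quasiCoeff A e.2) z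
      (a e.1, initSlope A z e.2 (a e.1) (a (e.1 + 1)) (f e), f e) := by
  have h1 : (vertexLift A z a + dirichletLift A z f) e =
      leftValue a e • edgeCLM (quasiCoeff A e.2) z
        (1, -(cosRoot z Real.pi / sinRoot z Real.pi), 0) +
      leftValue (shift 1 a) e • edgeCLM (quasiCoeff A e.2) z
        (0, magSign A / sinRoot z Real.pi, 0) +
      edgeCLM (quasiCoeff A e.2) z (0, cosFun (quasiCoeff A e.2) z (f e) -
        (cosRoot z Real.pi / sinRoot z Real.pi) * sinFun (quasiCoeff A e.2) z (f e), f e) := rfl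
  rw [h1, leftValue_apply, leftValue_apply, shift_apply, ← map_smul, ← map_smul, ← map_add,
    ← map_add]
  congr 1
  simp only [Prod.smul_mk, Prod.mk_add_mk, smul_eq_mul, mul_one, mul_zero, smul_zero, add_zero,
    zero_add, Prod.mk.injEq, true_and, and_true]
  rw [initSlope]
  ring

/-- `vertexSource` as an operator. -/
def vertexSourceCLM (A : ℤ) (z : ℂ) : L2Chain →L[ℂ] VertexL2 :=
  (-(magSign A / 2)) • ((edgePull 0 true + edgePull 0 false) ∘L
      boolMap (fun s => sinRoot z Real.pi • cosFun (quasiCoeff A s) z -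
        cosRoot z Real.pi • sinFun (quasiCoeff A s) z)) +
    (-(1 / 2) : ℂ) • ((edgePull (-1) true + edgePull (-1) false) ∘L
      boolMap (fun s => sinFun (quasiCoeff A s) z))

theorem vertexSourceCLM_apply (A : ℤ) (z : ℂ) (f : L2Chain) (j : ℤ) :
    vertexSourceCLM A z f j = vertexSource A z f j := by
  set F := boolMap (fun s => sinRoot z Real.pi • cosFun (quasiCoeff A s) z -
        cosRoot z Real.pi • sinFun (quasiCoeff A s) z) f with hF
  set G := boolMap (fun s => sinFun (quasiCoeff A s) z) f with hG
  have h1 : vertexSourceCLM A z f j =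
      (-(magSign A / 2)) * (edgePull 0 true F j + edgePull 0 false F j) +
      (-(1 / 2) : ℂ) * (edgePull (-1) true G j + edgePull (-1) false G j) := rfl
  rw [h1]
  simp only [edgePull_apply, hF, hG, boolMap_apply, sub_apply,
    smul_apply, smul_eq_mul, add_zero, ← sub_eq_add_neg]
  rw [vertexSource]
  ring

/-- Half the trace of the monodromy matrix of the periodic chain. -/
def discr (α : ℝ) (z : ℂ) : ℂ := cosRoot z Real.pi + α / 4 * sinRoot z Real.pi

/-- The spectral bands of the periodic chain. -/
def band (α : ℝ) : Set ℂ := {z | ∃ r : ℝ, -1 ≤ r ∧ r ≤ 1 ∧ discr α z = r}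

theorem mem_impurity_graph_iff (A : ℤ) (α γ : ℝ) {z : ℂ} (hz : sinRoot z Real.pi ≠ 0)
    (u f : L2Chain) :
    (u, f + z • u) ∈ (impurityHamiltonian A α γ).graph ↔ ∃ a : VertexL2,
      vertexOp (magSign A * (2 * discr α z)) (magSign A * (γ * sinRoot z Real.pi / 2)) a =
        vertexSourceCLM A z f ∧ u = vertexLift A z a + dirichletLift A z f := by
  rw [impurityHamiltonian, hamiltonian_graph, mem_hamiltonianGraph_iff_vertex A _ hz]
  have hcoup : ∀ (a : ℤ → ℂ) (j : ℤ),
      a (j + 1) + a (j - 1) - magSign A * (2 * cosRoot z Real.pi +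
        ((if j = 1 then α + γ else α : ℝ) : ℂ) * sinRoot z Real.pi / 2) * a j =
      a (j + 1) + a (j - 1) - magSign A * (2 * discr α z) * a j -
        if j = 1 then magSign A * (γ * sinRoot z Real.pi / 2) * a j else 0 := by
    intro a j
    rw [discr]
    split_ifs <;> push_cast <;> ring
  constructor
  · rintro ⟨a, hu, ha⟩
    -- The vertex values inherit square summability from `u` and `f`, through a bound uniform over
    -- the upper edges.
    have hmem : Memℓp a 2 := by
      obtain ⟨K, hK0, hK⟩ := exists_norm_le_edgeCLM (quasiCoeff A true) z
      have h1 := ((lp.memℓp (edgePull 0 true u)).norm.add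
        (lp.memℓp (edgePull 0 true f)).norm).const_mul K
      refine (h1.mono fun j => ?_)
      have h2 := hK (a j) (initSlope A z true (a j) (a (j + 1)) (f (j, true))) (f (j, true))
      rw [← hu (j, true)] at h2
      refine h2.trans (le_of_eq ?_)
      simp [edgePull_apply]
    refine ⟨⟨a, hmem⟩, ?_, ?_⟩
    · ext j
      rw [vertexOp_apply, vertexSourceCLM_apply, ← ha j, hcoup]
    · apply lp.ext
      funext e
      rw [vertexLift_add_dirichletLift]
      exact hu e
  · rintro ⟨a, ha, hu⟩
    refine ⟨a, fun e => ?_, fun j => ?_⟩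
    · rw [hu, vertexLift_add_dirichletLift]
    · rw [hcoup, ← vertexOp_apply, ha, vertexSourceCLM_apply]

theorem mem_impurity_graph_iff_ker (A : ℤ) (α γ : ℝ) {z : ℂ} (hz : sinRoot z Real.pi ≠ 0)
    (u : L2Chain) :
    (u, z • u) ∈ (impurityHamiltonian A α γ).graph ↔ ∃ a : VertexL2,
      vertexOp (magSign A * (2 * discr α z)) (magSign A * (γ * sinRoot z Real.pi / 2)) a = 0 ∧
        u = vertexLift A z a := by
  have h := mem_impurity_graph_iff A α γ hz u 0
  simpa using h

theorem vertexLift_eq_zero {A : ℤ} {z : ℂ} {a : VertexL2} (h : vertexLift A z a = 0) : a = 0 := by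
  ext j
  have h1 := vertexLift_add_dirichletLift A z a 0 (j, true)
  rw [h, map_zero, add_zero] at h1
  exact (eq_zero_of_edgeCLM_eq_zero h1.symm).1

/-- When the sine term vanishes, `cosRoot z π = ±1`, so the discriminant is `±1` whatever `α` is. -/
theorem mem_band_of_sinRoot_eq_zero (α : ℝ) {z : ℂ} (hz : sinRoot z Real.pi = 0) : z ∈ band α := by
  have h := cosRoot_sq_add z Real.pi
  rw [hz] at h
  have h1 : cosRoot z Real.pi ^ 2 = 1 := by linear_combination h
  rcases sq_eq_sq_iff_eq_or_eq_neg.1 (h1.trans (one_pow 2).symm) with h2 | h2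
  · exact ⟨1, by norm_num, le_rfl, by simp [discr, h2, hz]⟩
  · exact ⟨-1, le_rfl, by norm_num, by simp [discr, h2, hz]⟩

theorem sinRoot_pi_eq_zero_iff {z : ℂ} :
    sinRoot z Real.pi = 0 ↔ ∃ n : ℕ, 1 ≤ n ∧ z = (n : ℂ) ^ 2 := by
  have hpi : (Real.pi : ℂ) ≠ 0 := by exact_mod_cast Real.pi_ne_zero
  constructor
  · intro h
    have h1 := csqrt_mul_sinRoot z Real.pi
    rw [h, mul_zero] at h1
    obtain ⟨n, hn⟩ := Complex.sin_eq_zero_iff.1 h1.symm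
    have hk : csqrt z = n := mul_right_cancel₀ hpi hn
    -- The value `z = 0` is not a zero: there the sine-type solution is `x` itself.
    have hn0 : n ≠ 0 := by
      rintro rfl
      rw [sinRoot, hk] at h
      simp [csinc_zero] at h
    refine ⟨n.natAbs, by omega, ?_⟩
    rw [← csqrt_sq z, hk]
    have : ((n.natAbs : ℤ) : ℂ) ^ 2 = (n : ℂ) ^ 2 := by
      exact_mod_cast Int.natAbs_sq n
    rw [← this]
    simp
  · rintro ⟨n, hn, rfl⟩
    have h1 := mul_sinRoot_sq (n : ℂ) Real.pi
    rw [Complex.sin_nat_mul_pi] at h1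
    exact (mul_eq_zero.1 h1).resolve_left (by exact_mod_cast (by omega : n ≠ 0))

theorem sinRoot_pi_ne_zero_of_notMem_band {α : ℝ} {z : ℂ} (hz : z ∉ band α) :
    sinRoot z Real.pi ≠ 0 := fun h => hz (mem_band_of_sinRoot_eq_zero α h)

/-! ### Outside of the bands -/

theorem exists_multiplier (A : ℤ) {α : ℝ} {z : ℂ} (hz : z ∉ band α) :
    ∃ l : ℂ, l ≠ 0 ∧ ‖l‖ < 1 ∧ l + l⁻¹ = magSign A * (2 * discr α z) := by
  apply exists_root_norm_lt_one
  intro r h1 h2 h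
  apply hz
  rcases magSign_eq_or A with hA | hA
  · refine ⟨r, h1, h2, ?_⟩
    rw [hA] at h
    linear_combination h / 2
  · refine ⟨-r, by linarith, by linarith, ?_⟩
    rw [hA] at h
    push_cast
    linear_combination -h / 2

/-- A Fredholm alternative: absence of an eigenvalue makes the vertex operator injective, hence
invertible. Its inverse, composed with the lifts from vertex values and right-hand sides, yields the
resolvent. -/
theorem mem_resolventSet_of_notMem_band (A : ℤ) {α γ : ℝ} {z : ℂ} (hz : z ∉ band α)
    (he : ¬ UnboundedOp.IsEigenvalue (impurityHamiltonian A α γ) z) :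
    z ∈ UnboundedOp.resolventSet (impurityHamiltonian A α γ) := by
  have hs := sinRoot_pi_ne_zero_of_notMem_band hz
  obtain ⟨l, h0, h1, hl⟩ := exists_multiplier A hz
  have hunit : IsUnit (vertexOp (magSign A * (2 * discr α z))
      (magSign A * (γ * sinRoot z Real.pi / 2))) := by
    rw [← hl]
    apply isUnit_vertexOp h0 h1
    rw [hl]
    intro a ha
    by_contra hne
    apply he
    rw [UnboundedOp.isEigenvalue_iff]
    refine ⟨vertexLift A z a, fun h => hne (vertexLift_eq_zero h), ?_⟩
    exact (mem_impurity_graph_iff_ker A α γ hs _).2 ⟨a, ha, rfl⟩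
  obtain ⟨K, hK⟩ := hunit
  have k1 : ∀ a, (K : VertexL2 →L[ℂ] VertexL2) ((K⁻¹ : (VertexL2 →L[ℂ] VertexL2)ˣ).1 a) = a :=
    fun a => by rw [← mul_apply_eq_comp, Units.mul_inv, one_apply_eq_self]
  have k2 : ∀ a, (K⁻¹ : (VertexL2 →L[ℂ] VertexL2)ˣ).1 ((K : VertexL2 →L[ℂ] VertexL2) a) = a :=
    fun a => by rw [← mul_apply_eq_comp, Units.inv_mul, one_apply_eq_self]
  refine UnboundedOp.mem_resolventSet_of_graph
    (vertexLift A z ∘L (K⁻¹ : (VertexL2 →L[ℂ] VertexL2)ˣ).1 ∘L vertexSourceCLM A z +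
      dirichletLift A z) (fun f => ?_) (fun u f h => ?_)
  · rw [mem_impurity_graph_iff A α γ hs]
    exact ⟨(K⁻¹ : (VertexL2 →L[ℂ] VertexL2)ˣ).1 (vertexSourceCLM A z f),
      by rw [← hK, k1], rfl⟩
  · obtain ⟨a, ha, rfl⟩ := (mem_impurity_graph_iff A α γ hs u f).1 h
    change vertexLift A z ((K⁻¹ : (VertexL2 →L[ℂ] VertexL2)ˣ).1 (vertexSourceCLM A z f)) +
      dirichletLift A z f = _
    rw [← ha, ← hK, k2]

theorem isEigenvalue_iff_of_notMem_band (A : ℤ) {α γ : ℝ} {z : ℂ} (hz : z ∉ band α) :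
    UnboundedOp.IsEigenvalue (impurityHamiltonian A α γ) z ↔
      ∃ l : ℂ, l ≠ 0 ∧ ‖l‖ < 1 ∧ l + l⁻¹ = magSign A * (2 * discr α z) ∧
        l - l⁻¹ = magSign A * (γ * sinRoot z Real.pi / 2) := by
  have hs := sinRoot_pi_ne_zero_of_notMem_band hz
  rw [UnboundedOp.isEigenvalue_iff]
  constructor
  · rintro ⟨u, hu, h⟩
    obtain ⟨a, ha, rfl⟩ := (mem_impurity_graph_iff_ker A α γ hs u).1 h
    obtain ⟨l, h0, h1, hl⟩ := exists_multiplier A hz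
    rw [← hl] at ha
    refine ⟨l, h0, h1, hl, sub_inv_eq_of_vertexOp_eq_zero h0 h1 ha ?_⟩
    rintro rfl
    exact hu (map_zero _)
  · rintro ⟨l, h0, h1, hl, hd⟩
    obtain ⟨a, hne, ha⟩ := exists_vertexOp_eq_zero h0 h1 hd
    rw [hl] at ha
    exact ⟨vertexLift A z a, fun h => hne (vertexLift_eq_zero h),
      (mem_impurity_graph_iff_ker A α γ hs _).2 ⟨a, ha, rfl⟩⟩

theorem isSimpleEigenvalue_of_notMem_band (A : ℤ) {α γ : ℝ} {z : ℂ} (hz : z ∉ band α)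
    (he : UnboundedOp.IsEigenvalue (impurityHamiltonian A α γ) z) :
    UnboundedOp.IsSimpleEigenvalue (impurityHamiltonian A α γ) z := by
  refine ⟨he, ?_⟩
  have hs := sinRoot_pi_ne_zero_of_notMem_band hz
  obtain ⟨l, h0, h1, hl⟩ := exists_multiplier A hz
  obtain ⟨u, hu, h⟩ := UnboundedOp.isEigenvalue_iff.1 he
  rw [finrank_eq_one_iff']
  refine ⟨⟨u, h⟩, fun h0 => hu (congrArg Subtype.val h0), fun ⟨w, hw⟩ => ?_⟩
  obtain ⟨a, ha, rfl⟩ := (mem_impurity_graph_iff_ker A α γ hs u).1 h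
  obtain ⟨b, hb, rfl⟩ := (mem_impurity_graph_iff_ker A α γ hs w).1 hw
  rw [← hl] at ha hb
  have pa := eq_pow_of_vertexOp_eq_zero h0 h1 ha
  have pb := eq_pow_of_vertexOp_eq_zero h0 h1 hb
  have ha1 : a 1 ≠ 0 := by
    intro h
    apply hu
    have : a = 0 := by
      ext j
      rw [pa j, h, mul_zero]
      rfl
    rw [this, map_zero]
  refine ⟨b 1 / a 1, Subtype.ext ?_⟩
  change (b 1 / a 1) • vertexLift A z a = vertexLift A z b
  rw [← map_smul]
  congr 1
  ext j
  rw [lp.coeFn_smul, Pi.smul_apply, smul_eq_mul, pa j, pb j]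
  field_simp

/-! ### Inside of the bands -/

/-- The recursion is not required at `1` and `2`, which leaves room for the impurity and for a
source on ring `1`. The half-lines `j ≤ 1` and `j ≥ 2` are treated separately and together cover all
vertices. -/
theorem eq_zero_of_band {r : ℝ} (h1 : -1 ≤ r) (h2 : r ≤ 1) {a : VertexL2}
    (ha : ∀ j, j ≤ 0 ∨ 3 ≤ j → a (j + 1) + a (j - 1) = 2 * r * a j) : a = 0 := by
  have hr : ∀ n : ℕ, a (2 + n) = 0 := by
    refine eq_zero_of_tendsto_zero h1 h2 (x := fun n : ℕ => a (2 + n)) (fun n => ?_)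
      (tendsto_vertexL2 a (τ := fun n : ℕ => 2 + (n : ℤ)) fun n m h => by simpa using h)
    have h := ha (2 + (n + 1 : ℕ)) (Or.inr (by push_cast; omega))
    rw [show (2 : ℤ) + (n + 1 : ℕ) + 1 = 2 + (n + 2 : ℕ) by push_cast; ring,
      show (2 : ℤ) + (n + 1 : ℕ) - 1 = 2 + n by push_cast; ring] at h
    linear_combination h
  have hl : ∀ n : ℕ, a (1 - n) = 0 := by
    refine eq_zero_of_tendsto_zero h1 h2 (x := fun n : ℕ => a (1 - n)) (fun n => ?_)
      (tendsto_vertexL2 a (τ := fun n : ℕ => 1 - (n : ℤ)) fun n m h => by simpa using h)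
    have h := ha (1 - (n + 1 : ℕ)) (Or.inl (by push_cast; omega))
    rw [show (1 : ℤ) - (n + 1 : ℕ) + 1 = 1 - n by push_cast; ring,
      show (1 : ℤ) - (n + 1 : ℕ) - 1 = 1 - (n + 2 : ℕ) by push_cast; ring] at h
    linear_combination h
  ext j
  rcases le_or_gt j 1 with h | h
  · have e := hl (1 - j).natAbs
    rwa [show (1 : ℤ) - (1 - j).natAbs = j by omega] at e
  · have e := hr (j - 2).natAbs
    rwa [show (2 : ℤ) + (j - 2).natAbs = j by omega] at e

theorem exists_band_parameter (A : ℤ) {α : ℝ} {z : ℂ} (hz : z ∈ band α) :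
    ∃ r : ℝ, -1 ≤ r ∧ r ≤ 1 ∧ magSign A * (2 * discr α z) = 2 * r := by
  obtain ⟨r, h1, h2, h⟩ := hz
  rcases magSign_eq_or A with hA | hA
  · exact ⟨r, h1, h2, by rw [hA, h]; ring⟩
  · exact ⟨-r, by linarith, by linarith, by rw [hA, h]; push_cast; ring⟩

theorem not_isEigenvalue_of_mem_band (A : ℤ) {α γ : ℝ} {z : ℂ} (hz : z ∈ band α)
    (hs : sinRoot z Real.pi ≠ 0) :
    ¬ UnboundedOp.IsEigenvalue (impurityHamiltonian A α γ) z := by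
  rw [UnboundedOp.isEigenvalue_iff]
  rintro ⟨u, hu, h⟩
  obtain ⟨a, ha, rfl⟩ := (mem_impurity_graph_iff_ker A α γ hs u).1 h
  obtain ⟨r, h1, h2, hr⟩ := exists_band_parameter A hz
  apply hu
  rw [eq_zero_of_band h1 h2 (a := a), map_zero]
  intro j hj
  have e := vertexOp_eq_zero_iff.1 ha j
  rw [hr, if_neg (by omega)] at e
  linear_combination e

/-- Tested on the conjugate of its own weight, the functional gives the integral of a square that is
nonzero at `π`. -/
theorem exists_sinFun_ne_zero (c : ℂ) {z : ℂ} (hs : sinRoot z Real.pi ≠ 0) :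
    ∃ g : EdgeL2, sinFun c z g ≠ 0 := by
  have hc := continuous_sinWeight c z
  have hm : MemLp (fun x => (starRingEnd ℂ) (sinWeight c z x)) 2 edgeMeasure := by
    obtain ⟨B, hB⟩ := (isCompact_Icc (a := (0 : ℝ)) (b := Real.pi)).exists_bound_of_continuousOn
      hc.continuousOn
    refine MemLp.of_bound (Complex.continuous_conj.comp hc).aestronglyMeasurable B ?_
    filter_upwards [ae_restrict_mem measurableSet_Icc] with x hx
    simpa using hB x hx
  refine ⟨hm.toLp, ?_⟩
  have h1 : sinFun c z hm.toLp = ∫ t in (0 : ℝ)..Real.pi, ((‖sinWeight c z t‖ ^ 2 : ℝ) : ℂ) := by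
    change ∫ t in (0 : ℝ)..Real.pi, sinWeight c z t * (hm.toLp : EdgeL2) t = _
    apply intervalIntegral.integral_congr_ae_restrict
    rw [Set.uIoc_of_le Real.pi_pos.le]
    filter_upwards [ae_restrict_of_ae_restrict_of_subset Set.Ioc_subset_Icc_self
      hm.coeFn_toLp] with t ht
    rw [ht, Complex.mul_conj, Complex.normSq_eq_norm_sq]
  rw [h1, intervalIntegral.integral_ofReal]
  have hpos : 0 < ∫ t in (0 : ℝ)..Real.pi, ‖sinWeight c z t‖ ^ 2 := by
    refine intervalIntegral.integral_pos Real.pi_pos (hc.norm.pow 2).continuousOn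
      (fun x _ => sq_nonneg _) ⟨Real.pi, pi_mem_Icc, ?_⟩
    have : sinWeight c z Real.pi ≠ 0 := mul_ne_zero (Complex.exp_ne_zero _) hs
    positivity
  exact_mod_cast hpos.ne'

/-- A right-hand side on the upper edge of ring `1` enters only the vertex equations at `1` and `2`.
The remaining equations already force `a = 0`, and the equation at `2` then fails; so `T - z` is not
surjective. -/
theorem mem_spectrum_of_mem_band (A : ℤ) {α γ : ℝ} {z : ℂ} (hz : z ∈ band α)
    (hs : sinRoot z Real.pi ≠ 0) :
    z ∈ UnboundedOp.spectrum (impurityHamiltonian A α γ) := by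
  intro hres
  obtain ⟨g, hg⟩ := exists_sinFun_ne_zero (quasiCoeff A true) hs
  set f : L2Chain := lp.single 2 ((1, true) : Edge) g with hf
  have hf0 : ∀ e : Edge, e ≠ (1, true) → f e = 0 := by
    intro e he
    rw [hf, lp.single_apply_ne _ _ _ he]
  have hf1 : f (1, true) = g := by
    rw [hf, lp.single_apply_self]
  obtain ⟨u, hu⟩ := UnboundedOp.exists_graph_of_mem_resolventSet hres f
  obtain ⟨a, ha, -⟩ := (mem_impurity_graph_iff A α γ hs u f).1 hu
  obtain ⟨r, h1, h2, hr⟩ := exists_band_parameter A hz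
  have ha0 : a = 0 := by
    refine eq_zero_of_band h1 h2 fun j hj => ?_
    have e := congrArg (fun b : VertexL2 => b j) ha
    simp only [vertexOp_apply, vertexSourceCLM_apply, vertexSource] at e
    rw [hr, if_neg (by omega), hf0 (j, true) (by simp; omega), hf0 (j, false) (by simp),
      hf0 (j - 1, true) (by simp; omega), hf0 (j - 1, false) (by simp)] at e
    simp only [map_zero] at e
    linear_combination e
  have e := congrArg (fun b : VertexL2 => b 2) ha
  simp only [ha0, map_zero, vertexSourceCLM_apply, vertexSource] at e
  rw [hf0 (2, true) (by simp), hf0 (2, false) (by simp), hf0 (2 - 1, false) (by simp),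
    show ((2 : ℤ) - 1, true) = ((1 : ℤ), true) by norm_num, hf1] at e
  simp at e
  exact hg e

/-- The state supported on ring `j` that is antisymmetric under exchange of its edges. -/
def ringState (A : ℤ) (z : ℂ) (j : ℤ) : L2Chain :=
  lp.single 2 ((j, true) : Edge) (edgeCLM (quasiCoeff A true) z (0, 1, 0)) +
    lp.single 2 ((j, false) : Edge) (edgeCLM (quasiCoeff A false) z (0, -1, 0))

theorem ringState_apply (A : ℤ) (z : ℂ) (j : ℤ) (e : Edge) :
    ringState A z j e = edgeCLM (quasiCoeff A e.2) z
      (0, if e.1 = j then (if e.2 then 1 else -1) else 0, 0) := by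
  have h0 : ∀ s, edgeCLM (quasiCoeff A s) z (0, 0, 0) = 0 := fun s => map_zero _
  rw [ringState, lp.coeFn_add, Pi.add_apply, lp.single_apply, lp.single_apply]
  rcases e with ⟨i, s⟩
  by_cases hi : i = j
  · subst hi
    cases s <;> simp
  · cases s <;> simp [hi, h0]

/-- The state vanishes at all vertices, so the coupling constants play no role. Its opposite slopes
on the two semicircles cancel at either end because the gauge signs agree. -/
theorem ringState_mem_eigenspace (A : ℤ) (α γ : ℝ) {z : ℂ} (hs : sinRoot z Real.pi = 0) (j : ℤ) :
    ringState A z j ∈ UnboundedOp.eigenspace (impurityHamiltonian A α γ) z := by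
  change (ringState A z j, z • ringState A z j) ∈ (impurityHamiltonian A α γ).graph
  have h := mem_hamiltonianGraph_iff A (fun j => if j = 1 then α + γ else α) z (ringState A z j) 0
  rw [zero_add] at h
  rw [impurityHamiltonian, hamiltonian_graph, h]
  refine ⟨fun _ => 0, fun e => if e.1 = j then (if e.2 then 1 else -1) else 0,
    ringState_apply A z j, fun _ => rfl, fun i s => ?_, fun i => ?_⟩
  · change edgeSol _ _ _ _ ((0 : EdgeL2) : ℝ → ℂ) _ = _
    rw [edgeSol_pi, hs, map_zero]
    simp
  · change _ - edgeDer _ _ _ _ ((0 : EdgeL2) : ℝ → ℂ) _ -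
      edgeDer _ _ _ _ ((0 : EdgeL2) : ℝ → ℂ) _ = _
    rw [edgeDer_pi, edgeDer_pi, gauge_quasiCoeff, gauge_quasiCoeff, hs]
    simp only [map_zero]
    by_cases h1 : i = j <;> by_cases h2 : i - 1 = j <;> simp [h1, h2]

theorem linearIndependent_ringState (A : ℤ) (z : ℂ) : LinearIndependent ℂ (ringState A z) := by
  rw [linearIndependent_iff']
  intro t g h i hi
  have h1 := congrArg (lp.evalₗ (𝕜 := ℂ) (E := fun _ : Edge => EdgeL2) (p := 2) (i, true)) h
  rw [map_sum, map_zero] at h1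
  simp only [map_smul, lp.evalₗ_apply, ringState_apply] at h1
  rw [Finset.sum_eq_single i] at h1
  · by_contra hg
    have h2 := (smul_eq_zero.1 h1).resolve_left hg
    have := (eq_zero_of_edgeCLM_eq_zero h2).2
    simp at this
  · intro k _ hk
    rw [if_neg hk.symm]
    have h0 : edgeCLM (quasiCoeff A true) z (0, 0, 0) = 0 := map_zero _
    simp [h0]
  · exact fun h => absurd hi h

theorem not_finiteDimensional_eigenspace (A : ℤ) (α γ : ℝ) {z : ℂ} (hs : sinRoot z Real.pi = 0) :
    ¬ FiniteDimensional ℂ (UnboundedOp.eigenspace (impurityHamiltonian A α γ) z) := by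
  intro hfin
  have h : LinearIndependent ℂ (fun j => (⟨ringState A z j,
      ringState_mem_eigenspace A α γ hs j⟩ :
        UnboundedOp.eigenspace (impurityHamiltonian A α γ) z)) :=
    LinearIndependent.of_comp (Submodule.subtype _) (linearIndependent_ringState A z)
  have := h.finite
  exact not_finite ℤ

theorem mem_essSpectrum_of_mem_band (A : ℤ) {α : ℝ} (γ : ℝ) {z : ℂ} (hz : z ∈ band α) :
    z ∈ UnboundedOp.essSpectrum (impurityHamiltonian A α γ) := by
  by_cases hs : sinRoot z Real.pi = 0
  · refine ⟨UnboundedOp.IsEigenvalue.mem_spectrum ?_,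
      fun h => not_finiteDimensional_eigenspace A α γ hs h.2.1⟩
    rw [UnboundedOp.isEigenvalue_iff]
    exact ⟨ringState A z 0, (linearIndependent_ringState A z).ne_zero 0,
      ringState_mem_eigenspace A α γ hs 0⟩
  · exact ⟨mem_spectrum_of_mem_band A hz hs, fun h => not_isEigenvalue_of_mem_band A hz hs h.1⟩

end RingChain
end

noncomputable section
namespace RingChain

/-! ### Factorization of the discriminant -/

/-- Lagrange's identity. With `w = conj z` it gives the sign of the imaginary part of `tanFac`; with
two real parameters it gives the difference quotient of `lowFac`. -/
theorem wronskian_cosRoot (z w : ℂ) (x : ℝ) :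
    w * sinRoot w x * cosRoot z x - z * sinRoot z x * cosRoot w x =
      (w - z) * ∫ t in (0 : ℝ)..x, cosRoot w t * cosRoot z t := by
  have hd : ∀ t : ℝ, HasDerivAt
      (fun t => w * sinRoot w t * cosRoot z t - z * sinRoot z t * cosRoot w t)
      ((w - z) * (cosRoot w t * cosRoot z t)) t := by
    intro t
    refine ((((hasDerivAt_sinRoot w t).const_mul w).mul (hasDerivAt_cosRoot z t)).sub
      (((hasDerivAt_sinRoot z t).const_mul z).mul (hasDerivAt_cosRoot w t))).congr_deriv ?_
    ring
  have hc : Continuous fun t => (w - z) * (cosRoot w t * cosRoot z t) :=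
    ((continuous_cosRoot w).mul (continuous_cosRoot z)).const_mul _
  have h := intervalIntegral.integral_eq_sub_of_hasDerivAt (fun t _ => hd t)
    (hc.intervalIntegrable 0 x)
  rw [intervalIntegral.integral_const_mul] at h
  rw [h]
  simp

theorem wronskian_sinRoot (z w : ℂ) (x : ℝ) :
    cosRoot w x * sinRoot z x - cosRoot z x * sinRoot w x =
      (z - w) * ∫ t in (0 : ℝ)..x, sinRoot w t * sinRoot z t := by
  have hd : ∀ t : ℝ, HasDerivAt
      (fun t => cosRoot w t * sinRoot z t - cosRoot z t * sinRoot w t)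
      ((z - w) * (sinRoot w t * sinRoot z t)) t := by
    intro t
    refine (((hasDerivAt_cosRoot w t).mul (hasDerivAt_sinRoot z t)).sub
      ((hasDerivAt_cosRoot z t).mul (hasDerivAt_sinRoot w t))).congr_deriv ?_
    ring
  have hc : Continuous fun t => (z - w) * (sinRoot w t * sinRoot z t) :=
    ((continuous_sinRoot w).mul (continuous_sinRoot z)).const_mul _
  have h := intervalIntegral.integral_eq_sub_of_hasDerivAt (fun t _ => hd t)
    (hc.intervalIntegrable 0 x)
  rw [intervalIntegral.integral_const_mul] at h
  rw [h]
  simp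

/-- `√z tan (√z π / 2)`. -/
def tanFac (z : ℂ) : ℂ := z * sinRoot z (Real.pi / 2) / cosRoot z (Real.pi / 2)

/-- `√z cot (√z π / 2)`. -/
def cotFac (z : ℂ) : ℂ := cosRoot z (Real.pi / 2) / sinRoot z (Real.pi / 2)

theorem half_ne_zero {z : ℂ} (hs : sinRoot z Real.pi ≠ 0) :
    sinRoot z (Real.pi / 2) ≠ 0 ∧ cosRoot z (Real.pi / 2) ≠ 0 := by
  rw [sinRoot_pi] at hs
  exact ⟨fun h => hs (by simp [h]), fun h => hs (by simp [h])⟩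

theorem discr_sub_one (α : ℝ) {z : ℂ} (hs : sinRoot z Real.pi ≠ 0) :
    discr α z - 1 = (α / 4 - tanFac z) * sinRoot z Real.pi := by
  have h := (half_ne_zero hs).2
  rw [discr, tanFac, cosRoot_pi, sinRoot_pi]
  field_simp
  linear_combination 4 * cosRoot_sq_add z (Real.pi / 2)

theorem discr_add_one (α : ℝ) {z : ℂ} (hs : sinRoot z Real.pi ≠ 0) :
    discr α z + 1 = (α / 4 + cotFac z) * sinRoot z Real.pi := by
  have h := (half_ne_zero hs).1
  rw [discr, cotFac, cosRoot_pi, sinRoot_pi]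
  field_simp
  linear_combination -4 * cosRoot_sq_add z (Real.pi / 2)

/-- The secular equation for eigenvalues outside of the bands. -/
theorem secular_of_multiplier {A : ℤ} {α γ : ℝ} {z l : ℂ} (hs : sinRoot z Real.pi ≠ 0)
    (h0 : l ≠ 0) (h1 : l + l⁻¹ = magSign A * (2 * discr α z))
    (h2 : l - l⁻¹ = magSign A * (γ * sinRoot z Real.pi / 2)) :
    (α / 4 - tanFac z) * (α / 4 + cotFac z) = (γ : ℂ) ^ 2 / 16 := by
  have hl : l * l⁻¹ = 1 := mul_inv_cancel₀ h0
  have hε := magSign_mul_self A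
  have e1 := discr_sub_one α hs
  have e2 := discr_add_one α hs
  have h3 : (l + l⁻¹) ^ 2 - (l - l⁻¹) ^ 2 = 4 := by linear_combination 4 * hl
  rw [h1, h2] at h3
  have h4 : discr α z ^ 2 - 1 = (γ : ℂ) ^ 2 / 16 * sinRoot z Real.pi ^ 2 := by
    linear_combination h3 / 4 - (discr α z ^ 2 - (γ * sinRoot z Real.pi) ^ 2 / 16) * hε
  apply mul_right_cancel₀ (pow_ne_zero 2 hs)
  rw [← h4]
  linear_combination -(discr α z + 1) * e1 - (α / 4 - tanFac z) * sinRoot z Real.pi * e2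

/-! ### Nonreal spectral parameters -/

/-- Herglotz property: Lagrange's identity for `z` and `conj z` expresses the imaginary part through
the integral of `‖cosRoot z t‖ ^ 2`. -/
theorem im_tanFac {z : ℂ} (hs : sinRoot z Real.pi ≠ 0) :
    ∃ p : ℝ, 0 < p ∧ (tanFac z).im = z.im * p := by
  have hC := (half_ne_zero hs).2
  have hw := wronskian_cosRoot z ((starRingEnd ℂ) z) (Real.pi / 2)
  set I : ℝ := ∫ t in (0 : ℝ)..(Real.pi / 2), ‖cosRoot z t‖ ^ 2 with hI
  have hIpos : 0 < I := by
    refine intervalIntegral.integral_pos (by positivity)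
      ((continuous_cosRoot z).norm.pow 2).continuousOn (fun x _ => sq_nonneg _)
      ⟨0, ⟨le_rfl, by positivity⟩, ?_⟩
    simp
  have hint : ∫ t in (0 : ℝ)..(Real.pi / 2),
      cosRoot ((starRingEnd ℂ) z) t * cosRoot z t = (I : ℂ) := by
    rw [hI, ← intervalIntegral.integral_ofReal]
    congr 1
    funext t
    rw [cosRoot_conj, mul_comm, Complex.mul_conj, Complex.normSq_eq_norm_sq]
  rw [hint, cosRoot_conj, sinRoot_conj] at hw
  refine ⟨I / Complex.normSq (cosRoot z (Real.pi / 2)),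
    div_pos hIpos (Complex.normSq_pos.2 hC), ?_⟩
  have e : (starRingEnd ℂ) (tanFac z) - tanFac z =
      ((starRingEnd ℂ) z - z) * ((I / Complex.normSq (cosRoot z (Real.pi / 2)) : ℝ) : ℂ) := by
    have hC' : (starRingEnd ℂ) (cosRoot z (Real.pi / 2)) ≠ 0 := by simpa using hC
    push_cast
    rw [← Complex.mul_conj, tanFac, map_div₀, map_mul]
    field_simp
    linear_combination hw
  have e2 := congrArg Complex.im e
  rw [Complex.im_mul_ofReal] at e2
  simp only [Complex.sub_im, Complex.conj_im] at e2
  linarith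

theorem im_cotFac {z : ℂ} (hs : sinRoot z Real.pi ≠ 0) :
    ∃ q : ℝ, 0 < q ∧ (cotFac z).im = -(z.im * q) := by
  have hS := (half_ne_zero hs).1
  have hw := wronskian_sinRoot z ((starRingEnd ℂ) z) (Real.pi / 2)
  set I : ℝ := ∫ t in (0 : ℝ)..(Real.pi / 2), ‖sinRoot z t‖ ^ 2 with hI
  have hIpos : 0 < I := by
    refine intervalIntegral.integral_pos (by positivity)
      ((continuous_sinRoot z).norm.pow 2).continuousOn (fun x _ => sq_nonneg _)
      ⟨Real.pi / 2, ⟨by positivity, le_rfl⟩, ?_⟩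
    positivity
  have hint : ∫ t in (0 : ℝ)..(Real.pi / 2),
      sinRoot ((starRingEnd ℂ) z) t * sinRoot z t = (I : ℂ) := by
    rw [hI, ← intervalIntegral.integral_ofReal]
    congr 1
    funext t
    rw [sinRoot_conj, mul_comm, Complex.mul_conj, Complex.normSq_eq_norm_sq]
  rw [hint, cosRoot_conj, sinRoot_conj] at hw
  refine ⟨I / Complex.normSq (sinRoot z (Real.pi / 2)),
    div_pos hIpos (Complex.normSq_pos.2 hS), ?_⟩
  have e : (starRingEnd ℂ) (cotFac z) - cotFac z =
      (z - (starRingEnd ℂ) z) * ((I / Complex.normSq (sinRoot z (Real.pi / 2)) : ℝ) : ℂ) := by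
    have hS' : (starRingEnd ℂ) (sinRoot z (Real.pi / 2)) ≠ 0 := by simpa using hS
    push_cast
    rw [← Complex.mul_conj, cotFac, map_div₀]
    field_simp
    linear_combination hw
  have e2 := congrArg Complex.im e
  rw [Complex.im_mul_ofReal] at e2
  simp only [Complex.sub_im, Complex.conj_im] at e2
  linarith

theorem sinRoot_pi_ne_zero_of_im {z : ℂ} (hz : z.im ≠ 0) : sinRoot z Real.pi ≠ 0 := by
  rw [Ne, sinRoot_pi_eq_zero_iff]
  rintro ⟨n, -, rfl⟩
  apply hz
  norm_cast

theorem notMem_band_of_im (α : ℝ) {z : ℂ} (hz : z.im ≠ 0) : z ∉ band α := by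
  rintro ⟨r, h1, h2, hr⟩
  have hs := sinRoot_pi_ne_zero_of_im hz
  obtain ⟨p, hp, ep⟩ := im_tanFac hs
  obtain ⟨q, hq, eq⟩ := im_cotFac hs
  have e1 := discr_sub_one α hs
  have e2 := discr_add_one α hs
  rw [hr] at e1 e2
  -- Elimination of the sine from both factorizations. The imaginary parts then give `(r + 1) p + (1
  -- - r) q = 0` with `p, q > 0`, impossible for `|r| ≤ 1`.
  have e3 : ((r + 1 : ℝ) : ℂ) * (α / 4 - tanFac z) = ((r - 1 : ℝ) : ℂ) * (α / 4 + cotFac z) := by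
    apply mul_right_cancel₀ hs
    push_cast
    linear_combination ((r : ℂ) - 1) * e2 - ((r : ℂ) + 1) * e1
  have e4 := congrArg Complex.im e3
  rw [Complex.im_ofReal_mul, Complex.im_ofReal_mul] at e4
  have e5 : ((α : ℂ) / 4).im = 0 := by
    rw [show (α : ℂ) / 4 = ((α / 4 : ℝ) : ℂ) by push_cast; ring]
    exact Complex.ofReal_im _
  rw [Complex.sub_im, Complex.add_im, ep, eq, e5] at e4
  have e6 : z.im * ((r + 1) * p + (1 - r) * q) = 0 := by linarith
  have e7 := (mul_eq_zero.1 e6).resolve_left hz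
  have p1 := mul_nonneg (by linarith : 0 ≤ r + 1) hp.le
  have p2 := mul_nonneg (by linarith : 0 ≤ 1 - r) hq.le
  have z1 : (r + 1) * p = 0 := by linarith
  have z2 : (1 - r) * q = 0 := by linarith
  have r1 := (mul_eq_zero.1 z1).resolve_right hp.ne'
  have r2 := (mul_eq_zero.1 z2).resolve_right hq.ne'
  linarith

theorem not_isEigenvalue_of_im (A : ℤ) (α γ : ℝ) {z : ℂ} (hz : z.im ≠ 0) :
    ¬ UnboundedOp.IsEigenvalue (impurityHamiltonian A α γ) z := by
  rw [isEigenvalue_iff_of_notMem_band A (notMem_band_of_im α hz)]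
  rintro ⟨l, h0, -, h1, h2⟩
  have hs := sinRoot_pi_ne_zero_of_im hz
  have hsec := secular_of_multiplier hs h0 h1 h2
  obtain ⟨p, hp, ep⟩ := im_tanFac hs
  obtain ⟨q, hq, eq⟩ := im_cotFac hs
  set Q := (α : ℂ) / 4 + cotFac z with hQ
  have e5 : ((α : ℂ) / 4).im = 0 := by
    rw [show (α : ℂ) / 4 = ((α / 4 : ℝ) : ℂ) by push_cast; ring]
    exact Complex.ofReal_im _
  have hQim : Q.im = -(z.im * q) := by rw [hQ, Complex.add_im, e5, eq, zero_add]
  have hQ0 : Q ≠ 0 := by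
    intro h
    rw [h, Complex.zero_im] at hQim
    exact mul_ne_zero hz hq.ne' (by linarith)
  -- The secular equation times the conjugate of `Q`. The imaginary part on the left has the sign
  -- opposite to `z.im`, while the one on the right is a nonnegative multiple of `z.im`.
  have e : ((α : ℂ) / 4 - tanFac z) * ((Complex.normSq Q : ℝ) : ℂ) =
      ((γ ^ 2 / 16 : ℝ) : ℂ) * (starRingEnd ℂ) Q := by
    rw [← Complex.mul_conj]
    push_cast
    linear_combination (starRingEnd ℂ) Q * hsec
  have e4 := congrArg Complex.im e
  rw [Complex.im_mul_ofReal, Complex.im_ofReal_mul, Complex.conj_im, hQim, Complex.sub_im, e5,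
    ep] at e4
  have e6 : z.im * (p * Complex.normSq Q + γ ^ 2 / 16 * q) = 0 := by linarith
  have e7 := (mul_eq_zero.1 e6).resolve_left hz
  have p1 := mul_pos hp (Complex.normSq_pos.2 hQ0)
  have p2 : 0 ≤ γ ^ 2 / 16 * q := by positivity
  linarith

/-! ### Real spectral parameters -/

/-- `α / 4 - √x tan (√x π / 2)` for real `x`. -/
def lowFac (α x : ℝ) : ℝ := α / 4 - x * sinR x (Real.pi / 2) / cosR x (Real.pi / 2)

/-- `α / 4 + √x cot (√x π / 2)` for real `x`. -/
def upFac (α x : ℝ) : ℝ := α / 4 + cosR x (Real.pi / 2) / sinR x (Real.pi / 2)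

theorem ofReal_lowFac (α x : ℝ) : (lowFac α x : ℂ) = α / 4 - tanFac x := by
  rw [lowFac, tanFac]
  push_cast
  rw [ofReal_cosR, ofReal_sinR]

theorem ofReal_upFac (α x : ℝ) : (upFac α x : ℂ) = α / 4 + cotFac x := by
  rw [upFac, cotFac]
  push_cast
  rw [ofReal_cosR, ofReal_sinR]

/-- The discriminant for real `x`. -/
def discrR (α x : ℝ) : ℝ := cosR x Real.pi + α / 4 * sinR x Real.pi

theorem ofReal_discrR (α x : ℝ) : (discrR α x : ℂ) = discr α x := by
  rw [discrR, discr]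
  push_cast
  rw [ofReal_cosR, ofReal_sinR]

theorem sinRoot_ofReal_ne_zero {x : ℝ} : sinRoot x Real.pi ≠ 0 ↔ sinR x Real.pi ≠ 0 := by
  rw [← ofReal_sinR]
  norm_cast

theorem half_ne_zero_real {x : ℝ} (hs : sinR x Real.pi ≠ 0) :
    sinR x (Real.pi / 2) ≠ 0 ∧ cosR x (Real.pi / 2) ≠ 0 := by
  have h := half_ne_zero (sinRoot_ofReal_ne_zero.2 hs)
  rw [← ofReal_sinR, ← ofReal_cosR] at h
  exact_mod_cast h

theorem discrR_sub_one (α : ℝ) {x : ℝ} (hs : sinR x Real.pi ≠ 0) :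
    discrR α x - 1 = lowFac α x * sinR x Real.pi := by
  have h := discr_sub_one α (sinRoot_ofReal_ne_zero.2 hs)
  rw [← ofReal_discrR, ← ofReal_lowFac, ← ofReal_sinR] at h
  exact_mod_cast h

theorem discrR_add_one (α : ℝ) {x : ℝ} (hs : sinR x Real.pi ≠ 0) :
    discrR α x + 1 = upFac α x * sinR x Real.pi := by
  have h := discr_add_one α (sinRoot_ofReal_ne_zero.2 hs)
  rw [← ofReal_discrR, ← ofReal_upFac, ← ofReal_sinR] at h
  exact_mod_cast h

/-- The two factorizations multiply to `D² - 1 = PQs²`. -/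
theorem notMem_band_iff {α x : ℝ} :
    (x : ℂ) ∉ band α ↔ sinR x Real.pi ≠ 0 ∧ 0 < lowFac α x * upFac α x := by
  by_cases hs : sinR x Real.pi = 0
  · have h : (x : ℂ) ∈ band α := by
      apply mem_band_of_sinRoot_eq_zero
      rw [← ofReal_sinR, hs, Complex.ofReal_zero]
    simp [h, hs]
  · have e1 := discrR_sub_one α hs
    have e2 := discrR_add_one α hs
    have e3 : discrR α x ^ 2 - 1 = lowFac α x * upFac α x * sinR x Real.pi ^ 2 := by
      linear_combination (discrR α x + 1) * e1 + lowFac α x * sinR x Real.pi * e2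
    have hs2 : 0 < sinR x Real.pi ^ 2 := by positivity
    have hb : (x : ℂ) ∈ band α ↔ discrR α x ^ 2 ≤ 1 := by
      rw [sq_le_one_iff_abs_le_one, abs_le]
      constructor
      · rintro ⟨r, h1, h2, h⟩
        rw [← ofReal_discrR] at h
        rw [Complex.ofReal_inj.1 h]
        exact ⟨h1, h2⟩
      · exact fun h => ⟨discrR α x, h.1, h.2, (ofReal_discrR α x).symm⟩
    rw [hb, not_le]
    constructor
    · intro h
      refine ⟨hs, ?_⟩
      by_contra hn
      nlinarith [mul_nonneg (not_lt.1 hn |> neg_nonneg.2) hs2.le]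
    · rintro ⟨-, h⟩
      nlinarith [mul_pos h hs2]

theorem add_fac (α : ℝ) {x : ℝ} (hs : sinR x Real.pi ≠ 0) :
    lowFac α x + upFac α x = α / 2 + 2 * (cosR x Real.pi / sinR x Real.pi) := by
  have e1 := discrR_sub_one α hs
  have e2 := discrR_add_one α hs
  rw [discrR] at e1 e2
  field_simp
  linear_combination -2 * e1 - 2 * e2

theorem upFac_sub_lowFac (α : ℝ) {x : ℝ} (hs : sinR x Real.pi ≠ 0) :
    (upFac α x - lowFac α x) * sinR x Real.pi = 2 := by
  linear_combination discrR_sub_one α hs - discrR_add_one α hs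

theorem isEigenvalue_real_iff (A : ℤ) {α γ x : ℝ} (hx : (x : ℂ) ∉ band α) :
    UnboundedOp.IsEigenvalue (impurityHamiltonian A α γ) (x : ℂ) ↔
      lowFac α x * upFac α x = γ ^ 2 / 16 ∧ γ * lowFac α x < 0 := by
  rw [isEigenvalue_iff_of_notMem_band A hx]
  obtain ⟨hs, hpos⟩ := notMem_band_iff.1 hx
  have hsc := sinRoot_ofReal_ne_zero.2 hs
  have e1 := discrR_sub_one α hs
  have e2 := discrR_add_one α hs
  set D := discrR α x with hD
  set P := lowFac α x with hP
  set Q := upFac α x with hQ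
  set s := sinR x Real.pi with hsdef
  have hs2 : 0 < s ^ 2 := by positivity
  have hDs : 2 * D = (P + Q) * s := by linarith
  have hε := magSign_mul_self A
  have hεn : ‖magSign A‖ = 1 := by
    rcases magSign_eq_or A with h | h <;> simp [h]
  have hnorm : ‖magSign A * ((D + γ * s / 4 : ℝ) : ℂ)‖ = |D + γ * s / 4| := by
    rw [norm_mul, hεn, one_mul, Complex.norm_real, Real.norm_eq_abs]
  have hDc : discr α x = (D : ℂ) := (ofReal_discrR α x).symm
  have hsc' : sinRoot x Real.pi = (s : ℂ) := (ofReal_sinR x Real.pi).symm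
  constructor
  · rintro ⟨l, h0, h1, h2, h3⟩
    have hsec : P * Q = γ ^ 2 / 16 := by
      have h := secular_of_multiplier hsc h0 h2 h3
      rw [← ofReal_lowFac, ← ofReal_upFac] at h
      exact_mod_cast h
    refine ⟨hsec, ?_⟩
    -- Half the sum of the equations for `l + l⁻¹` and `l - l⁻¹`.
    have hl : l = magSign A * ((D + γ * s / 4 : ℝ) : ℂ) := by
      rw [hDc] at h2
      rw [hsc'] at h3
      push_cast
      linear_combination h2 / 2 + h3 / 2
    rw [hl, hnorm, ← sq_lt_one_iff_abs_lt_one] at h1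
    have hprod : (D + γ * s / 4) * (D - γ * s / 4) = 1 := by
      linear_combination s ^ 2 * hsec + (D + 1) * e1 + P * s * e2
    -- With `t = D + γs/4` and `t' = D - γs/4`, the bound `t² < 1 = tt'` says `t (t - t') < 0`,
    -- where `t - t' = γs/2`.
    have h4 : s ^ 2 * (γ * (P + Q + γ / 2)) < 0 := by
      have : (D + γ * s / 4) * (γ * s / 2) < 0 := by nlinarith
      have e : s ^ 2 * (γ * (P + Q + γ / 2)) = 4 * ((D + γ * s / 4) * (γ * s / 2)) := by
        linear_combination -γ * s * hDs
      rw [e]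
      linarith
    have h5 : γ * (P + Q + γ / 2) < 0 := by
      by_contra hn
      exact absurd h4 (not_lt.2 (mul_nonneg hs2.le (not_lt.1 hn)))
    by_contra hn
    have h6 : 0 ≤ γ * P := not_lt.1 hn
    have h7 : 0 ≤ γ * Q := by
      rcases mul_pos_iff.1 hpos with ⟨hp, hq⟩ | ⟨hp, hq⟩
      · exact mul_nonneg (nonneg_of_mul_nonneg_left h6 hp) hq.le
      · have : γ ≤ 0 := by
          by_contra hγ
          nlinarith [mul_neg_of_pos_of_neg (not_le.1 hγ) hp]
        exact mul_nonneg_of_nonpos_of_nonpos this hq.le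
    nlinarith [sq_nonneg γ]
  · rintro ⟨hsec, hneg⟩
    have hprod : (D + γ * s / 4) * (D - γ * s / 4) = 1 := by
      linear_combination s ^ 2 * hsec + (D + 1) * e1 + P * s * e2
    have hqneg : γ * Q < 0 := by
      have : 0 < (γ * P) * (γ * Q) := by
        have hγ : γ ≠ 0 := by
          rintro rfl
          simp at hneg
        have e : (γ * P) * (γ * Q) = γ ^ 2 * (P * Q) := by ring
        rw [e]
        positivity
      by_contra hn
      have h := mul_nonpos_of_nonpos_of_nonneg hneg.le (not_lt.1 hn)
      linarith
    have hne : P ≠ Q := by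
      intro h
      have := upFac_sub_lowFac α hs
      rw [← hP, ← hQ, h, sub_self, zero_mul] at this
      norm_num at this
    have hγ : γ ≠ 0 := by
      rintro rfl
      simp at hneg
    -- Strict inequality of the means: `PQ = γ²/16` and `P ≠ Q` give `|γP + γQ| > γ²/2`, and both
    -- summands are negative.
    have h5 : γ * (P + Q + γ / 2) < 0 := by
      have hlt : (γ ^ 2 / 2) ^ 2 < (γ * P + γ * Q) ^ 2 := by
        have e : (γ * P + γ * Q) ^ 2 = (γ ^ 2 / 2) ^ 2 + γ ^ 2 * (P - Q) ^ 2 := by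
          linear_combination 4 * γ ^ 2 * hsec
        have : 0 < γ ^ 2 * (P - Q) ^ 2 := by
          have := sub_ne_zero.2 hne
          positivity
        linarith
      have h := sq_lt_sq.1 hlt
      rw [abs_of_nonneg (by positivity), abs_of_neg (by linarith)] at h
      linarith
    have hlt1 : |D + γ * s / 4| < 1 := by
      rw [← sq_lt_one_iff_abs_lt_one]
      have e : s ^ 2 * (γ * (P + Q + γ / 2)) = 4 * ((D + γ * s / 4) * (γ * s / 2)) := by
        linear_combination -γ * s * hDs
      have := mul_neg_of_pos_of_neg hs2 h5
      nlinarith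
    have hinv : (magSign A * ((D + γ * s / 4 : ℝ) : ℂ))⁻¹ =
        magSign A * ((D - γ * s / 4 : ℝ) : ℂ) := by
      apply inv_eq_of_mul_eq_one_right
      have hc : ((D + γ * s / 4 : ℝ) : ℂ) * ((D - γ * s / 4 : ℝ) : ℂ) = 1 := by
        exact_mod_cast hprod
      linear_combination
        ((D + γ * s / 4 : ℝ) : ℂ) * ((D - γ * s / 4 : ℝ) : ℂ) * hε + hc
    refine ⟨magSign A * ((D + γ * s / 4 : ℝ) : ℂ), ?_, ?_, ?_, ?_⟩
    · intro h
      rw [h, norm_zero] at hnorm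
      have : D + γ * s / 4 = 0 := abs_eq_zero.1 hnorm.symm
      rw [this, zero_mul] at hprod
      exact zero_ne_one hprod
    · rw [hnorm]
      exact hlt1
    · rw [hinv, hDc]
      push_cast
      ring
    · rw [hinv, hsc']
      push_cast
      ring

end RingChain
end

noncomputable section
namespace RingChain

/-! ### Monotonicity between consecutive Dirichlet eigenvalues -/

/-- Carathéodory's form of the derivative: the difference quotient is `g` itself. Lagrange's
identity supplies such a `g`, so no differentiation in the spectral parameter is needed. -/
theorem hasDerivAt_of_sub_eq_mul {f g : ℝ → ℝ} {x : ℝ} (hg : ContinuousAt g x)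
    (h : ∀ᶠ y in 𝓝 x, f y - f x = (y - x) * g y) : HasDerivAt f (g x) x := by
  rw [hasDerivAt_iff_tendsto_slope]
  refine (hg.tendsto.mono_left nhdsWithin_le_nhds).congr' ?_
  filter_upwards [nhdsWithin_le_nhds h, self_mem_nhdsWithin] with y hy hne
  rw [slope_def_field, hy, mul_div_cancel_left₀ _ (sub_ne_zero.2 hne)]

theorem continuous_sinR_left (t : ℝ) : Continuous fun x => sinR x t := by
  have := continuous_sinR
  fun_prop

theorem continuous_cosR_left (t : ℝ) : Continuous fun x => cosR x t := by
  have := continuous_cosR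
  fun_prop

theorem continuous_sinR_right (x : ℝ) : Continuous fun t => sinR x t := by
  have := continuous_sinR
  fun_prop

theorem continuous_cosR_right (x : ℝ) : Continuous fun t => cosR x t := by
  have := continuous_cosR
  fun_prop

theorem wronskian_cosR (x y t : ℝ) :
    y * sinR y t * cosR x t - x * sinR x t * cosR y t =
      (y - x) * ∫ u in (0 : ℝ)..t, cosR y u * cosR x u := by
  have h := wronskian_cosRoot x y t
  simp only [← ofReal_cosR, ← ofReal_sinR, ← Complex.ofReal_mul] at h
  rw [intervalIntegral.integral_ofReal] at h
  exact_mod_cast h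

theorem wronskian_sinR (x y t : ℝ) :
    cosR y t * sinR x t - cosR x t * sinR y t =
      (x - y) * ∫ u in (0 : ℝ)..t, sinR y u * sinR x u := by
  have h := wronskian_sinRoot x y t
  simp only [← ofReal_cosR, ← ofReal_sinR, ← Complex.ofReal_mul] at h
  rw [intervalIntegral.integral_ofReal] at h
  exact_mod_cast h

theorem exists_hasDerivAt_lowFac (α : ℝ) {x : ℝ} (hs : sinR x Real.pi ≠ 0) :
    ∃ d < 0, HasDerivAt (lowFac α) d x := by
  have hC := (half_ne_zero_real hs).2
  set h := Real.pi / 2 with hh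
  have hpos : 0 < h := by positivity
  set g : ℝ → ℝ := fun y =>
    -((∫ u in (0 : ℝ)..h, cosR y u * cosR x u) / (cosR y h * cosR x h)) with hg
  refine ⟨g x, ?_, hasDerivAt_of_sub_eq_mul ?_ ?_⟩
  · have hI : 0 < ∫ u in (0 : ℝ)..h, cosR x u * cosR x u := by
      refine intervalIntegral.integral_pos hpos
        ((continuous_cosR_right x).mul (continuous_cosR_right x)).continuousOn
        (fun u _ => mul_self_nonneg _) ⟨0, ⟨le_rfl, hpos.le⟩, ?_⟩
      simp [cosR]
    simp only [hg, neg_lt_zero]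
    exact div_pos hI (mul_self_pos.2 hC)
  · have hc : Continuous fun y => ∫ u in (0 : ℝ)..h, cosR y u * cosR x u := by
      apply intervalIntegral.continuous_parametric_intervalIntegral_of_continuous'
      exact continuous_cosR.mul ((continuous_cosR_right x).comp continuous_snd)
    exact (hc.continuousAt.div ((continuous_cosR_left h).mul_const _).continuousAt
      (mul_ne_zero hC hC)).neg
  · filter_upwards [(continuous_cosR_left h).continuousAt.eventually_ne hC] with y hy
    have w := wronskian_cosR x y h
    simp only [lowFac, hg, ← hh]
    field_simp
    linear_combination -4 * w

theorem exists_hasDerivAt_upFac (α : ℝ) {x : ℝ} (hs : sinR x Real.pi ≠ 0) :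
    ∃ d < 0, HasDerivAt (upFac α) d x := by
  have hS := (half_ne_zero_real hs).1
  set h := Real.pi / 2 with hh
  have hpos : 0 < h := by positivity
  set g : ℝ → ℝ := fun y =>
    -((∫ u in (0 : ℝ)..h, sinR y u * sinR x u) / (sinR y h * sinR x h)) with hg
  refine ⟨g x, ?_, hasDerivAt_of_sub_eq_mul ?_ ?_⟩
  · have hI : 0 < ∫ u in (0 : ℝ)..h, sinR x u * sinR x u :=
      intervalIntegral.integral_pos hpos
        ((continuous_sinR_right x).mul (continuous_sinR_right x)).continuousOn
        (fun u _ => mul_self_nonneg _) ⟨h, ⟨hpos.le, le_rfl⟩, mul_self_pos.2 hS⟩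
    simp only [hg, neg_lt_zero]
    exact div_pos hI (mul_self_pos.2 hS)
  · have hc : Continuous fun y => ∫ u in (0 : ℝ)..h, sinR y u * sinR x u := by
      apply intervalIntegral.continuous_parametric_intervalIntegral_of_continuous'
      exact continuous_sinR.mul ((continuous_sinR_right x).comp continuous_snd)
    exact (hc.continuousAt.div ((continuous_sinR_left h).mul_const _).continuousAt
      (mul_ne_zero hS hS)).neg
  · filter_upwards [(continuous_sinR_left h).continuousAt.eventually_ne hS] with y hy
    have w := wronskian_sinR x y h
    simp only [upFac, hg, ← hh]
    field_simp
    linear_combination 4 * w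

theorem strictAntiOn_of_hasDerivAt_neg {f : ℝ → ℝ} {J : Set ℝ} (hJ : Convex ℝ J)
    (h : ∀ x ∈ J, ∃ d < 0, HasDerivAt f d x) : StrictAntiOn f J := by
  refine strictAntiOn_of_deriv_neg hJ (fun x hx => ?_) (fun x hx => ?_)
  · obtain ⟨d, -, hd⟩ := h x hx
    exact hd.continuousAt.continuousWithinAt
  · obtain ⟨d, hd0, hd⟩ := h x (interior_subset hx)
    rwa [hd.deriv]

/-- The intervals between consecutive numbers `n²`, `n ≥ 1`. -/
def cell (n : ℕ) : Set ℝ := {x | (n = 0 ∨ (n : ℝ) ^ 2 < x) ∧ x < ((n : ℝ) + 1) ^ 2}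

/-- The interval with `n = 0` extends to `-∞`, since `0` is not a zero of the sine term. -/
theorem cell_eq_or (n : ℕ) :
    cell n = Set.Iio (((n : ℝ) + 1) ^ 2) ∨ cell n = Set.Ioo ((n : ℝ) ^ 2) (((n : ℝ) + 1) ^ 2) := by
  rcases Nat.eq_zero_or_pos n with h | h
  · left
    ext x
    simp [cell, h]
  · right
    ext x
    simp [cell, h.ne']

theorem convex_cell (n : ℕ) : Convex ℝ (cell n) := by
  rcases cell_eq_or n with h | h <;> rw [h]
  · exact convex_Iio _
  · exact convex_Ioo _ _

theorem ordConnected_cell (n : ℕ) : (cell n).OrdConnected := (convex_cell n).ordConnected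

theorem isOpen_cell (n : ℕ) : IsOpen (cell n) := by
  rcases cell_eq_or n with h | h <;> rw [h]
  · exact isOpen_Iio
  · exact isOpen_Ioo

theorem sinR_pi_eq_zero_iff {x : ℝ} :
    sinR x Real.pi = 0 ↔ ∃ n : ℕ, 1 ≤ n ∧ x = (n : ℝ) ^ 2 := by
  have h := sinRoot_pi_eq_zero_iff (z := (x : ℂ))
  rw [← ofReal_sinR] at h
  exact_mod_cast h

theorem sinR_ne_zero_of_mem_cell {n : ℕ} {x : ℝ} (hx : x ∈ cell n) : sinR x Real.pi ≠ 0 := by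
  rw [Ne, sinR_pi_eq_zero_iff]
  rintro ⟨m, hm, rfl⟩
  obtain ⟨h1, h2⟩ := hx
  have h3 : m < n + 1 := by
    have := lt_of_pow_lt_pow_left₀ 2 (by positivity) h2
    exact_mod_cast this
  rcases h1 with h1 | h1
  · omega
  · have : (n : ℝ) < m := lt_of_pow_lt_pow_left₀ 2 (by positivity) h1
    have : n < m := by exact_mod_cast this
    omega

theorem exists_mem_cell {x : ℝ} (hs : sinR x Real.pi ≠ 0) : ∃ n, x ∈ cell n := by
  rcases lt_or_ge x 1 with h | h
  · exact ⟨0, Or.inl rfl, by simpa using h⟩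
  · have h0 : 0 ≤ x := by linarith
    have hf := Nat.floor_le (Real.sqrt_nonneg x)
    have hl := Nat.lt_floor_add_one (Real.sqrt x)
    set n := ⌊Real.sqrt x⌋₊
    have h1 : 1 ≤ n := Nat.le_floor (by rw [Nat.cast_one]; exact Real.one_le_sqrt.2 h)
    have hsq := Real.sq_sqrt h0
    have hle : (n : ℝ) ^ 2 ≤ x := by
      rw [← hsq]
      exact pow_le_pow_left₀ (by positivity) hf 2
    refine ⟨n, Or.inr (lt_of_le_of_ne hle fun e => hs (sinR_pi_eq_zero_iff.2 ⟨n, h1, e.symm⟩)), ?_⟩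
    rw [← hsq]
    exact pow_lt_pow_left₀ hl (Real.sqrt_nonneg x) two_ne_zero

theorem strictAntiOn_lowFac (α : ℝ) (n : ℕ) : StrictAntiOn (lowFac α) (cell n) :=
  strictAntiOn_of_hasDerivAt_neg (convex_cell n) fun _ hx =>
    exists_hasDerivAt_lowFac α (sinR_ne_zero_of_mem_cell hx)

theorem strictAntiOn_upFac (α : ℝ) (n : ℕ) : StrictAntiOn (upFac α) (cell n) :=
  strictAntiOn_of_hasDerivAt_neg (convex_cell n) fun _ hx =>
    exists_hasDerivAt_upFac α (sinR_ne_zero_of_mem_cell hx)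

theorem continuousAt_lowFac (α : ℝ) {x : ℝ} (hs : sinR x Real.pi ≠ 0) :
    ContinuousAt (lowFac α) x := by
  obtain ⟨d, -, hd⟩ := exists_hasDerivAt_lowFac α hs
  exact hd.continuousAt

theorem continuousAt_upFac (α : ℝ) {x : ℝ} (hs : sinR x Real.pi ≠ 0) :
    ContinuousAt (upFac α) x := by
  obtain ⟨d, -, hd⟩ := exists_hasDerivAt_upFac α hs
  exact hd.continuousAt

theorem continuousOn_lowFac (α : ℝ) (n : ℕ) : ContinuousOn (lowFac α) (cell n) :=
  fun _ hx => (continuousAt_lowFac α (sinR_ne_zero_of_mem_cell hx)).continuousWithinAt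

theorem continuousOn_upFac (α : ℝ) (n : ℕ) : ContinuousOn (upFac α) (cell n) :=
  fun _ hx => (continuousAt_upFac α (sinR_ne_zero_of_mem_cell hx)).continuousWithinAt

/-! ### Behaviour at the ends of the intervals -/

theorem cosR_sq (k : ℝ) (t : ℝ) : cosR (k ^ 2) t = Real.cos (k * t) := by
  have h := cosRoot_sq (k : ℂ) t
  rw [← Complex.ofReal_pow, ← ofReal_cosR, ← Complex.ofReal_mul, ← Complex.ofReal_cos] at h
  exact_mod_cast h

theorem mul_sinR_sq (k : ℝ) (t : ℝ) : k * sinR (k ^ 2) t = Real.sin (k * t) := by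
  have h := mul_sinRoot_sq (k : ℂ) t
  rw [← Complex.ofReal_pow, ← ofReal_sinR, ← Complex.ofReal_mul, ← Complex.ofReal_mul,
    ← Complex.ofReal_sin] at h
  exact_mod_cast h

theorem cosR_neg_sq (k : ℝ) (t : ℝ) : cosR (-k ^ 2) t = Real.cosh (k * t) := by
  have h := cosRoot_sq ((k : ℂ) * Complex.I) t
  have e1 : ((k : ℂ) * Complex.I) ^ 2 = ((-k ^ 2 : ℝ) : ℂ) := by
    push_cast
    linear_combination (k : ℂ) ^ 2 * Complex.I_sq
  have e2 : (k : ℂ) * Complex.I * t = ((k * t : ℝ) : ℂ) * Complex.I := by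
    push_cast
    ring
  rw [e1, e2, ← ofReal_cosR, Complex.cos_mul_I, ← Complex.ofReal_cosh] at h
  exact_mod_cast h

theorem mul_sinR_neg_sq (k : ℝ) (t : ℝ) : k * sinR (-k ^ 2) t = Real.sinh (k * t) := by
  have h := mul_sinRoot_sq ((k : ℂ) * Complex.I) t
  have e1 : ((k : ℂ) * Complex.I) ^ 2 = ((-k ^ 2 : ℝ) : ℂ) := by
    push_cast
    linear_combination (k : ℂ) ^ 2 * Complex.I_sq
  have e2 : (k : ℂ) * Complex.I * t = ((k * t : ℝ) : ℂ) * Complex.I := by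
    push_cast
    ring
  rw [e1, e2, ← ofReal_sinR, Complex.sin_mul_I, ← Complex.ofReal_sinh] at h
  have h2 : (k : ℂ) * (sinR (-k ^ 2) t : ℂ) = ((Real.sinh (k * t) : ℝ) : ℂ) := by
    apply mul_right_cancel₀ Complex.I_ne_zero
    linear_combination h
  exact_mod_cast h2

theorem one_le_sinR_of_neg {x : ℝ} (hx : x < 0) : 1 ≤ sinR x Real.pi := by
  set k := Real.sqrt (-x) with hk
  have hkpos : 0 < k := Real.sqrt_pos.2 (by linarith)
  have hx2 : x = -k ^ 2 := by
    rw [hk, Real.sq_sqrt (by linarith)]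
    ring
  have h := mul_sinR_neg_sq k Real.pi
  rw [← hx2] at h
  have h1 : k * Real.pi ≤ Real.sinh (k * Real.pi) :=
    Real.self_le_sinh_iff.2 (by positivity)
  rw [← h] at h1
  have := le_of_mul_le_mul_left h1 hkpos
  linarith [Real.pi_gt_three]

theorem cos_mul_sin_eq (n : ℕ) (k : ℝ) :
    cosR (k ^ 2) Real.pi * (k * sinR (k ^ 2) Real.pi) =
      Real.sin (2 * ((k - n) * Real.pi)) / 2 := by
  rw [cosR_sq, mul_sinR_sq]
  have h : Real.sin (2 * ((k - n) * Real.pi)) = Real.sin (2 * (k * Real.pi)) := by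
    rw [show 2 * ((k - n) * Real.pi) = 2 * (k * Real.pi) - n * (2 * Real.pi) by ring,
      Real.sin_sub_nat_mul_two_pi]
  rw [h, Real.sin_two_mul]
  ring

theorem cosR_mul_sinR_natCast_sq {n : ℕ} (hn : 1 ≤ n) :
    cosR ((n : ℝ) ^ 2) Real.pi ^ 2 = 1 ∧
      cosR ((n : ℝ) ^ 2) Real.pi * sinR ((n : ℝ) ^ 2) Real.pi = 0 := by
  have hs : sinR ((n : ℝ) ^ 2) Real.pi = 0 := sinR_pi_eq_zero_iff.2 ⟨n, hn, rfl⟩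
  refine ⟨?_, by rw [hs, mul_zero]⟩
  rw [cosR_sq, Real.cos_nat_mul_pi, ← pow_mul, mul_comm, pow_mul]
  simp

/-- Used for the cotangent near `n²`: the square of the cosine tends to `1`, and the sign of the
product of cosine and sine does not involve the parity of `n`. -/
theorem div_eq_sq_mul_inv (a b : ℝ) : a / b = a ^ 2 * (a * b)⁻¹ := by
  rcases eq_or_ne a 0 with rfl | ha
  · simp
  · rw [mul_inv]
    field_simp

theorem tendsto_cot_right {n : ℕ} (hn : 1 ≤ n) :
    Tendsto (fun x => cosR x Real.pi / sinR x Real.pi) (𝓝[>] ((n : ℝ) ^ 2)) atTop := by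
  obtain ⟨h1, h2⟩ := cosR_mul_sinR_natCast_sq hn
  have c1 : Tendsto (fun x => cosR x Real.pi ^ 2) (𝓝 ((n : ℝ) ^ 2))
      (𝓝 (cosR ((n : ℝ) ^ 2) Real.pi ^ 2)) :=
    ((continuous_cosR_left Real.pi).pow 2).tendsto ((n : ℝ) ^ 2)
  have c2 : Tendsto (fun x => cosR x Real.pi * sinR x Real.pi) (𝓝 ((n : ℝ) ^ 2))
      (𝓝 (cosR ((n : ℝ) ^ 2) Real.pi * sinR ((n : ℝ) ^ 2) Real.pi)) :=
    ((continuous_cosR_left Real.pi).mul (continuous_sinR_left Real.pi)).tendsto ((n : ℝ) ^ 2)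
  rw [h1] at c1
  rw [h2] at c2
  have hn' : (1 : ℝ) ≤ n := by exact_mod_cast hn
  have hpos : ∀ᶠ x in 𝓝[>] ((n : ℝ) ^ 2), 0 < cosR x Real.pi * sinR x Real.pi := by
    -- The offset `1 / 2` keeps `2 (√x - n) π` within `(0, π)`, where the sine is positive.
    have hm : Set.Ioo ((n : ℝ) ^ 2) (((n : ℝ) + 1 / 2) ^ 2) ∈ 𝓝[>] ((n : ℝ) ^ 2) :=
      Ioo_mem_nhdsGT (pow_lt_pow_left₀ (by linarith) (by positivity) two_ne_zero)
    filter_upwards [hm] with x hx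
    have hx0 : 0 ≤ x := (sq_nonneg _).trans hx.1.le
    have k1 : (n : ℝ) < Real.sqrt x := Real.lt_sqrt_of_sq_lt hx.1
    have k2 : Real.sqrt x < (n : ℝ) + 1 / 2 := (Real.sqrt_lt' (by positivity)).2 hx.2
    have e := cos_mul_sin_eq n (Real.sqrt x)
    rw [Real.sq_sqrt hx0] at e
    have hsin : 0 < Real.sin (2 * ((Real.sqrt x - n) * Real.pi)) := by
      apply Real.sin_pos_of_pos_of_lt_pi
      · have := mul_pos (sub_pos.2 k1) Real.pi_pos
        linarith
      · nlinarith [Real.pi_pos]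
    have hk : 0 < Real.sqrt x := by linarith
    have e2 : Real.sqrt x * (cosR x Real.pi * sinR x Real.pi) =
        Real.sin (2 * ((Real.sqrt x - n) * Real.pi)) / 2 := by linear_combination e
    exact pos_of_mul_pos_right (e2 ▸ half_pos hsin) hk.le
  have hinv : Tendsto (fun x => (cosR x Real.pi * sinR x Real.pi)⁻¹)
      (𝓝[>] ((n : ℝ) ^ 2)) atTop :=
    tendsto_inv_nhdsGT_zero.comp
      (tendsto_nhdsWithin_iff.2 ⟨c2.mono_left nhdsWithin_le_nhds, hpos⟩)
  refine ((c1.mono_left nhdsWithin_le_nhds).pos_mul_atTop one_pos hinv).congr fun x => ?_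
  exact (div_eq_sq_mul_inv _ _).symm

theorem tendsto_cot_left {n : ℕ} (hn : 1 ≤ n) :
    Tendsto (fun x => cosR x Real.pi / sinR x Real.pi) (𝓝[<] ((n : ℝ) ^ 2)) atBot := by
  obtain ⟨h1, h2⟩ := cosR_mul_sinR_natCast_sq hn
  have c1 : Tendsto (fun x => cosR x Real.pi ^ 2) (𝓝 ((n : ℝ) ^ 2))
      (𝓝 (cosR ((n : ℝ) ^ 2) Real.pi ^ 2)) :=
    ((continuous_cosR_left Real.pi).pow 2).tendsto ((n : ℝ) ^ 2)
  have c2 : Tendsto (fun x => cosR x Real.pi * sinR x Real.pi) (𝓝 ((n : ℝ) ^ 2))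
      (𝓝 (cosR ((n : ℝ) ^ 2) Real.pi * sinR ((n : ℝ) ^ 2) Real.pi)) :=
    ((continuous_cosR_left Real.pi).mul (continuous_sinR_left Real.pi)).tendsto ((n : ℝ) ^ 2)
  rw [h1] at c1
  rw [h2] at c2
  have hn' : (1 : ℝ) ≤ n := by exact_mod_cast hn
  have hneg : ∀ᶠ x in 𝓝[<] ((n : ℝ) ^ 2), cosR x Real.pi * sinR x Real.pi < 0 := by
    have hm : Set.Ioo (((n : ℝ) - 1 / 2) ^ 2) ((n : ℝ) ^ 2) ∈ 𝓝[<] ((n : ℝ) ^ 2) :=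
      Ioo_mem_nhdsLT (pow_lt_pow_left₀ (by linarith) (by linarith) two_ne_zero)
    filter_upwards [hm] with x hx
    have hx0 : 0 ≤ x := (sq_nonneg _).trans hx.1.le
    have k1 : (n : ℝ) - 1 / 2 < Real.sqrt x := Real.lt_sqrt_of_sq_lt hx.1
    have k2 : Real.sqrt x < (n : ℝ) := (Real.sqrt_lt' (by positivity)).2 hx.2
    have e := cos_mul_sin_eq n (Real.sqrt x)
    rw [Real.sq_sqrt hx0] at e
    have hsin : Real.sin (2 * ((Real.sqrt x - n) * Real.pi)) < 0 := by
      apply Real.sin_neg_of_neg_of_neg_pi_lt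
      · have := mul_neg_of_neg_of_pos (sub_neg.2 k2) Real.pi_pos
        linarith
      · nlinarith [Real.pi_pos]
    have hk : 0 < Real.sqrt x := by linarith
    have e2 : Real.sqrt x * (cosR x Real.pi * sinR x Real.pi) =
        Real.sin (2 * ((Real.sqrt x - n) * Real.pi)) / 2 := by linear_combination e
    by_contra hc
    have := mul_nonneg hk.le (not_lt.1 hc)
    linarith
  have hinv : Tendsto (fun x => (cosR x Real.pi * sinR x Real.pi)⁻¹)
      (𝓝[<] ((n : ℝ) ^ 2)) atBot :=
    tendsto_inv_nhdsLT_zero.comp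
      (tendsto_nhdsWithin_iff.2 ⟨c2.mono_left nhdsWithin_le_nhds, hneg⟩)
  refine ((c1.mono_left nhdsWithin_le_nhds).pos_mul_atBot one_pos hinv).congr fun x => ?_
  exact (div_eq_sq_mul_inv _ _).symm

theorem exists_lt_add_fac (α : ℝ) {n : ℕ} {x : ℝ} (hx : x ∈ cell n) (M : ℝ) :
    ∃ y ∈ cell n, y < x ∧ M < lowFac α y + upFac α y := by
  obtain ⟨h1, h2⟩ := hx
  rcases Nat.eq_zero_or_pos n with h0 | h0
  · subst h0
    -- At `-k²` the ratio is `k coth (kπ) ≥ k`. The summands of `k` ensure positivity, `-k² < x` and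
    -- a value above `M`.
    set k := 1 + |x| + |M - α / 2| with hk
    have hk1 : 1 ≤ k := by
      have := abs_nonneg x
      have := abs_nonneg (M - α / 2)
      linarith
    have hkx : |x| < k := by
      have := abs_nonneg (M - α / 2)
      linarith
    have hkM : M - α / 2 < k := by
      have := abs_nonneg x
      have := le_abs_self (M - α / 2)
      linarith
    have hlt : -k ^ 2 < x := by
      have := neg_abs_le x
      nlinarith
    have hmem : -k ^ 2 ∈ cell 0 := ⟨Or.inl rfl, hlt.trans h2⟩
    refine ⟨-k ^ 2, hmem, hlt, ?_⟩
    have hs := sinR_ne_zero_of_mem_cell hmem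
    have hs1 := one_le_sinR_of_neg (x := -k ^ 2) (by nlinarith)
    rw [add_fac α hs]
    have hcot : k ≤ cosR (-k ^ 2) Real.pi / sinR (-k ^ 2) Real.pi := by
      rw [le_div_iff₀ (by linarith), mul_sinR_neg_sq, cosR_neg_sq]
      exact (Real.sinh_lt_cosh _).le
    linarith
  · have ht := tendsto_cot_right h0
    have hlt := h1.resolve_left h0.ne'
    have hev := (ht.eventually_gt_atTop ((M - α / 2) / 2)).and
      (Ioo_mem_nhdsGT hlt)
    obtain ⟨y, hy1, hy2⟩ := hev.exists
    have hmem : y ∈ cell n := ⟨Or.inr hy2.1, hy2.2.trans h2⟩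
    refine ⟨y, hmem, hy2.2, ?_⟩
    rw [add_fac α (sinR_ne_zero_of_mem_cell hmem)]
    linarith

theorem exists_add_fac_lt (α : ℝ) {n : ℕ} {x : ℝ} (hx : x ∈ cell n) (M : ℝ) :
    ∃ y ∈ cell n, x < y ∧ lowFac α y + upFac α y < M := by
  obtain ⟨h1, h2⟩ := hx
  have ht := tendsto_cot_left (n := n + 1) (by omega)
  push_cast at ht
  have hev := (ht.eventually_lt_atBot ((M - α / 2) / 2)).and (Ioo_mem_nhdsLT h2)
  obtain ⟨y, hy1, hy2⟩ := hev.exists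
  have hmem : y ∈ cell n := ⟨h1.imp_right fun h => h.trans hy2.1, hy2.2⟩
  refine ⟨y, hmem, hy2.1, ?_⟩
  rw [add_fac α (sinR_ne_zero_of_mem_cell hmem)]
  linarith

/-- Intermediate value theorem for the product of positive parts, which vanishes at `y₂` and can
equal `t > 0` only where both factors are positive. At `y₁` it is at least `t`, because `(p - m)(q -
m) ≥ 0` gives `pq ≥ m (p + q) - m²`. -/
theorem exists_mul_eq {p q : ℝ → ℝ} {J : Set ℝ} (hJ : J.OrdConnected) (hp : ContinuousOn p J)
    (hq : ContinuousOn q J) {y₁ y₂ m t : ℝ} (h₁ : y₁ ∈ J) (h₂ : y₂ ∈ J) (hm : 0 < m)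
    (hpm : m ≤ p y₁) (hqm : m ≤ q y₁) (hsum : t / m + m ≤ p y₁ + q y₁) (hneg : p y₂ + q y₂ ≤ 0)
    (ht : 0 < t) : ∃ y ∈ J, 0 < p y ∧ 0 < q y ∧ p y * q y = t := by
  set F : ℝ → ℝ := fun y => max (p y) 0 * max (q y) 0 with hF
  have hsub : Set.uIcc y₁ y₂ ⊆ J := hJ.uIcc_subset h₁ h₂
  have hFc : ContinuousOn F (Set.uIcc y₁ y₂) :=
    ((hp.mono hsub).sup continuousOn_const).mul ((hq.mono hsub).sup continuousOn_const)
  have hF1 : t ≤ F y₁ := by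
    simp only [hF]
    rw [max_eq_left (hm.le.trans hpm), max_eq_left (hm.le.trans hqm)]
    have e : t = t / m * m := by field_simp
    nlinarith [mul_nonneg (sub_nonneg.2 hpm) (sub_nonneg.2 hqm),
      mul_le_mul_of_nonneg_right hsum hm.le]
  have hF2 : F y₂ = 0 := by
    simp only [hF]
    rcases le_total (p y₂) 0 with h | h
    · rw [max_eq_right h, zero_mul]
    · rw [max_eq_right (by linarith : q y₂ ≤ 0), mul_zero]
  have hmem : t ∈ Set.uIcc (F y₁) (F y₂) := by
    rw [hF2, Set.uIcc_of_ge (ht.le.trans hF1)]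
    exact ⟨ht.le, hF1⟩
  obtain ⟨y, hy, hyt⟩ := intermediate_value_uIcc hFc hmem
  have hpos : 0 < max (p y) 0 * max (q y) 0 := by
    rw [show max (p y) 0 * max (q y) 0 = t from hyt]
    exact ht
  have hp0 : 0 < p y := by
    by_contra h
    rw [max_eq_right (not_lt.1 h), zero_mul] at hpos
    exact lt_irrefl _ hpos
  have hq0 : 0 < q y := by
    by_contra h
    rw [max_eq_right (not_lt.1 h), mul_zero] at hpos
    exact lt_irrefl _ hpos
  refine ⟨y, hsub hy, hp0, hq0, ?_⟩
  rw [← hyt]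
  simp only [hF]
  rw [max_eq_left hp0.le, max_eq_left hq0.le]

theorem exists_pos_fac_mul_eq (α : ℝ) {n : ℕ} {x t : ℝ} (hx : x ∈ cell n)
    (hP : 0 < lowFac α x) (hQ : 0 < upFac α x) (ht : 0 < t) :
    ∃ y ∈ cell n, 0 < lowFac α y ∧ 0 < upFac α y ∧ lowFac α y * upFac α y = t := by
  -- To the left of `x` both factors stay above `m` by monotonicity, while their sum becomes
  -- arbitrarily large.
  set m := min (lowFac α x) (upFac α x) with hm
  obtain ⟨y₁, h₁, hlt₁, hs₁⟩ := exists_lt_add_fac α hx (t / m + m)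
  obtain ⟨y₂, h₂, -, hs₂⟩ := exists_add_fac_lt α hx 0
  exact exists_mul_eq (ordConnected_cell n) (continuousOn_lowFac α n) (continuousOn_upFac α n)
    h₁ h₂ (lt_min hP hQ)
    ((min_le_left _ _).trans (strictAntiOn_lowFac α n h₁ hx hlt₁).le)
    ((min_le_right _ _).trans (strictAntiOn_upFac α n h₁ hx hlt₁).le) hs₁.le hs₂.le ht

theorem exists_neg_fac_mul_eq (α : ℝ) {n : ℕ} {x t : ℝ} (hx : x ∈ cell n)
    (hP : lowFac α x < 0) (hQ : upFac α x < 0) (ht : 0 < t) :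
    ∃ y ∈ cell n, lowFac α y < 0 ∧ upFac α y < 0 ∧ lowFac α y * upFac α y = t := by
  set m := min (-lowFac α x) (-upFac α x) with hm
  obtain ⟨y₁, h₁, hlt₁, hs₁⟩ := exists_add_fac_lt α hx (-(t / m + m))
  obtain ⟨y₂, h₂, -, hs₂⟩ := exists_lt_add_fac α hx 0
  obtain ⟨y, hy, hp, hq, hpq⟩ := exists_mul_eq (p := fun y => -lowFac α y)
    (q := fun y => -upFac α y) (ordConnected_cell n) (continuousOn_lowFac α n).neg
    (continuousOn_upFac α n).neg h₁ h₂ (lt_min (neg_pos.2 hP) (neg_pos.2 hQ))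
    ((min_le_left _ _).trans (neg_le_neg (strictAntiOn_lowFac α n hx h₁ hlt₁).le))
    ((min_le_right _ _).trans (neg_le_neg (strictAntiOn_upFac α n hx h₁ hlt₁).le))
    (by linarith) (by linarith) ht
  exact ⟨y, hy, by linarith, by linarith, by linarith⟩

/-- The tangent and cotangent terms `a`, `b` have product `x`. Here `a > 0 > b`, hence `x < 0`; but
then `b` is of hyperbolic type and positive. -/
theorem not_both_neg {α x : ℝ} (hα : 0 < α) (hs : sinR x Real.pi ≠ 0) (hP : lowFac α x < 0)
    (hQ : upFac α x < 0) : False := by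
  obtain ⟨hS, hC⟩ := half_ne_zero_real hs
  have hprod : (x * sinR x (Real.pi / 2) / cosR x (Real.pi / 2)) *
      (cosR x (Real.pi / 2) / sinR x (Real.pi / 2)) = x := by
    field_simp
  rw [lowFac] at hP
  rw [upFac] at hQ
  set a := x * sinR x (Real.pi / 2) / cosR x (Real.pi / 2) with ha
  set b := cosR x (Real.pi / 2) / sinR x (Real.pi / 2) with hb
  have hx : x < 0 := by
    rw [← hprod]
    exact mul_neg_of_pos_of_neg (by linarith) (by linarith)
  have h1 := one_le_sinR_of_neg hx
  have h2 : sinR x Real.pi = 2 * sinR x (Real.pi / 2) * cosR x (Real.pi / 2) := by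
    have := sinRoot_pi (x : ℂ)
    rw [← ofReal_sinR, ← ofReal_sinR, ← ofReal_cosR] at this
    exact_mod_cast this
  have h3 : b * sinR x (Real.pi / 2) ^ 2 = sinR x (Real.pi / 2) * cosR x (Real.pi / 2) := by
    rw [hb]
    field_simp
  have h4 : 0 < b * sinR x (Real.pi / 2) ^ 2 := by
    rw [h3]
    linarith
  have h5 : 0 < b := pos_of_mul_pos_left h4 (sq_nonneg _)
  linarith

theorem neg_of_fac_pos {α x : ℝ} (hα : α < 0) (hs : sinR x Real.pi ≠ 0) (hP : 0 < lowFac α x)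
    (hQ : 0 < upFac α x) : x < 0 := by
  obtain ⟨hS, hC⟩ := half_ne_zero_real hs
  have hprod : (x * sinR x (Real.pi / 2) / cosR x (Real.pi / 2)) *
      (cosR x (Real.pi / 2) / sinR x (Real.pi / 2)) = x := by
    field_simp
  rw [lowFac] at hP
  rw [upFac] at hQ
  rw [← hprod]
  exact mul_neg_of_neg_of_pos (by linarith) (by linarith)

theorem exists_neg_fac_pos (α : ℝ) : ∃ x ∈ cell 0, 0 < lowFac α x ∧ 0 < upFac α x := by
  -- The bound `2` beats the difference of the factors, which is `2 / sinR y π ≤ 2` for negative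
  -- `y`.
  obtain ⟨y, hy, hlt, hM⟩ := exists_lt_add_fac α (n := 0) (x := 0) ⟨Or.inl rfl, by simp⟩ 2
  have hs := sinR_ne_zero_of_mem_cell hy
  have h1 := one_le_sinR_of_neg hlt
  have h2 := upFac_sub_lowFac α hs
  have h3 : 0 < upFac α y - lowFac α y := pos_of_mul_pos_left (by rw [h2]; norm_num) (by linarith)
  have h4 : upFac α y - lowFac α y ≤ 2 := by nlinarith
  exact ⟨y, hy, by linarith, by linarith⟩

end RingChain
end

/-! ### Connected components on the real line -/

theorem mem_connectedComponentIn_iff_uIcc_subset {O : Set ℝ} {x y : ℝ} (hx : x ∈ O) :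
    y ∈ connectedComponentIn O x ↔ Set.uIcc x y ⊆ O := by
  constructor
  · intro hy
    exact (isPreconnected_connectedComponentIn.ordConnected.uIcc_subset
      (mem_connectedComponentIn hx) hy).trans (connectedComponentIn_subset O x)
  · intro h
    exact isPreconnected_uIcc.subset_connectedComponentIn Set.left_mem_uIcc h Set.right_mem_uIcc

noncomputable section
namespace RingChain

/-! ### The essential spectrum -/

theorem fac_same_sign {α x : ℝ} (hx : (x : ℂ) ∉ band α) :
    (0 < lowFac α x ∧ 0 < upFac α x) ∨ (lowFac α x < 0 ∧ upFac α x < 0) :=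
  mul_pos_iff.1 (notMem_band_iff.1 hx).2

theorem fac_mul_lt_of_pos {α : ℝ} {n : ℕ} {x y : ℝ} (hx : x ∈ cell n) (hy : y ∈ cell n)
    (hxy : x < y) (hP : 0 < lowFac α y) (hQ : 0 < upFac α y) :
    lowFac α y * upFac α y < lowFac α x * upFac α x :=
  mul_lt_mul'' (strictAntiOn_lowFac α n hx hy hxy) (strictAntiOn_upFac α n hx hy hxy) hP.le hQ.le

theorem fac_mul_lt_of_neg {α : ℝ} {n : ℕ} {x y : ℝ} (hx : x ∈ cell n) (hy : y ∈ cell n)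
    (hxy : x < y) (hP : lowFac α x < 0) (hQ : upFac α x < 0) :
    lowFac α x * upFac α x < lowFac α y * upFac α y := by
  have h := mul_lt_mul'' (neg_lt_neg (strictAntiOn_lowFac α n hx hy hxy))
    (neg_lt_neg (strictAntiOn_upFac α n hx hy hxy)) (neg_nonneg.2 hP.le) (neg_nonneg.2 hQ.le)
  simpa using h

theorem isEigenvalue_pos_of_neg (A : ℤ) {α γ x : ℝ} (hγ : γ < 0) (hx : (x : ℂ) ∉ band α)
    (he : UnboundedOp.IsEigenvalue (impurityHamiltonian A α γ) (x : ℂ)) :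
    0 < lowFac α x ∧ 0 < upFac α x ∧ lowFac α x * upFac α x = γ ^ 2 / 16 := by
  obtain ⟨h1, h2⟩ := (isEigenvalue_real_iff A hx).1 he
  rcases fac_same_sign hx with h | h
  · exact ⟨h.1, h.2, h1⟩
  · exact absurd h2 (not_lt.2 (mul_pos_of_neg_of_neg hγ h.1).le)

theorem isEigenvalue_neg_of_pos (A : ℤ) {α γ x : ℝ} (hγ : 0 < γ) (hx : (x : ℂ) ∉ band α)
    (he : UnboundedOp.IsEigenvalue (impurityHamiltonian A α γ) (x : ℂ)) :
    lowFac α x < 0 ∧ upFac α x < 0 ∧ lowFac α x * upFac α x = γ ^ 2 / 16 := by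
  obtain ⟨h1, h2⟩ := (isEigenvalue_real_iff A hx).1 he
  rcases fac_same_sign hx with h | h
  · exact absurd h2 (not_lt.2 (mul_pos hγ h.1).le)
  · exact ⟨h.1, h.2, h1⟩

/-- The sign of `γ` fixes the sign of both factors, and where they have that common sign their
product is strictly monotone, so it takes the value `γ²/16` at most once. -/
theorem eigenvalue_unique_in_cell (A : ℤ) {α γ : ℝ} {n : ℕ} {x y : ℝ} (hx : x ∈ cell n)
    (hy : y ∈ cell n) (hxb : (x : ℂ) ∉ band α) (hyb : (y : ℂ) ∉ band α)
    (hxe : UnboundedOp.IsEigenvalue (impurityHamiltonian A α γ) (x : ℂ))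
    (hye : UnboundedOp.IsEigenvalue (impurityHamiltonian A α γ) (y : ℂ)) : x = y := by
  rcases lt_trichotomy γ 0 with hγ | hγ | hγ
  · obtain ⟨p1, p2, p3⟩ := isEigenvalue_pos_of_neg A hγ hxb hxe
    obtain ⟨q1, q2, q3⟩ := isEigenvalue_pos_of_neg A hγ hyb hye
    rcases lt_trichotomy x y with h | h | h
    · linarith [fac_mul_lt_of_pos hx hy h q1 q2]
    · exact h
    · linarith [fac_mul_lt_of_pos hy hx h p1 p2]
  · have h := ((isEigenvalue_real_iff A hxb).1 hxe).2
    rw [hγ, zero_mul] at h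
    exact absurd h (lt_irrefl 0)
  · obtain ⟨p1, p2, p3⟩ := isEigenvalue_neg_of_pos A hγ hxb hxe
    obtain ⟨q1, q2, q3⟩ := isEigenvalue_neg_of_pos A hγ hyb hye
    rcases lt_trichotomy x y with h | h | h
    · linarith [fac_mul_lt_of_neg hx hy h p1 p2]
    · exact h
    · linarith [fac_mul_lt_of_neg hy hx h q1 q2]

theorem eq_ofReal_of_isEigenvalue {A : ℤ} {α γ : ℝ} {z : ℂ}
    (he : UnboundedOp.IsEigenvalue (impurityHamiltonian A α γ) z) : z = (z.re : ℂ) := by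
  have h : z.im = 0 := by
    by_contra h
    exact not_isEigenvalue_of_im A α γ h he
  exact Complex.ext (by simp) (by simp [h])

/-- Isolation: nearby nonreal points are in the resolvent set. Nearby real points lie in the same
cell and off the bands, where uniqueness leaves no second eigenvalue. -/
theorem mem_discreteSpectrum (A : ℤ) {α γ : ℝ} {z : ℂ} (hz : z ∉ band α)
    (he : UnboundedOp.IsEigenvalue (impurityHamiltonian A α γ) z) :
    z ∈ UnboundedOp.discreteSpectrum (impurityHamiltonian A α γ) := by
  have hfr := (isSimpleEigenvalue_of_notMem_band A hz he).2
  refine ⟨he, Module.finite_of_finrank_eq_succ hfr, ?_⟩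
  have hzr := eq_ofReal_of_isEigenvalue he
  set x := z.re with hx
  rw [hzr] at hz he
  obtain ⟨hs, hpos⟩ := notMem_band_iff.1 hz
  obtain ⟨n, hn⟩ := exists_mem_cell hs
  have hN : ∀ᶠ y in 𝓝 x, y ∈ cell n ∧ 0 < lowFac α y * upFac α y :=
    ((isOpen_cell n).eventually_mem hn).and
      (((continuousAt_lowFac α hs).mul (continuousAt_upFac α hs)).eventually_const_lt hpos)
  have hre : Tendsto Complex.re (𝓝 z) (𝓝 x) := Complex.continuous_re.tendsto z
  filter_upwards [nhdsWithin_le_nhds (hre.eventually hN), self_mem_nhdsWithin] with w hw hne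
  rw [UnboundedOp.spectrum, Set.notMem_compl_iff]
  by_cases him : w.im = 0
  · have hwr : w = (w.re : ℂ) := Complex.ext (by simp) (by simp [him])
    rw [hwr]
    have hwb : (w.re : ℂ) ∉ band α :=
      notMem_band_iff.2 ⟨sinR_ne_zero_of_mem_cell hw.1, hw.2⟩
    apply mem_resolventSet_of_notMem_band A hwb
    intro hwe
    have h := eigenvalue_unique_in_cell A hw.1 hn hwb hz hwe he
    apply hne
    rw [Set.mem_singleton_iff, hwr, h, ← hzr]
  · exact mem_resolventSet_of_notMem_band A (notMem_band_of_im α him)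
      (not_isEigenvalue_of_im A α γ him)

theorem essSpectrum_impurityHamiltonian (A : ℤ) (α γ : ℝ) :
    UnboundedOp.essSpectrum (impurityHamiltonian A α γ) = band α := by
  ext z
  refine ⟨fun h => ?_, mem_essSpectrum_of_mem_band A γ⟩
  by_contra hz
  by_cases he : UnboundedOp.IsEigenvalue (impurityHamiltonian A α γ) z
  · exact h.2 (mem_discreteSpectrum A hz he)
  · exact h.1 (mem_resolventSet_of_notMem_band A hz he)

theorem periodicHamiltonian_eq (A α : ℝ) :
    periodicHamiltonian A α = impurityHamiltonian A α 0 := by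
  simp [periodicHamiltonian, impurityHamiltonian]

theorem spectrum_periodicHamiltonian (A : ℤ) (α : ℝ) :
    UnboundedOp.spectrum (periodicHamiltonian A α) = band α := by
  rw [periodicHamiltonian_eq]
  ext z
  refine ⟨fun h => ?_, fun h => (mem_essSpectrum_of_mem_band A 0 h).1⟩
  by_contra hz
  refine h (mem_resolventSet_of_notMem_band A hz fun he => ?_)
  rw [eq_ofReal_of_isEigenvalue he] at hz he
  have h := ((isEigenvalue_real_iff A hz).1 he).2
  rw [zero_mul] at h
  exact lt_irrefl 0 h

/-! ### Gaps -/

theorem natCast_sq_mem_band (α : ℝ) {n : ℕ} (hn : 1 ≤ n) : (((n : ℝ) ^ 2 : ℝ) : ℂ) ∈ band α := by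
  apply mem_band_of_sinRoot_eq_zero
  rw [sinRoot_pi_eq_zero_iff]
  exact ⟨n, hn, by push_cast; rfl⟩

/-- A gap cannot cross a number `n²` with `n ≥ 1`, since these belong to the bands. -/
theorem mem_cell_of_uIcc_subset {α : ℝ} {n : ℕ} {x y : ℝ} (hx : x ∈ cell n)
    (h : Set.uIcc x y ⊆ {t : ℝ | (t : ℂ) ∉ band α}) : y ∈ cell n := by
  obtain ⟨h1, h2⟩ := hx
  constructor
  · rcases Nat.eq_zero_or_pos n with h0 | h0
    · exact Or.inl h0
    · right
      by_contra hn
      have hlt := h1.resolve_left h0.ne'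
      refine h (Set.mem_uIcc.2 (Or.inr ⟨not_lt.1 hn, hlt.le⟩)) (natCast_sq_mem_band α h0)
  · by_contra hn
    refine h (Set.mem_uIcc.2 (Or.inl ⟨h2.le, not_lt.1 hn⟩)) ?_
    have := natCast_sq_mem_band α (n := n + 1) (by omega)
    push_cast at this ⊢
    exact this

/-- In a gap where the factors are positive, an attractive impurity creates exactly one
eigenvalue. -/
theorem hasUniqueSimpleEigenvalueIn_of_neg (A : ℤ) {α γ : ℝ} (hγ : γ < 0) {x : ℝ}
    (hx : (x : ℂ) ∉ band α) (hP : 0 < lowFac α x) (hQ : 0 < upFac α x) :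
    UnboundedOp.HasUniqueSimpleEigenvalueIn (impurityHamiltonian A α γ)
      (connectedComponentIn {y : ℝ | (y : ℂ) ∉ band α} x) := by
  obtain ⟨n, hn⟩ := exists_mem_cell (notMem_band_iff.1 hx).1
  have hγ2 : 0 < γ ^ 2 / 16 := by
    have := hγ.ne
    positivity
  obtain ⟨E, hE, hEP, hEQ, hEt⟩ := exists_pos_fac_mul_eq α hn hP hQ hγ2
  -- Both factors decrease, so between `x` and `E` each is at least its positive value at the right
  -- end. Hence `E` lies in the same gap as `x`.
  have hmem : ∀ t ∈ Set.uIcc x E, (t : ℂ) ∉ band α := by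
    intro t ht
    have htc : t ∈ cell n := (ordConnected_cell n).uIcc_subset hn hE ht
    refine notMem_band_iff.2 ⟨sinR_ne_zero_of_mem_cell htc, mul_pos ?_ ?_⟩ <;>
    · rcases Set.mem_uIcc.1 ht with h | h
      · first
        | exact hEP.trans_le ((strictAntiOn_lowFac α n).antitoneOn htc hE h.2)
        | exact hEQ.trans_le ((strictAntiOn_upFac α n).antitoneOn htc hE h.2)
      · first
        | exact hP.trans_le ((strictAntiOn_lowFac α n).antitoneOn htc hn h.2)
        | exact hQ.trans_le ((strictAntiOn_upFac α n).antitoneOn htc hn h.2)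
  have hEb : (E : ℂ) ∉ band α := hmem E Set.right_mem_uIcc
  have hEe : UnboundedOp.IsEigenvalue (impurityHamiltonian A α γ) (E : ℂ) :=
    (isEigenvalue_real_iff A hEb).2 ⟨hEt, mul_neg_of_neg_of_pos hγ hEP⟩
  refine ⟨E, (mem_connectedComponentIn_iff_uIcc_subset hx).2 hmem,
    isSimpleEigenvalue_of_notMem_band A hEb hEe, fun y hy hye => ?_⟩
  have hy' := (mem_connectedComponentIn_iff_uIcc_subset hx).1 hy
  exact eigenvalue_unique_in_cell A (mem_cell_of_uIcc_subset hn hy') hE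
    (hy' Set.right_mem_uIcc) hEb hye hEe

/-- In a gap where the factors are negative, a repulsive impurity creates exactly one
eigenvalue. -/
theorem hasUniqueSimpleEigenvalueIn_of_pos (A : ℤ) {α γ : ℝ} (hγ : 0 < γ) {x : ℝ}
    (hx : (x : ℂ) ∉ band α) (hP : lowFac α x < 0) (hQ : upFac α x < 0) :
    UnboundedOp.HasUniqueSimpleEigenvalueIn (impurityHamiltonian A α γ)
      (connectedComponentIn {y : ℝ | (y : ℂ) ∉ band α} x) := by
  obtain ⟨n, hn⟩ := exists_mem_cell (notMem_band_iff.1 hx).1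
  obtain ⟨E, hE, hEP, hEQ, hEt⟩ := exists_neg_fac_mul_eq α hn hP hQ
    (by positivity : 0 < γ ^ 2 / 16)
  have hmem : ∀ t ∈ Set.uIcc x E, (t : ℂ) ∉ band α := by
    intro t ht
    have htc : t ∈ cell n := (ordConnected_cell n).uIcc_subset hn hE ht
    refine notMem_band_iff.2 ⟨sinR_ne_zero_of_mem_cell htc, mul_pos_of_neg_of_neg ?_ ?_⟩ <;>
    · rcases Set.mem_uIcc.1 ht with h | h
      · first
        | exact ((strictAntiOn_lowFac α n).antitoneOn hn htc h.1).trans_lt hP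
        | exact ((strictAntiOn_upFac α n).antitoneOn hn htc h.1).trans_lt hQ
      · first
        | exact ((strictAntiOn_lowFac α n).antitoneOn hE htc h.1).trans_lt hEP
        | exact ((strictAntiOn_upFac α n).antitoneOn hE htc h.1).trans_lt hEQ
  have hEb : (E : ℂ) ∉ band α := hmem E Set.right_mem_uIcc
  have hEe : UnboundedOp.IsEigenvalue (impurityHamiltonian A α γ) (E : ℂ) :=
    (isEigenvalue_real_iff A hEb).2 ⟨hEt, mul_neg_of_pos_of_neg hγ hEP⟩
  refine ⟨E, (mem_connectedComponentIn_iff_uIcc_subset hx).2 hmem,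
    isSimpleEigenvalue_of_notMem_band A hEb hEe, fun y hy hye => ?_⟩
  have hy' := (mem_connectedComponentIn_iff_uIcc_subset hx).1 hy
  exact eigenvalue_unique_in_cell A (mem_cell_of_uIcc_subset hn hy') hE
    (hy' Set.right_mem_uIcc) hEb hye hEe

theorem mem_firstGap_iff (A : ℤ) (α γ : ℝ) {x : ℝ} :
    x ∈ UnboundedOp.firstGap (impurityHamiltonian A α γ) ↔ ∀ y ≤ x, (y : ℂ) ∉ band α := by
  rw [UnboundedOp.firstGap, essSpectrum_impurityHamiltonian]
  exact ⟨fun h y hy hb => absurd (h y hb) (not_lt.2 hy),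
    fun h y hb => lt_of_not_ge fun hy => h y hy hb⟩

theorem connectedComponentIn_eq_firstGap (A : ℤ) (α γ : ℝ) {x : ℝ}
    (hx : x ∈ UnboundedOp.firstGap (impurityHamiltonian A α γ)) :
    connectedComponentIn {y : ℝ | (y : ℂ) ∉ band α} x =
      UnboundedOp.firstGap (impurityHamiltonian A α γ) := by
  have hx' := (mem_firstGap_iff A α γ).1 hx
  ext y
  rw [mem_connectedComponentIn_iff_uIcc_subset (hx' x le_rfl), mem_firstGap_iff]
  constructor
  · intro h t ht
    rcases le_total t x with h1 | h1
    · exact hx' t h1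
    · exact h (Set.mem_uIcc.2 (Or.inl ⟨h1, ht⟩))
  · intro h t ht
    rcases Set.mem_uIcc.1 ht with h1 | h1
    · exact h t h1.2
    · exact hx' t h1.2

theorem mem_firstGap_of_fac_pos (A : ℤ) {α : ℝ} (γ : ℝ) {x : ℝ} (hx : x ∈ cell 0)
    (hP : 0 < lowFac α x) (hQ : 0 < upFac α x) :
    x ∈ UnboundedOp.firstGap (impurityHamiltonian A α γ) := by
  rw [mem_firstGap_iff]
  intro y hy
  have hyc : y ∈ cell 0 := ⟨Or.inl rfl, hy.trans_lt hx.2⟩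
  exact notMem_band_iff.2 ⟨sinR_ne_zero_of_mem_cell hyc,
    mul_pos (hP.trans_le ((strictAntiOn_lowFac α 0).antitoneOn hyc hx hy))
      (hQ.trans_le ((strictAntiOn_upFac α 0).antitoneOn hyc hx hy))⟩

theorem mem_cell_zero_of_mem_firstGap {A : ℤ} {α γ x : ℝ}
    (hx : x ∈ UnboundedOp.firstGap (impurityHamiltonian A α γ)) : x ∈ cell 0 := by
  refine ⟨Or.inl rfl, lt_of_not_ge fun h => ?_⟩
  refine (mem_firstGap_iff A α γ).1 hx _ h ?_
  simpa using natCast_sq_mem_band α (n := 1) le_rfl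

/-- Far to the left both factors are positive. Were they negative at `x`, `lowFac` would vanish
somewhere below `x`, giving a band point below `x`. -/
theorem fac_pos_of_mem_firstGap {A : ℤ} {α γ x : ℝ}
    (hx : x ∈ UnboundedOp.firstGap (impurityHamiltonian A α γ)) :
    0 < lowFac α x ∧ 0 < upFac α x := by
  have hc := mem_cell_zero_of_mem_firstGap hx
  have hx' := (mem_firstGap_iff A α γ).1 hx
  refine (fac_same_sign (hx' x le_rfl)).resolve_right fun h => ?_
  obtain ⟨y, hy, hPy, hQy⟩ := exists_neg_fac_pos α
  have hle : y ≤ x := by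
    by_contra hn
    have := strictAntiOn_lowFac α 0 hc hy (not_le.1 hn)
    linarith
  have hsub : Set.Icc y x ⊆ cell 0 := (ordConnected_cell 0).out hy hc
  obtain ⟨t, ht, h0⟩ := intermediate_value_Icc' hle ((continuousOn_lowFac α 0).mono hsub)
    ⟨h.1.le, hPy.le⟩
  have := (notMem_band_iff.1 (hx' t ht.2)).2
  rw [h0, zero_mul] at this
  exact lt_irrefl 0 this

theorem eigenvalue_in_band (A : ℤ) {α γ : ℝ} {z : ℂ} (hz : z ∈ band α)
    (he : UnboundedOp.IsEigenvalue (impurityHamiltonian A α γ) z) :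
    z ∈ UnboundedOp.essSpectrum (impurityHamiltonian A α γ) ∧
      ∃ n : ℕ, 1 ≤ n ∧ z = (n : ℂ) ^ 2 := by
  refine ⟨mem_essSpectrum_of_mem_band A γ hz, sinRoot_pi_eq_zero_iff.1 ?_⟩
  by_contra hs
  exact not_isEigenvalue_of_mem_band A hz hs he

end RingChain
end

/-! ### The theorem, by the signs of `α` and `γ` -/

open RingChain in
theorem mainTheorem6 (A : ℤ) (α γ : ℝ) :
    (UnboundedOp.essSpectrum (RingChain.impurityHamiltonian A α γ) =
        UnboundedOp.essSpectrum (RingChain.periodicHamiltonian A α) ∧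
      UnboundedOp.essSpectrum (RingChain.impurityHamiltonian A α γ) =
        UnboundedOp.spectrum (RingChain.periodicHamiltonian A α)) ∧
    (0 < α → 0 < γ →
      ∀ z : ℂ, UnboundedOp.IsEigenvalue (RingChain.impurityHamiltonian A α γ) z →
        z ∈ UnboundedOp.essSpectrum (RingChain.impurityHamiltonian A α γ) ∧
          ∃ n : ℕ, 1 ≤ n ∧ z = (n : ℂ) ^ 2) ∧
    (0 < α → γ < 0 →
      ∀ G : Set ℝ, UnboundedOp.IsGap (RingChain.impurityHamiltonian A α γ) G →
        UnboundedOp.HasUniqueSimpleEigenvalueIn (RingChain.impurityHamiltonian A α γ) G) ∧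
    (α < 0 → 0 < γ →
      (∀ G : Set ℝ, UnboundedOp.IsGap (RingChain.impurityHamiltonian A α γ) G →
        G ≠ UnboundedOp.firstGap (RingChain.impurityHamiltonian A α γ) →
          UnboundedOp.HasUniqueSimpleEigenvalueIn (RingChain.impurityHamiltonian A α γ) G) ∧
      ∀ x ∈ UnboundedOp.firstGap (RingChain.impurityHamiltonian A α γ),
        ¬ UnboundedOp.IsEigenvalue (RingChain.impurityHamiltonian A α γ) (x : ℂ)) ∧
    (α < 0 → γ < 0 →
      ∃ E ∈ UnboundedOp.firstGap (RingChain.impurityHamiltonian A α γ),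
        UnboundedOp.IsSimpleEigenvalue (RingChain.impurityHamiltonian A α γ) (E : ℂ) ∧
        ∀ z : ℂ, UnboundedOp.IsEigenvalue (RingChain.impurityHamiltonian A α γ) z →
          z = (E : ℂ) ∨
          (z ∈ UnboundedOp.essSpectrum (RingChain.impurityHamiltonian A α γ) ∧
          ∃ n : ℕ, 1 ≤ n ∧ z = (n : ℂ) ^ 2)) := by
  have hess := essSpectrum_impurityHamiltonian A α γ
  refine ⟨⟨?_, ?_⟩, fun hα hγ z hz => ?_, fun hα hγ G hG => ?_,
    fun hα hγ => ⟨fun G hG hne => ?_, fun x hx he => ?_⟩, fun hα hγ => ?_⟩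
  · rw [hess, periodicHamiltonian_eq, essSpectrum_impurityHamiltonian]
  · rw [hess, spectrum_periodicHamiltonian]
  · by_cases hb : z ∈ band α
    · exact eigenvalue_in_band A hb hz
    · rw [eq_ofReal_of_isEigenvalue hz] at hb hz
      obtain ⟨hP, hQ, -⟩ := isEigenvalue_neg_of_pos A hγ hb hz
      exact (not_both_neg hα (notMem_band_iff.1 hb).1 hP hQ).elim
  · obtain ⟨x, hx, rfl⟩ := hG
    rw [hess] at hx ⊢
    rcases fac_same_sign hx with h | h
    · exact hasUniqueSimpleEigenvalueIn_of_neg A hγ hx h.1 h.2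
    · exact (not_both_neg hα (notMem_band_iff.1 hx).1 h.1 h.2).elim
  · obtain ⟨x, hx, rfl⟩ := hG
    rw [hess] at hx hne ⊢
    rcases fac_same_sign hx with h | h
    · exfalso
      -- Positive factors place `x` in the first gap, which is excluded here.
      have hx0 := neg_of_fac_pos hα (notMem_band_iff.1 hx).1 h.1 h.2
      have hc : x ∈ cell 0 := ⟨Or.inl rfl, by norm_num; linarith⟩
      exact hne (connectedComponentIn_eq_firstGap A α γ
        (mem_firstGap_of_fac_pos A γ hc h.1 h.2))
    · exact hasUniqueSimpleEigenvalueIn_of_pos A hγ hx h.1 h.2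
  · have hb := (mem_firstGap_iff A α γ).1 hx x le_rfl
    have h1 := (fac_pos_of_mem_firstGap hx).1
    have h2 := (isEigenvalue_neg_of_pos A hγ hb he).1
    linarith
  · obtain ⟨x, hxc, hP, hQ⟩ := exists_neg_fac_pos α
    have hx := mem_firstGap_of_fac_pos A γ hxc hP hQ
    have hxb := (mem_firstGap_iff A α γ).1 hx x le_rfl
    obtain ⟨E, hE, hEs, hEu⟩ := hasUniqueSimpleEigenvalueIn_of_neg A hγ hxb hP hQ
    rw [connectedComponentIn_eq_firstGap A α γ hx] at hE hEu
    refine ⟨E, hE, hEs, fun z hz => ?_⟩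
    by_cases hb : z ∈ band α
    · exact Or.inr (eigenvalue_in_band A hb hz)
    · left
      have hzr := eq_ofReal_of_isEigenvalue hz
      rw [hzr] at hb hz
      obtain ⟨hzP, hzQ, -⟩ := isEigenvalue_pos_of_neg A hγ hb hz
      -- An eigenvalue off the bands has positive factors, hence lies in the first gap, where `E` is
      -- the only one.
      have hz0 := neg_of_fac_pos hα (notMem_band_iff.1 hb).1 hzP hzQ
      have hzc : z.re ∈ cell 0 := ⟨Or.inl rfl, by norm_num; linarith⟩
      rw [hzr, hEu z.re (mem_firstGap_of_fac_pos A γ hzc hzP hzQ) hz]
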